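/- For $n\ge 1$ let $\Pi^{\rm even}_{2n}$ be the poset of partitions of $\{1,\dots,2n\}$ all of whose blocks have even size, ordered by refinement; its top element $\hat 1$ is the one-block partition. Let $\bar\Pi^{\rm even}_{2n}=\Pi^{\rm even}_{2n}\setminus\{\hat 1\}$ be its proper part, and let $\Pi^{\rm even}_{2n}\cup\{\hat 0\}$ be obtained by adjoining a new bottom element. Associate with each partition the word obtained by listing the elements of each block in increasing order and then listing the blocks in lexicographic order. Let $E_m$ be the Euler number, i.e. the number of permutations $\sigma\in\mathfrak S_m$ with $\sigma(1)<\sigma(2)>\sigma(3)<\cdots$. A recursive atom ordering of a bounded poset $P$ of length at least $1$ is an ordering $a_1,\dots,a_t$ of its atoms such that, if the length of $P$ is greater than $1$: (i) for each $j$ the interval $[a_j,\hat 1]$ admits a recursive atom ordering in which the atoms of $[a_j,\hat 1]$ lying above some $a_i$ with $i<j$ come first; (ii) whenever $i<j$ and $a_i,a_j<y$, there are $k<j$ and an atom $z$ of $[a_j,\hat 1]$ with $a_k<z\le y$. Then for every $n\ge 1$: 1. The lexicographic order of the associated words is a recursive atom ordering of $\Pi^{\rm even}_{2n}\cup\{\hat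 0\}$. 2. The order complex of $\bar\Pi^{\rm even}_{2n}$ is pure of dimension $n-2$ and shellable, i.e. its facets can be ordered $F_1,\dots,F_t$ so that for $2\le k\le t$ the complex $\left(\bigcup_{i<k}\langle F_i\rangle\right)\cap\langle F_k\rangle$ is pure of dimension $\dim F_k-1$. 3. The order complex of $\bar\Pi^{\rm even}_{2n}$ has the homotopy type of a wedge of $E_{2n-1}$ spheres of dimension $n-2$ (for $n=1$ it is the empty space, viewed as the sphere $S^{-1}$). 4. Over every integral domain $\mathbf k$ (e.g. $\mathbb Z$ or a field), the reduced Betti numbers, that is, the ranks of the reduced homology of the order complex with coefficients in $\mathbf k$, are $\tilde\beta_{n-2}(\bar\Pi^{\rm even}_{2n})=E_{2n-1}$ and $\tilde\beta_i(\bar\Pi^{\rm even}_{2n})=0$ for $i\ne n-2$. Moreover, with $\beta_{2n}=\tilde\beta_{n-2}(\bar\Pi^{\rm even}_{2n})$, one has the identities of formal power series over $\mathbb Q$ $$\sum_{n\ge1}\beta_{2n}\frac{u^{2n}}{(2n)!}=-\ln(\cos u),\qquad \sum_{n\ge1}\beta_{2n}\frac{u^{2n-1}}{(2n-1)!}=\tan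 u .$$ -/

import Mathlib

open scoped Nat ContinuousMap

noncomputable section

/-! ### The even block size partition poset -/

/-- `EvenPartition n` is the poset of set partitions of a `2n`-element set all of whose blocks have
even size, ordered by refinement (`π ≤ ρ` when every block of `π` lies in a block of `ρ`). -/
abbrev EvenPartition (n : ℕ) : Type :=
  {π : Finpartition (Finset.univ : Finset (Fin (2 * n))) // ∀ B ∈ π.parts, Even B.card}

/-- The top element is the partition with a single block. -/
instance EvenPartition.instOrderTop (n : ℕ) : OrderTop (EvenPartition n) where
  top := ⟨⊤, fun B hB => by
    have h := Finpartition.parts_top_subset (Finset.univ : Finset (Fin (2 * n))) hB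
    rw [Finset.mem_singleton] at h
    subst h
    simp⟩
  le_top π := by
    show π.1 ≤ ⊤
    exact le_top

/-- The proper part of the even block size partition poset: the poset with its top element removed. -/
abbrev EvenPartitionProper (n : ℕ) : Type :=
  {π : EvenPartition n // π ≠ ⊤}

/-- The word of a partition: the elements of each block are listed in increasing order, and the
blocks are then listed in lexicographic order. -/
def EvenPartition.word {n : ℕ} (π : EvenPartition n) : List (Fin (2 * n)) :=
  ((π.1.parts.image fun B => B.sort (· ≤ ·)).sort (· ≤ ·)).flatten

/-! ### Recursive atom orderings -/

/-- `IsRecursiveAtomOrdering x l` says that the list `l` is a recursive atom ordering of the bounded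
poset `[x, ⊤]`; its atoms are the elements covering `x`.  Either `[x, ⊤]` has length one, or its
length is greater than one, `l` lists the atoms without repetition, and conditions (i), (ii) hold:

(i) for every atom `aⱼ` the list `L j` is a recursive atom ordering of `[aⱼ, ⊤]` in which the atoms
  that lie above some earlier `aᵢ` come first;

(ii) if `i < j` and `aᵢ, aⱼ < y`, then there are `k < j` and an atom `z` of `[aⱼ, ⊤]` with
  `aₖ < z ≤ y`. -/
inductive IsRecursiveAtomOrdering {P : Type*} [PartialOrder P] [OrderTop P] : P → List P → Prop
  | length_one (x : P) (hx : x ⋖ ⊤) : IsRecursiveAtomOrdering x [⊤]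
  | step (x : P) (l : List P) (hx : x < ⊤) (hx' : ¬ x ⋖ ⊤)
      (nodup : l.Nodup) (mem_iff : ∀ a, a ∈ l ↔ x ⋖ a)
      (L : Fin l.length → List P)
      (rec_ordering : ∀ j, IsRecursiveAtomOrdering (l.get j) (L j))
      (come_first : ∀ j, (L j).Pairwise fun z w =>
        (∃ i < j, l.get i ≤ w) → ∃ i < j, l.get i ≤ z)
      (exchange : ∀ i j, i < j → ∀ y, l.get i < y → l.get j < y →
        ∃ k < j, ∃ z, l.get j ⋖ z ∧ l.get k < z ∧ z ≤ y) :
      IsRecursiveAtomOrdering x l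

/-! ### Simplicial complexes -/

/-- The order complex of a poset: its faces are the nonempty finite chains. -/
def orderComplex (P : Type*) [PartialOrder P] : AbstractSimplicialComplex P where
  faces := {s | s.Nonempty ∧ IsChain (· ≤ ·) (s : Set P)}
  isRelLowerSet_faces := fun {_} hs =>
    ⟨hs.1, fun _ ht hne => ⟨hne, hs.2.mono (Finset.coe_subset.2 ht)⟩⟩
  singleton_mem v := ⟨Finset.singleton_nonempty v, by simp⟩

namespace AbstractSimplicialComplex

/-- The facets are the maximal faces. -/
def IsFacet {V : Type*} (K : AbstractSimplicialComplex V) (F : Finset V) : Prop :=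
  Maximal (· ∈ K) F

/-- The complex is pure of dimension `d`: every facet has `d + 1` vertices. -/
def IsPureOfDim {V : Type*} (K : AbstractSimplicialComplex V) (d : ℤ) : Prop :=
  ∀ F, K.IsFacet F → (F.card : ℤ) = d + 1

/-- A shelling is an ordering `F₁, …, Fₜ` of the facets such that for `k ≥ 2` the complex
`(⟨F₁⟩ ∪ ⋯ ∪ ⟨Fₖ₋₁⟩) ∩ ⟨Fₖ⟩` is pure of dimension `dim Fₖ - 1`.  Here the intersection is taken with
its empty face, so that two facets may meet in the complex `{∅}` of dimension `-1`. -/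
def IsShelling {V : Type*} (K : AbstractSimplicialComplex V) (l : List (Finset V)) : Prop :=
  l.Nodup ∧ (∀ F, F ∈ l ↔ K.IsFacet F) ∧
    ∀ k : Fin l.length, 0 < k.val →
      ∀ G, Maximal (fun G : Finset V => G ⊆ l.get k ∧ ∃ i < k, G ⊆ l.get i) G →
        G.card + 1 = (l.get k).card

/-- A (finite) simplicial complex is shellable if it has a shelling. -/
def Shellable {V : Type*} (K : AbstractSimplicialComplex V) : Prop :=
  ∃ l, K.IsShelling l

/-- The geometric realization of a simplicial complex on a finite vertex set `V`: the points of
`ℝ^V` with nonnegative coordinates of sum `1` that are supported on a face. -/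
def realization {V : Type*} [Finite V] (K : AbstractSimplicialComplex V) : Set (V → ℝ) :=
  {w | (∀ v, 0 ≤ w v) ∧ ∃ s ∈ K, (∀ v ∉ s, w v = 0) ∧ ∑ v ∈ s, w v = 1}

end AbstractSimplicialComplex

/-! ### Reduced homology of a poset -/

/-- The chains `x₀ < ⋯ < x_{m-1}` with `m` elements of `P`, i.e. the `(m-1)`-dimensional faces of the
order complex (for `m = 0` the empty chain), generate the module of `(m-1)`-chains. -/
abbrev OrderChain (k : Type*) [CommRing k] (P : Type*) [PartialOrder P] (m : ℕ) : Type _ :=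
  (Fin m ↪o P) →₀ k

/-- The boundary `∂(x₀ < ⋯ < xₘ) = ∑ᵢ (-1)ⁱ (x₀ < ⋯ < x̂ᵢ < ⋯ < xₘ)`. -/
def orderBoundary (k : Type*) [CommRing k] (P : Type*) [PartialOrder P] (m : ℕ) :
    OrderChain k P (m + 1) →ₗ[k] OrderChain k P m :=
  Finsupp.linearCombination k fun c : Fin (m + 1) ↪o P =>
    ∑ i : Fin (m + 1), Finsupp.single ((Fin.succAboveOrderEmb i).trans c) ((-1 : k) ^ i.val)

/-- The cycles of dimension `m - 1`. -/
def orderCycles (k : Type*) [CommRing k] (P : Type*) [PartialOrder P] :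
    (m : ℕ) → Submodule k (OrderChain k P m)
  | 0 => ⊤
  | m + 1 => LinearMap.ker (orderBoundary k P m)

/-- The quotient `Z / (B ∩ Z)` of two submodules of a module; for `B ≤ Z` this is `Z / B`. -/
abbrev Subquotient {k M : Type*} [CommRing k] [AddCommGroup M] [Module k M]
    (Z B : Submodule k M) : Type _ :=
  Z ⧸ B.submoduleOf Z

/-- The rank of `Z / B`. -/
def subquotientRank {k M : Type*} [CommRing k] [AddCommGroup M] [Module k M]
    (Z B : Submodule k M) : ℕ :=
  Module.finrank k (Subquotient Z B)

/-- The reduced Betti number of (the order complex of) `P` in dimension `i`: the rank of the reduced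
homology, i.e. of the cycles modulo the boundaries.  It is zero for `i < -1`. -/
def reducedBetti (k : Type*) [CommRing k] (P : Type*) [PartialOrder P] (i : ℤ) : ℕ :=
  if i < -1 then 0
  else subquotientRank (orderCycles k P (i + 1).toNat)
    (LinearMap.range (orderBoundary k P (i + 1).toNat))

/-! ### Wedges of spheres -/

/-- The first unit vector of `ℝ^m`, used as base point of the unit sphere `S^{m-1}` if `m ≥ 1`. -/
def sphereBase (m : ℕ) : EuclideanSpace ℝ (Fin m) :=
  WithLp.toLp 2 fun i => if i.val = 0 then 1 else 0

/-- Identify the base points of the `r` copies of `S^{m-1}`. -/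
def wedgeSetoid (r m : ℕ) :
    Setoid (Fin r × Metric.sphere (0 : EuclideanSpace ℝ (Fin m)) 1) where
  r x y := x = y ∨ (x.2.1 = sphereBase m ∧ y.2.1 = sphereBase m)
  iseqv :=
    { refl := fun _ => Or.inl rfl
      symm := by
        rintro x y (h | h)
        · exact Or.inl h.symm
        · exact Or.inr ⟨h.2, h.1⟩
      trans := by
        rintro x y z (rfl | h) (rfl | h')
        · exact Or.inl rfl
        · exact Or.inr h'
        · exact Or.inr h
        · exact Or.inr ⟨h.1, h'.2⟩ }

/-- The wedge of `r ≥ 1` copies of the unit sphere `S^{m-1}` of `ℝ^m`, with the quotient topology.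
For `m = 0` the sphere `S^{-1}` is empty, and so is the wedge. -/
abbrev SphereWedge (r m : ℕ) : Type := Quotient (wedgeSetoid r m)

/-! ### Euler numbers -/

/-- A permutation `σ(1) … σ(m)` is alternating if it has ascents at all odd and descents at all even
positions: `σ(1) < σ(2) > σ(3) < ⋯`.  In the code the positions are counted from zero. -/
def IsAlternating {m : ℕ} (σ : Equiv.Perm (Fin m)) : Prop :=
  ∀ (i : ℕ) (h : i + 1 < m),
    (Even i → σ ⟨i, by omega⟩ < σ ⟨i + 1, h⟩) ∧ (Odd i → σ ⟨i + 1, h⟩ < σ ⟨i, by omega⟩)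

/-- The Euler number `E_m`: the number of alternating permutations of `m` letters. -/
def eulerNumber (m : ℕ) : ℕ := Nat.card {σ : Equiv.Perm (Fin m) // IsAlternating σ}

/-- The Betti number `β_{2n}` in dimension `n - 2` of the proper part of the even block size
partition poset. -/
def evenBetti (k : Type*) [CommRing k] (n : ℕ) : ℕ :=
  reducedBetti k (EvenPartitionProper n) ((n : ℤ) - 2)

end

/-! Recursive atom ordering. Covers among even partitions are exactly the merges of two blocks, so
the poset above any even partition is upper semimodular and every listing of atoms works there. Only
the bottom step is delicate. Its atoms are the perfect matchings. If `ρ` precedes `π` and both lie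
below `y`, they first differ at some `p` which is the smaller element of its pair in both, with
partners `q` in `ρ` and `q'` in `π`, where `q < q'`. Then `q` lies strictly inside the pair `{p,
q'}` of `π` and in the same block of `y`. Swapping two elements of the pairs of `π` through `p` and
`q` gives a matching with smaller word, and merging these two pairs gives the required atom `z ≤ y`
(`exists_isMin_word_lt`).

Shelling. A maximal chain is ranked by the index of its atom followed, recursively, by the rank of
its remainder in the upper interval. Lexicographic comparison of these index sequences gives a
shelling (`IsRecursiveAtomOrdering.exists_rank`).

Topology. When a facet `F` is added, its new faces are those containing its restriction `R`. If `R ≠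
F`, pushing mass from `R` to a vertex of `F` outside `R` collapses the new faces. If `R = F`, only
`F` itself is new. Setting the facets of the second kind aside leaves a contractible complex `A` to
which they are attached along their whole boundaries. Collapsing `A` to a point gives a wedge of
spheres. The same dichotomy, with coning from that vertex instead of pushing mass, shows that the
reduced homology vanishes below the top degree over any commutative ring. In both arguments the top
number is then read off from the Euler characteristic.

Euler characteristic. Give a block of size `m` the weight `(-1)^(m/2-1) E_{m-1}`, and a partition
the product of the weights of its blocks. By the recurrence `∑ (-1)^j C(2n+1, 2j+1) E_{2j+1} = 1`,
these products sum to one over each lower interval. Möbius inversion therefore identifies the weight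
of the one-block partition with the reduced Euler characteristic up to sign. The recurrence counts
permutations that alternate and then descend. It is also the coefficient form of `tan u * cos u =
sin u`, which gives both generating functions. -/

noncomputable section

/-! ### Euler numbers -/

/-- The permutation is alternating on the first `p` positions and has descents at all steps from
position `c` on. -/
def IsAltDesc {m : ℕ} (p c : ℕ) (σ : Equiv.Perm (Fin m)) : Prop :=
  ∀ (i : ℕ) (h : i + 1 < m),
    (i + 1 < p → (Even i ↔ σ ⟨i, by omega⟩ < σ ⟨i + 1, h⟩)) ∧
      (c ≤ i → σ ⟨i + 1, h⟩ < σ ⟨i, by omega⟩)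

theorem Equiv.Perm.lt_or_gt_succ {m : ℕ} (σ : Equiv.Perm (Fin m)) (i : ℕ) (h : i + 1 < m) :
    σ ⟨i, by omega⟩ < σ ⟨i + 1, h⟩ ∨ σ ⟨i + 1, h⟩ < σ ⟨i, by omega⟩ := by
  apply lt_or_gt_of_ne
  intro e
  have := σ.injective e
  simp at this

theorem isAlternating_iff {m : ℕ} (σ : Equiv.Perm (Fin m)) :
    IsAlternating σ ↔ ∀ (i : ℕ) (h : i + 1 < m),
      (Even i ↔ σ ⟨i, by omega⟩ < σ ⟨i + 1, h⟩) := by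
  refine forall_congr' fun i => forall_congr' fun h => ?_
  have h1 := σ.lt_or_gt_succ i h
  constructor
  · rintro ⟨ha, hb⟩
    refine ⟨ha, fun hlt => ?_⟩
    by_contra hne
    exact absurd (hb (Nat.not_even_iff_odd.1 hne)) hlt.asymm
  · intro ha
    refine ⟨ha.1, fun ho => h1.resolve_left fun hlt => ?_⟩
    exact (Nat.not_even_iff_odd.2 ho) (ha.2 hlt)

theorem isAltDesc_self {m : ℕ} (σ : Equiv.Perm (Fin m)) :
    IsAltDesc m (m - 1) σ ↔ IsAlternating σ := by
  rw [isAlternating_iff]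
  refine forall_congr' fun i => forall_congr' fun h => ?_
  constructor
  · exact fun ha => ha.1 h
  · exact fun ha => ⟨fun _ => ha, fun hi => by omega⟩

/-- The number of permutations which alternate on the first `p` positions and descend from
position `c` on. -/
def altDescNumber (m p c : ℕ) : ℕ := Nat.card {σ : Equiv.Perm (Fin m) // IsAltDesc p c σ}

theorem altDescNumber_self (m : ℕ) : altDescNumber m m (m - 1) = eulerNumber m :=
  Nat.card_congr (Equiv.subtypeEquivRight isAltDesc_self)

theorem altDescNumber_one_zero (m : ℕ) : altDescNumber m 1 0 = 1 := by
  unfold altDescNumber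
  rw [Nat.card_eq_one_iff_unique]
  have hrev : IsAltDesc 1 0 (Fin.revPerm : Equiv.Perm (Fin m)) := by
    intro i h
    refine ⟨fun h => by omega, fun _ => ?_⟩
    simp [Fin.lt_def, Fin.val_rev]
    omega
  refine ⟨⟨fun σ τ => ?_⟩, ⟨⟨_, hrev⟩⟩⟩
  have key : ∀ σ : {σ : Equiv.Perm (Fin m) // IsAltDesc 1 0 σ}, ∀ i, σ.1 (Fin.rev i) = i := by
    rintro ⟨σ, hσ⟩ i
    rcases m with _ | m
    · exact i.elim0
    have hm : StrictMono fun i : Fin (m + 1) => σ (Fin.rev i) := by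
      rw [Fin.strictMono_iff_lt_succ]
      intro i
      have := (hσ (m - i - 1) (by omega)).2 (by omega)
      have e1 : Fin.rev i.castSucc = ⟨m - i - 1 + 1, by omega⟩ := by
        ext; simp only [Fin.val_rev, Fin.val_castSucc]; omega
      have e2 : Fin.rev i.succ = ⟨m - i - 1, by omega⟩ := by
        ext; simp only [Fin.val_rev, Fin.val_succ]; omega
      simp only [e1, e2]
      exact this
    have e := Finset.orderEmbOfFin_unique (s := Finset.univ) (k := m + 1) (by simp)
      (f := fun i => σ (Fin.rev i)) (by simp) hm
    have e' := Finset.orderEmbOfFin_unique (s := Finset.univ) (k := m + 1) (by simp)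
      (f := fun i => i) (by simp) strictMono_id
    exact (congrFun e i).trans (congrFun e' i).symm
  refine Subtype.ext (Equiv.ext fun i => ?_)
  have h1 := key σ (Fin.rev i)
  have h2 := key τ (Fin.rev i)
  rw [Fin.rev_rev] at h1 h2
  rw [h1, h2]

/-- Split by the one unconstrained step, from index `p - 1` to index `p`. A descent there lengthens
the descending tail. An ascent there continues the alternation because `p` is odd, and so does the
descent that follows it. -/
theorem altDescNumber_eq_add {m p : ℕ} (hp : Odd p) (hpm : p + 2 ≤ m) :
    altDescNumber m p p = altDescNumber m p (p - 1) + altDescNumber m (p + 2) (p + 1) := by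
  classical
  unfold altDescNumber
  obtain ⟨r, rfl⟩ := hp
  simp only [Nat.card_eq_fintype_card, Fintype.card_subtype]
  rw [← Finset.card_union_of_disjoint]
  · congr 1
    ext σ
    simp only [Finset.mem_filter, Finset.mem_univ, true_and, Finset.mem_union]
    constructor
    · intro hσ
      rcases σ.lt_or_gt_succ (2 * r) (by omega) with hlt | hlt
      · refine Or.inr fun i h => ⟨fun hi => ?_, fun hi => (hσ i h).2 (by omega)⟩
        by_cases h1 : i + 1 < 2 * r + 1
        · exact (hσ i h).1 h1
        obtain rfl | rfl : i = 2 * r ∨ i = 2 * r + 1 := by omega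
        · simpa using hlt
        · have := (hσ (2 * r + 1) h).2 le_rfl
          simpa using this.le
      · refine Or.inl fun i h => ⟨(hσ i h).1, fun hi => ?_⟩
        by_cases h1 : i = 2 * r
        · subst h1
          exact hlt
        · exact (hσ i h).2 (by omega)
    · rintro (hσ | hσ) i h
      · exact ⟨(hσ i h).1, fun hi => (hσ i h).2 (by omega)⟩
      · refine ⟨fun hi => (hσ i h).1 (by omega), fun hi => ?_⟩
        by_cases h1 : i = 2 * r + 1
        · subst h1
          refine (σ.lt_or_gt_succ _ h).resolve_left fun hlt => ?_
          have := ((hσ _ h).1 (by omega)).2 hlt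
          simp at this
        · exact (hσ i h).2 (by omega)
  · rw [Finset.disjoint_filter]
    intro σ _ h1 h2
    have h1 := (h1 (2 * r) (by omega)).2 (by omega)
    have h2 := ((h2 (2 * r) (by omega)).1 (by omega)).1 (by simp)
    exact h1.asymm h2

/-- Such a permutation amounts to the set `S` of its first `p` values, an alternating arrangement of
`S`, and the forced decreasing arrangement of the complement. -/
theorem altDescNumber_add_self (p q : ℕ) :
    altDescNumber (p + q) p p = (p + q).choose p * eulerNumber p := by
  classical
  let T := {S : Finset (Fin (p + q)) // S.card = p}
  have hT : Nat.card T = (p + q).choose p := by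
    rw [Nat.card_eq_fintype_card, Fintype.card_finset_len, Fintype.card_fin]
  have hc : ∀ S : T, S.1ᶜ.card = q := fun S => by
    rw [Finset.card_compl, S.2, Fintype.card_fin]; omega
  let g : T → Equiv.Perm (Fin p) → Fin (p + q) → Fin (p + q) := fun S τ =>
    Fin.addCases (fun i => S.1.orderEmbOfFin S.2 (τ i))
      (fun j => S.1ᶜ.orderEmbOfFin (hc S) (Fin.rev j))
  have hgl : ∀ S τ i, g S τ (Fin.castAdd q i) = S.1.orderEmbOfFin S.2 (τ i) :=
    fun S τ i => Fin.addCases_left i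
  have hgr : ∀ S τ j, g S τ (Fin.natAdd p j) = S.1ᶜ.orderEmbOfFin (hc S) (Fin.rev j) :=
    fun S τ j => Fin.addCases_right j
  have hlm : ∀ S τ i, g S τ (Fin.castAdd q i) ∈ S.1 := fun S τ i => by
    rw [hgl]; exact Finset.orderEmbOfFin_mem _ _ _
  have hrm : ∀ S τ j, g S τ (Fin.natAdd p j) ∉ S.1 := fun S τ i => by
    rw [hgr, ← Finset.mem_compl]; exact Finset.orderEmbOfFin_mem _ _ _
  have hg : ∀ S τ, Function.Injective (g S τ) := by
    intro S τ a b
    refine Fin.addCases (fun i => ?_) (fun i => ?_) a <;>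
      refine Fin.addCases (fun j => ?_) (fun j => ?_) b
    · rw [hgl, hgl]
      intro h
      simpa using h
    · intro h
      exact absurd (h ▸ hlm S τ i) (hrm S τ j)
    · intro h
      exact absurd (h ▸ hlm S τ j) (hrm S τ i)
    · rw [hgr, hgr]
      intro h
      simpa using h
  let G : T → Equiv.Perm (Fin p) → Equiv.Perm (Fin (p + q)) := fun S τ =>
    Equiv.ofBijective (g S τ) (Finite.injective_iff_bijective.1 (hg S τ))
  have hGalt : ∀ S τ, IsAlternating τ → IsAltDesc p p (G S τ) := by
    intro S τ hτ i h
    rw [isAlternating_iff] at hτ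
    constructor
    · intro hi
      rw [hτ i hi]
      change _ ↔ g S τ _ < g S τ _
      have e1 : (⟨i, by omega⟩ : Fin (p + q)) = Fin.castAdd q ⟨i, by omega⟩ := rfl
      have e2 : (⟨i + 1, h⟩ : Fin (p + q)) = Fin.castAdd q ⟨i + 1, hi⟩ := rfl
      rw [e1, e2, hgl, hgl]
      simp
    · intro hi
      change g S τ _ < g S τ _
      have e1 : (⟨i, by omega⟩ : Fin (p + q)) = Fin.natAdd p ⟨i - p, by omega⟩ := by
        ext; simp; omega
      have e2 : (⟨i + 1, h⟩ : Fin (p + q)) = Fin.natAdd p ⟨i + 1 - p, by omega⟩ := by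
        ext; simp; omega
      rw [e1, e2, hgr, hgr]
      simp [Fin.lt_def]
      omega
  let Φ : T × {τ : Equiv.Perm (Fin p) // IsAlternating τ} →
      {σ : Equiv.Perm (Fin (p + q)) // IsAltDesc p p σ} :=
    fun x => ⟨G x.1 x.2.1, hGalt _ _ x.2.2⟩
  have hbij : Function.Bijective Φ := by
    constructor
    · rintro ⟨S, τ, hτ⟩ ⟨S', τ', hτ'⟩ h
      have h1 : ∀ a, g S τ a = g S' τ' a := fun a =>
        congrArg (fun s : {σ : Equiv.Perm (Fin (p + q)) // IsAltDesc p p σ} => s.1 a) h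
      have hS : S = S' := by
        have key : ∀ S τ S' τ', (∀ a, g S τ a = g S' τ' a) → S.1 ⊆ S'.1 := by
          intro S τ S' τ' h1 x hx
          obtain ⟨a, rfl⟩ := (G S τ).surjective x
          change g S τ a ∈ _ at hx
          change g S τ a ∈ _
          revert hx
          refine Fin.addCases (fun i => ?_) (fun i => ?_) a
          · intro _
            rw [h1]
            exact hlm _ _ _
          · exact fun hx => absurd hx (hrm _ _ _)
        exact Subtype.ext ((key _ _ _ _ h1).antisymm (key _ _ _ _ fun a => (h1 a).symm))
      subst hS
      have hτ : τ = τ' := by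
        ext1 i
        have := h1 (Fin.castAdd q i)
        rw [hgl, hgl] at this
        simpa using this
      subst hτ
      rfl
    · rintro ⟨σ, hσ⟩
      let S : T := ⟨Finset.univ.image fun i : Fin p => σ (Fin.castAdd q i), by
        rw [Finset.card_image_of_injective, Finset.card_univ, Fintype.card_fin]
        intro i j h
        simpa using h⟩
      have hmem : ∀ i, σ (Fin.castAdd q i) ∈ S.1 := fun i =>
        Finset.mem_image_of_mem _ (Finset.mem_univ i)
      let t : Fin p → Fin p := fun i => (S.1.orderIsoOfFin S.2).symm ⟨σ (Fin.castAdd q i), hmem i⟩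
      have ht : Function.Injective t := by
        intro i j h
        simpa [t] using h
      let τ : Equiv.Perm (Fin p) := Equiv.ofBijective t (Finite.injective_iff_bijective.1 ht)
      have hl : ∀ i, S.1.orderEmbOfFin S.2 (τ i) = σ (Fin.castAdd q i) := by
        intro i
        change S.1.orderEmbOfFin S.2 (t i) = _
        rw [← Finset.coe_orderIsoOfFin_apply]
        simp [t]
      have hr : ∀ j, S.1ᶜ.orderEmbOfFin (hc S) (Fin.rev j) = σ (Fin.natAdd p j) := by
        have hm : StrictMono fun j : Fin q => σ (Fin.natAdd p (Fin.rev j)) := by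
          rcases q with _ | q
          · exact fun i => i.elim0
          rw [Fin.strictMono_iff_lt_succ]
          intro j
          have := (hσ (p + (q - j - 1)) (by omega)).2 (by omega)
          have e1 : Fin.natAdd p (Fin.rev j.castSucc) = ⟨p + (q - j - 1) + 1, by omega⟩ := by
            ext; simp only [Fin.val_natAdd, Fin.val_rev, Fin.val_castSucc]; omega
          have e2 : Fin.natAdd p (Fin.rev j.succ) = ⟨p + (q - j - 1), by omega⟩ := by
            ext; simp only [Fin.val_natAdd, Fin.val_rev, Fin.val_succ]; omega
          simp only [e1, e2]
          exact this
        have e := Finset.orderEmbOfFin_unique (hc S)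
          (f := fun j => σ (Fin.natAdd p (Fin.rev j))) (fun j => by
            simp only [S, Finset.mem_compl, Finset.mem_image, Finset.mem_univ, true_and, not_exists]
            intro i hi
            have := σ.injective hi
            simp [Fin.ext_iff] at this
            omega) hm
        intro j
        have := congrFun e (Fin.rev j)
        simp only [Fin.rev_rev] at this
        exact this.symm
      have hτ : IsAlternating τ := by
        rw [isAlternating_iff]
        intro i h
        rw [(hσ i (by omega)).1 h, ← (S.1.orderEmbOfFin S.2).lt_iff_lt, hl, hl]
        rfl
      refine ⟨(S, ⟨τ, hτ⟩), Subtype.ext (Equiv.ext fun a => ?_)⟩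
      change g S τ a = σ a
      refine Fin.addCases (fun i => ?_) (fun i => ?_) a
      · rw [hgl, hl]
      · rw [hgr, hr]
  have := Nat.card_eq_of_bijective Φ hbij
  rw [Nat.card_prod, hT] at this
  exact this.symm

/-- The recurrence for the Euler numbers of odd index, i.e. `tan u * cos u = sin u`. -/
theorem sum_choose_mul_eulerNumber (n : ℕ) :
    ∑ j ∈ Finset.range (n + 1),
      (-1 : ℤ) ^ j * ((2 * n + 1).choose (2 * j + 1) * eulerNumber (2 * j + 1) : ℕ) = 1 := by
  -- Write `a r` for the number on the right. The product in the `r`-th term is `a r + a (r + 1)`,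
  -- so the alternating sum telescopes from `a 0 = 1`. The last term of the full sum cancels the
  -- remainder since `a n = E_{2n+1}`.
  have key : ∀ r ≤ n, ∑ j ∈ Finset.range r,
      (-1 : ℤ) ^ j * ((2 * n + 1).choose (2 * j + 1) * eulerNumber (2 * j + 1) : ℕ) =
        1 - (-1 : ℤ) ^ r * altDescNumber (2 * n + 1) (2 * r + 1) (2 * r) := by
    intro r
    induction r with
    | zero => intro _; simp [altDescNumber_one_zero]
    | succ r ih =>
      intro hr
      rw [Finset.sum_range_succ, ih (by omega)]
      have h1 := altDescNumber_add_self (2 * r + 1) (2 * n + 1 - (2 * r + 1))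
      rw [show 2 * r + 1 + (2 * n + 1 - (2 * r + 1)) = 2 * n + 1 by omega] at h1
      rw [← h1, altDescNumber_eq_add ⟨r, rfl⟩ (by omega)]
      rw [show 2 * (r + 1) = 2 * r + 2 by ring, show 2 * r + 1 + 1 = 2 * r + 2 by ring,
        Nat.add_sub_cancel, show 2 * r + 1 + 2 = 2 * r + 2 + 1 by ring]
      push_cast
      ring
  rw [Finset.sum_range_succ, key n le_rfl]
  have := altDescNumber_self (2 * n + 1)
  rw [Nat.add_sub_cancel] at this
  rw [this]
  simp

theorem eulerNumber_pos (n : ℕ) : 0 < eulerNumber (2 * n + 1) := by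
  -- The word `0, n+1, 1, n+2, …, n`, with the small values at the even indices.
  let f : Fin (2 * n + 1) → Fin (2 * n + 1) := fun i =>
    if h : Even i.val then ⟨i / 2, by omega⟩ else ⟨n + 1 + i / 2, by
      rw [Nat.even_iff] at h
      omega⟩
  have hf : Function.Injective f := by
    intro i j h
    simp only [f] at h
    split_ifs at h with h1 h2 h2 <;> simp only [Fin.mk.injEq] at h <;> ext <;>
      grind
  rw [eulerNumber]
  have : Nonempty {σ : Equiv.Perm (Fin (2 * n + 1)) // IsAlternating σ} := by
    refine ⟨Equiv.ofBijective f (Finite.injective_iff_bijective.1 hf), fun i h => ⟨fun he => ?_,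
      fun ho => ?_⟩⟩
    · have : ¬ Even (i + 1) := by simpa [parity_simps] using he
      simp only [Equiv.ofBijective_apply, f, he, this, dif_pos, dif_neg, not_false_iff, Fin.mk_lt_mk]
      omega
    · have h1 : Even (i + 1) := by simpa [parity_simps] using ho
      have h2 : ¬ Even i := by simpa [parity_simps] using ho
      simp only [Equiv.ofBijective_apply, f, h1, h2, dif_pos, dif_neg, not_false_iff, Fin.mk_lt_mk]
      omega
  exact Nat.card_pos

/-! ### Generating functions -/

theorem Finset.sum_range_two_mul {M : Type*} [AddCommMonoid M] (f : ℕ → M) (N : ℕ) :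
    ∑ i ∈ Finset.range (2 * N), f i = ∑ a ∈ Finset.range N, (f (2 * a) + f (2 * a + 1)) := by
  induction N with
  | zero => simp
  | succ N ih =>
    rw [show 2 * (N + 1) = 2 * N + 1 + 1 by ring, Finset.sum_range_succ, Finset.sum_range_succ, ih,
      Finset.sum_range_succ, add_assoc]

/-- The exponential generating function of the Euler numbers of odd index is the tangent. -/
theorem mk_eulerNumber_mul_cos :
    (PowerSeries.mk fun m => if Odd m then (eulerNumber m : ℚ) / (m ! : ℚ) else 0) *
      PowerSeries.cos ℚ = PowerSeries.sin ℚ := by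
  ext m
  rw [PowerSeries.coeff_mul, Finset.Nat.sum_antidiagonal_eq_sum_range_succ_mk]
  simp only [PowerSeries.cos, PowerSeries.sin, PowerSeries.coeff_mk, eq_ratCast, Rat.cast_id]
  rcases Nat.even_or_odd m with hm | ⟨n, rfl⟩
  · rw [if_pos hm]
    refine Finset.sum_eq_zero fun i hi => ?_
    have hi := Nat.lt_succ_iff.1 (Finset.mem_range.1 hi)
    by_cases ho : Odd i
    · have : ¬ Even (m - i) := by
        rw [Nat.not_even_iff_odd]
        exact Nat.Even.sub_odd hi hm ho
      rw [if_neg this, mul_zero]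
    · rw [if_neg ho, zero_mul]
  · rw [show (2 * n + 1).succ = 2 * (n + 1) by omega, Finset.sum_range_two_mul]
    have hf : ((2 * n + 1)! : ℚ) ≠ 0 := by positivity
    rw [if_neg (by simp), show (2 * n + 1) / 2 = n by omega, eq_div_iff hf]
    -- The factor `(-1)^n` turns the sign `(-1)^a` of the recurrence into the sign `(-1)^(n-a)` of
    -- the cosine coefficient.
    have h := congrArg (fun z : ℤ => (z : ℚ) * (-1) ^ n) (sum_choose_mul_eulerNumber n)
    simp only [Int.cast_one, one_mul] at h
    rw [← h, Finset.sum_mul]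
    push_cast
    rw [Finset.sum_mul]
    refine Finset.sum_congr rfl fun a ha => ?_
    have ha := Nat.lt_succ_iff.1 (Finset.mem_range.1 ha)
    rw [if_neg (by simp), zero_mul, zero_add, if_pos (by simp),
      Nat.cast_choose ℚ (show 2 * a + 1 ≤ 2 * n + 1 by omega),
      show 2 * n + 1 - (2 * a + 1) = 2 * (n - a) by omega,
      show 2 * n - 2 * a = 2 * (n - a) by omega, if_pos (by simp),
      show 2 * (n - a) / 2 = n - a by omega]
    have h1 : (-1 : ℚ) ^ n = (-1) ^ (n - a) * (-1) ^ a := by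
      rw [← pow_add, Nat.sub_add_cancel ha]
    have h2 : ((-1 : ℚ) ^ a) * (-1) ^ a = 1 := by
      rw [← mul_pow]; simp
    have h3 : ((2 * a + 1)! : ℚ) ≠ 0 := by positivity
    have h4 : ((2 * (n - a))! : ℚ) ≠ 0 := by positivity
    rw [h1]
    field_simp
    linear_combination (-(eulerNumber (2 * a + 1) : ℚ)) * h2

theorem PowerSeries.constantCoeff_cos : PowerSeries.constantCoeff (PowerSeries.cos ℚ) = 1 := by
  rw [← PowerSeries.coeff_zero_eq_constantCoeff_apply]
  simp [PowerSeries.cos]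

theorem PowerSeries.derivative_cos :
    PowerSeries.derivative ℚ (PowerSeries.cos ℚ) = -PowerSeries.sin ℚ := by
  ext m
  simp only [PowerSeries.coeff_derivative, PowerSeries.cos, PowerSeries.sin, PowerSeries.coeff_mk,
    map_neg, eq_ratCast, Rat.cast_id]
  rcases Nat.even_or_odd m with hm | ⟨n, rfl⟩
  · rw [if_neg (by simpa [parity_simps] using hm), if_pos hm]
    simp
  · rw [if_pos (by simp [parity_simps]), if_neg (by simp), show (2 * n + 1 + 1) / 2 = n + 1 by omega,
      show (2 * n + 1) / 2 = n by omega, Nat.factorial_succ (2 * n + 1)]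
    have : ((2 * n + 1)! : ℚ) ≠ 0 := by positivity
    have : ((2 * n + 1 + 1 : ℕ) : ℚ) ≠ 0 := by positivity
    push_cast at *
    field_simp
    ring

/-- The chain rule, with `log' * (1 + X) = 1` evaluated at `X = f - 1`. The product form avoids
inverting `f`. -/
theorem PowerSeries.derivative_logOf_mul {f : PowerSeries ℚ} (hf : PowerSeries.constantCoeff f = 1) :
    PowerSeries.derivative ℚ (PowerSeries.logOf f) * f = PowerSeries.derivative ℚ f := by
  have hs : PowerSeries.HasSubst (f - 1) :=
    PowerSeries.HasSubst.of_constantCoeff_zero' (by simp [hf])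
  rw [PowerSeries.logOf_eq, PowerSeries.derivative_subst hs]
  have h1 : PowerSeries.derivative ℚ (PowerSeries.log ℚ) * (1 + PowerSeries.X) = 1 := by
    rw [PowerSeries.deriv_log]
    ext n
    rcases n with _ | n
    · simp
    · rw [mul_add, mul_one, map_add, PowerSeries.coeff_succ_mul_X]
      simp [pow_succ, PowerSeries.coeff_one]
  have h2 := congrArg (PowerSeries.subst (f - 1)) h1
  rw [PowerSeries.subst_mul hs, PowerSeries.subst_add hs, PowerSeries.subst_X hs] at h2
  have h3 : PowerSeries.subst (f - 1) (1 : PowerSeries ℚ) = 1 := by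
    rw [← PowerSeries.coe_substAlgHom hs, map_one]
  rw [h3, add_sub_cancel] at h2
  simp only [map_sub, Derivation.map_one_eq_zero, sub_zero]
  linear_combination PowerSeries.derivative ℚ f * h2

/-- The exponential generating function of the tangent numbers with shifted indices is
`-ln cos u`. -/
theorem mk_eulerNumber_pred :
    (PowerSeries.mk fun m => if Even m ∧ m ≠ 0 then (eulerNumber (m - 1) : ℚ) / (m ! : ℚ) else 0) =
      -PowerSeries.logOf (PowerSeries.cos ℚ) := by
  -- Both constant terms vanish, so it suffices to compare derivatives. After multiplication by the
  -- cosine this is the tangent identity.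
  apply PowerSeries.derivative.ext
  · have hc : PowerSeries.cos ℚ ≠ 0 := by
      intro h
      have := PowerSeries.constantCoeff_cos
      simp [h] at this
    refine mul_right_cancel₀ hc ?_
    rw [map_neg, neg_mul, PowerSeries.derivative_logOf_mul PowerSeries.constantCoeff_cos,
      PowerSeries.derivative_cos, neg_neg, ← mk_eulerNumber_mul_cos]
    congr 1
    ext m
    simp only [PowerSeries.coeff_derivative, PowerSeries.coeff_mk]
    have : Even (m + 1) ∧ m + 1 ≠ 0 ↔ Odd m := by simp [parity_simps]
    simp only [this]
    split_ifs
    · rw [Nat.factorial_succ, Nat.add_sub_cancel]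
      push_cast
      field_simp
    · simp
  · rw [map_neg, PowerSeries.constantCoeff_logOf PowerSeries.constantCoeff_cos,
      ← PowerSeries.coeff_zero_eq_constantCoeff_apply]
    simp

/-! ### Recursive atom orderings of semimodular posets -/

/-- When every listing of the atoms of the upper intervals is admissible, condition (i) is free:
list first the atoms lying above an earlier `aᵢ`, then the others. Only the exchange condition
remains to be supplied. -/
theorem IsRecursiveAtomOrdering.of_forall {P : Type*} [PartialOrder P] [OrderTop P] [Finite P]
    (x : P) (l : List P) (hx : x < ⊤) (hx' : ¬ x ⋖ ⊤) (nodup : l.Nodup)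
    (mem_iff : ∀ a, a ∈ l ↔ x ⋖ a)
    (hrec : ∀ a ∈ l, a < ⊤ → ∀ L : List P, L.Nodup → (∀ b, b ∈ L ↔ a ⋖ b) →
      IsRecursiveAtomOrdering a L)
    (exchange : ∀ i j : Fin l.length, i < j → ∀ y, l.get i < y → l.get j < y →
        ∃ k < j, ∃ z, l.get j ⋖ z ∧ l.get k < z ∧ z ≤ y) :
    IsRecursiveAtomOrdering x l := by
  classical
  have := Fintype.ofFinite P
  let early : Fin l.length → P → Prop := fun j w => ∃ i < j, l.get i ≤ w
  let C : Fin l.length → List P := fun j => (Finset.univ.filter (l.get j ⋖ ·)).toList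
  refine .step x l hx hx' nodup mem_iff
    (fun j => (C j).filter (early j ·) ++ (C j).filter (¬ early j ·)) (fun j => ?_) (fun j => ?_)
    exchange
  · have hj : x ⋖ l.get j := (mem_iff _).1 (l.get_mem j)
    refine hrec _ (l.get_mem j) (lt_top_iff_ne_top.2 fun h => hx' (h ▸ hj)) _ ?_ fun b => ?_
    · rw [List.nodup_append]
      refine ⟨(Finset.nodup_toList _).filter _, (Finset.nodup_toList _).filter _, ?_⟩
      intro a ha b hb hab
      subst hab
      simp only [List.mem_filter, decide_eq_true_eq] at ha hb
      exact hb.2 ha.2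
    · simp only [List.mem_append, List.mem_filter, decide_eq_true_eq, C, Finset.mem_toList,
        Finset.mem_filter, Finset.mem_univ, true_and]
      by_cases h : early j b <;> simp [h]
  · rw [List.pairwise_append]
    refine ⟨List.pairwise_of_forall_mem_list fun a ha b hb _ => ?_,
      List.pairwise_of_forall_mem_list fun a ha b hb h => ?_, fun a ha b hb _ => ?_⟩
    · simp only [List.mem_filter, decide_eq_true_eq] at ha
      exact ha.2
    · simp only [List.mem_filter, decide_eq_true_eq] at hb
      exact absurd h hb.2
    · simp only [List.mem_filter, decide_eq_true_eq] at ha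
      exact ha.2

/-- In an upper semimodular poset every listing of the atoms is a recursive atom ordering. -/
theorem IsRecursiveAtomOrdering.of_semimodular {P : Type*} [PartialOrder P] [OrderTop P] [Finite P]
    (x₀ : P) (h : ∀ x a b y : P, x₀ ≤ x → x ⋖ a → x ⋖ b → a ≠ b → a ≤ y → b ≤ y →
      ∃ z, b ⋖ z ∧ a < z ∧ z ≤ y) (x : P) :
    x₀ ≤ x → x < ⊤ → ∀ l : List P, l.Nodup → (∀ a, a ∈ l ↔ x ⋖ a) →
      IsRecursiveAtomOrdering x l := by
  induction x using (Finite.wellFounded_of_trans_of_irrefl (α := P) (· > ·)).induction with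
  | _ x ih =>
    intro h₀ hx l hl hmem
    by_cases hx' : x ⋖ ⊤
    · have : l = [⊤] := by
        have h1 : ∀ a ∈ l, a = ⊤ := fun a ha =>
          (eq_or_lt_of_le (le_top (a := a))).resolve_right
            fun hlt => hx'.2 ((hmem a).1 ha).lt hlt
        have h2 : (⊤ : P) ∈ l := (hmem _).2 hx'
        rw [List.eq_replicate_of_mem h1] at hl h2 ⊢
        have h3 := List.nodup_replicate.1 hl
        have h4 : l.length ≠ 0 := fun h0 => by simp [h0] at h2
        rw [show l.length = 1 by omega]
        rfl
      rw [this]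
      exact .length_one x hx'
    · refine .of_forall x l hx hx' hl hmem (fun a ha hat L hL hLm => ?_) ?_
      · have hxa := ((hmem a).1 ha).lt
        exact ih a hxa (h₀.trans hxa.le) hat L hL hLm
      -- Semimodularity lets the earlier atom `aᵢ` itself play the role of `aₖ`.
      · intro i j hij y hiy hjy
        obtain ⟨z, hz⟩ := h x (l.get i) (l.get j) y h₀ ((hmem _).1 (l.get_mem i))
          ((hmem _).1 (l.get_mem j)) (fun e => hij.ne (hl.injective_get e)) hiy.le hjy.le
        exact ⟨i, hij, z, hz⟩

/-! ### Merging two blocks of a partition -/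

namespace Finpartition

variable {α : Type*} [Fintype α] [DecidableEq α]

theorem le_iff_mem_part {P Q : Finpartition (Finset.univ : Finset α)} :
    P ≤ Q ↔ ∀ a b, a ∈ P.part b → a ∈ Q.part b := by
  constructor
  · intro h a b hab
    obtain ⟨c, hc, hPc⟩ := h (P.part_mem.2 (Finset.mem_univ b))
    have hb : b ∈ c := hPc (P.mem_part (Finset.mem_univ b))
    rw [Q.part_eq_of_mem hc hb]
    exact hPc hab
  · intro h B hB
    obtain ⟨b, hb⟩ := P.nonempty_of_mem_parts hB
    refine ⟨Q.part b, Q.part_mem.2 (Finset.mem_univ b), fun a ha => h a b ?_⟩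
    rwa [P.part_eq_of_mem hB hb]

theorem mem_part_comm (P : Finpartition (Finset.univ : Finset α)) {a b : α} :
    a ∈ P.part b ↔ b ∈ P.part a := by
  rw [P.mem_part_iff_part_eq_part (by simp) (by simp),
    P.mem_part_iff_part_eq_part (by simp) (by simp), eq_comm]

theorem mem_part_trans (P : Finpartition (Finset.univ : Finset α)) {a b c : α}
    (h : a ∈ P.part b) (h' : b ∈ P.part c) : a ∈ P.part c := by
  rw [P.mem_part_iff_part_eq_part (by simp) (by simp)] at *
  rw [h, h']

theorem mem_part_univ (P : Finpartition (Finset.univ : Finset α)) (a : α) : a ∈ P.part a :=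
  P.mem_part (Finset.mem_univ a)

/-- Join the blocks of `p` and `q`. -/
def merge (P : Finpartition (Finset.univ : Finset α)) (p q : α) :
    Finpartition (Finset.univ : Finset α) :=
  ofExistsUnique (insert (P.part p ∪ P.part q) ((P.parts.erase (P.part p)).erase (P.part q)))
    (fun _ _ => Finset.subset_univ _)
    (by
      intro a _
      by_cases ha : a ∈ P.part p ∪ P.part q
      · refine ⟨P.part p ∪ P.part q, ⟨Finset.mem_insert_self _ _, ha⟩, ?_⟩
        rintro t ⟨ht, hat⟩
        rcases Finset.mem_insert.1 ht with rfl | ht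
        · rfl
        simp only [Finset.mem_erase] at ht
        rcases Finset.mem_union.1 ha with h | h
        · exact absurd (P.eq_of_mem_parts ht.2.2 (by simp) hat h) ht.2.1
        · exact absurd (P.eq_of_mem_parts ht.2.2 (by simp) hat h) ht.1
      · simp only [Finset.mem_union, not_or] at ha
        refine ⟨P.part a, ⟨?_, P.mem_part_univ a⟩, ?_⟩
        · simp only [Finset.mem_insert, Finset.mem_erase]
          refine Or.inr ⟨fun h => ha.2 (h ▸ P.mem_part_univ a),
            fun h => ha.1 (h ▸ P.mem_part_univ a), by simp⟩
        · rintro t ⟨ht, hat⟩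
          rcases Finset.mem_insert.1 ht with rfl | ht
          · simp [ha] at hat
          simp only [Finset.mem_erase] at ht
          exact (P.part_eq_of_mem ht.2.2 hat).symm)
    (by
      simp only [Finset.mem_insert, Finset.mem_erase, P.empty_notMem_parts, and_false, or_false]
      intro h
      have := P.mem_part_univ p
      have h' : p ∈ P.part p ∪ P.part q := Finset.mem_union_left _ this
      rw [← h] at h'
      simp at h')

theorem parts_merge (P : Finpartition (Finset.univ : Finset α)) (p q : α) :
    (P.merge p q).parts =
      insert (P.part p ∪ P.part q) ((P.parts.erase (P.part p)).erase (P.part q)) := rfl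

/-- The universal property of the merge, valid also when `p` and `q` already share a block. Most
later order relations involving merges are deduced from it. -/
theorem merge_le_iff {P Q : Finpartition (Finset.univ : Finset α)} {p q : α} :
    P.merge p q ≤ Q ↔ P ≤ Q ∧ p ∈ Q.part q := by
  have hmem : P.part p ∪ P.part q ∈ (P.merge p q).parts := by
    rw [parts_merge]; exact Finset.mem_insert_self _ _
  constructor
  · intro h
    refine ⟨le_trans (fun B hB => ?_) h, ?_⟩
    · by_cases h1 : B = P.part p
      · exact ⟨_, hmem, h1 ▸ Finset.subset_union_left⟩
      by_cases h2 : B = P.part q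
      · exact ⟨_, hmem, h2 ▸ Finset.subset_union_right⟩
      refine ⟨B, ?_, le_rfl⟩
      rw [parts_merge]
      simp [h1, h2, hB]
    · obtain ⟨c, hc, hle⟩ := h hmem
      rw [Q.mem_part_iff_exists]
      exact ⟨c, hc, hle (Finset.mem_union_left _ (P.mem_part_univ p)),
        hle (Finset.mem_union_right _ (P.mem_part_univ q))⟩
  · rintro ⟨h, hpq⟩ B hB
    rw [parts_merge] at hB
    rcases Finset.mem_insert.1 hB with rfl | hB
    · refine ⟨Q.part q, by simp, Finset.union_subset (fun a ha => ?_) (fun a ha => ?_)⟩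
      · exact Q.mem_part_trans (le_iff_mem_part.1 h a p ha) hpq
      · exact le_iff_mem_part.1 h a q ha
    · simp only [Finset.mem_erase] at hB
      exact h hB.2.2

theorem card_parts_merge (P : Finpartition (Finset.univ : Finset α)) {p q : α}
    (h : p ∉ P.part q) : (P.merge p q).parts.card + 1 = P.parts.card := by
  have hne : P.part q ≠ P.part p := fun e => h (e ▸ P.mem_part_univ p)
  have hq : P.part q ∈ P.parts.erase (P.part p) := Finset.mem_erase.2 ⟨hne, by simp⟩
  rw [parts_merge, Finset.card_insert_of_notMem, Finset.card_erase_add_one hq,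
    Finset.card_erase_add_one (by simp)]
  simp only [Finset.mem_erase, not_and]
  intro h1 h2 h3
  have := P.part_eq_of_mem h3 (Finset.mem_union_left _ (P.mem_part_univ p))
  exact h2 this.symm

end Finpartition

/-! ### Covering relations between even partitions -/

namespace EvenPartition

variable {n : ℕ}

/-- Join the blocks of `p` and `q`. -/
def merge (π : EvenPartition n) (p q : Fin (2 * n)) : EvenPartition n :=
  ⟨π.1.merge p q, by
    intro B hB
    rw [Finpartition.parts_merge] at hB
    rcases Finset.mem_insert.1 hB with rfl | hB
    · have hp := π.2 (π.1.part p) (by simp)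
      have hq := π.2 (π.1.part q) (by simp)
      by_cases h : π.1.part p = π.1.part q
      · rwa [h, Finset.union_self]
      · have hd : Disjoint (π.1.part p) (π.1.part q) := π.1.disjoint
          (π.1.part_mem.2 (Finset.mem_univ p)) (π.1.part_mem.2 (Finset.mem_univ q)) h
        rw [Finset.card_union_of_disjoint hd]
        exact hp.add hq
    · simp only [Finset.mem_erase] at hB
      exact π.2 B hB.2.2⟩

theorem le_iff_mem_part {π ρ : EvenPartition n} :
    π ≤ ρ ↔ ∀ a b, a ∈ π.1.part b → a ∈ ρ.1.part b := Finpartition.le_iff_mem_part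

theorem merge_le_iff {π ρ : EvenPartition n} {p q : Fin (2 * n)} :
    π.merge p q ≤ ρ ↔ π ≤ ρ ∧ p ∈ ρ.1.part q := Finpartition.merge_le_iff

theorem le_merge (π : EvenPartition n) (p q : Fin (2 * n)) : π ≤ π.merge p q :=
  (merge_le_iff.1 le_rfl).1

theorem mem_part_merge (π : EvenPartition n) (p q : Fin (2 * n)) : p ∈ (π.merge p q).1.part q :=
  (merge_le_iff.1 le_rfl).2

theorem card_parts_merge (π : EvenPartition n) {p q : Fin (2 * n)} (h : p ∉ π.1.part q) :
    (π.merge p q).1.parts.card + 1 = π.1.parts.card := Finpartition.card_parts_merge _ h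

theorem lt_merge (π : EvenPartition n) {p q : Fin (2 * n)} (h : p ∉ π.1.part q) :
    π < π.merge p q :=
  (π.le_merge p q).lt_of_ne fun e => h (e ▸ π.mem_part_merge p q)

/-- Two elements separated by `π` but not by `ρ` give a merge in between. As a merge lowers the
number of blocks by exactly one, the covers are precisely the merges, and the number of blocks is a
rank function. -/
theorem exists_merge_le {π ρ : EvenPartition n} (h : π < ρ) :
    ∃ p q, p ∉ π.1.part q ∧ p ∈ ρ.1.part q ∧ π.merge p q ≤ ρ := by
  have := h.not_ge
  rw [le_iff_mem_part] at this
  push Not at this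
  obtain ⟨p, q, h1, h2⟩ := this
  exact ⟨p, q, h2, h1, merge_le_iff.2 ⟨h.le, h1⟩⟩

theorem card_parts_lt {π ρ : EvenPartition n} (h : π < ρ) :
    ρ.1.parts.card < π.1.parts.card := by
  obtain ⟨p, q, h1, -, h3⟩ := exists_merge_le h
  have := Finpartition.card_mono (show (π.merge p q).1 ≤ ρ.1 from h3)
  have := π.card_parts_merge h1
  omega

theorem covBy_merge (π : EvenPartition n) {p q : Fin (2 * n)} (h : p ∉ π.1.part q) :
    π ⋖ π.merge p q := by
  refine ⟨π.lt_merge h, fun c h1 h2 => ?_⟩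
  have := card_parts_lt h1
  have := card_parts_lt h2
  have := π.card_parts_merge h
  omega

theorem exists_eq_merge {π ρ : EvenPartition n} (h : π ⋖ ρ) :
    ∃ p q, p ∉ π.1.part q ∧ p ∈ ρ.1.part q ∧ ρ = π.merge p q := by
  obtain ⟨p, q, h1, h2, h3⟩ := exists_merge_le h.lt
  refine ⟨p, q, h1, h2, ?_⟩
  exact ((eq_or_lt_of_le h3).resolve_right fun h4 => h.2 (π.lt_merge h1) h4).symm

theorem card_parts_covBy {π ρ : EvenPartition n} (h : π ⋖ ρ) :
    ρ.1.parts.card + 1 = π.1.parts.card := by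
  obtain ⟨p, q, h1, -, rfl⟩ := exists_eq_merge h
  exact π.card_parts_merge h1

/-- If `a` merges the blocks of `p` and `q`, perform the same merge in `b`. It is a genuine merge
there, since otherwise `a ≤ b`. Counting blocks shows that the result differs from `a`. -/
theorem semimodular {x a b y : EvenPartition n} (ha : x ⋖ a) (hb : x ⋖ b) (hab : a ≠ b)
    (hay : a ≤ y) (hby : b ≤ y) : ∃ z, b ⋖ z ∧ a < z ∧ z ≤ y := by
  obtain ⟨p, q, h1, h2, rfl⟩ := exists_eq_merge ha
  have hpq : p ∉ b.1.part q := fun h => by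
    have hle : x.merge p q ≤ b := merge_le_iff.2 ⟨hb.le, h⟩
    exact hb.2 ha.lt (hle.lt_of_ne hab)
  refine ⟨b.merge p q, b.covBy_merge hpq, lt_of_le_of_ne ?_ ?_, ?_⟩
  · exact merge_le_iff.2 ⟨hb.le.trans (b.le_merge p q), b.mem_part_merge p q⟩
  · intro e
    have h3 := card_parts_covBy ha
    have h4 := card_parts_covBy hb
    have h5 := b.card_parts_merge hpq
    rw [e] at h3
    omega
  · exact merge_le_iff.2 ⟨hby, (merge_le_iff.1 hay).2⟩

end EvenPartition

/-! ### Words of partitions -/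

theorem Finset.sort_eq_append_filter_lt {α : Type*} [LinearOrder α] (s : Finset α) (x : α) :
    s.sort (· ≤ ·) = (s.filter (· < x)).sort (· ≤ ·) ++ (s.filter (x ≤ ·)).sort (· ≤ ·) := by
  have hp : ((s.filter (· < x)).sort (· ≤ ·) ++ (s.filter (x ≤ ·)).sort (· ≤ ·)).Pairwise
      (· ≤ ·) := by
    rw [List.pairwise_append]
    refine ⟨Finset.pairwise_sort _ _, Finset.pairwise_sort _ _, fun a ha b hb => ?_⟩
    simp only [Finset.mem_sort, Finset.mem_filter] at ha hb
    exact ha.2.le.trans hb.2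
  rw [← (List.toFinset_sort (· ≤ ·) ?_).2 hp]
  · congr 1
    ext a
    simp only [List.toFinset_append, Finset.sort_toFinset, Finset.mem_union, Finset.mem_filter]
    have := lt_or_ge a x
    tauto
  · rw [List.nodup_append]
    refine ⟨Finset.sort_nodup _ _, Finset.sort_nodup _ _, fun a ha b hb => ?_⟩
    simp only [Finset.mem_sort, Finset.mem_filter] at ha hb
    exact (ha.2.trans_le hb.2).ne

theorem Finset.exists_sort_eq_cons {α : Type*} [LinearOrder α] {s : Finset α} {m : α} (hm : m ∈ s)
    (h : ∀ x ∈ s, m ≤ x) : ∃ t, s.sort (· ≤ ·) = m :: t := by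
  refine ⟨(s.erase m).sort (· ≤ ·), ?_⟩
  conv_lhs => rw [← Finset.insert_erase hm]
  exact Finset.sort_insert _ (fun b hb => h b (Finset.mem_of_mem_erase hb)) (by simp)

theorem Finset.sort_pair {α : Type*} [LinearOrder α] {p q : α} (h : p < q) :
    ({p, q} : Finset α).sort (· ≤ ·) = [p, q] := by
  rw [Finset.sort_insert _ (by simp [h.le]) (by simp [h.ne]), Finset.sort_singleton]

/-- The list `[p]` serves as a threshold: among sorted blocks it separates those with minimum below
`p` from the rest, because `[p]` precedes every longer list starting with `p`. -/
theorem List.lt_singleton_iff {α : Type*} [LinearOrder α] {a p : α} {l : List α} :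
    a :: l < [p] ↔ a < p := by
  rw [List.cons_lt_cons_iff]
  simp

namespace EvenPartition

variable {n : ℕ}

/-- The sorted blocks of a partition. -/
def lists (π : EvenPartition n) : Finset (List (Fin (2 * n))) :=
  π.1.parts.image fun B => B.sort (· ≤ ·)

theorem exists_cons_of_mem_lists {π : EvenPartition n} {l : List (Fin (2 * n))}
    (hl : l ∈ π.lists) : ∃ r t, l = r :: t ∧ l = (π.1.part r).sort (· ≤ ·) := by
  obtain ⟨B, hB, rfl⟩ := Finset.mem_image.1 hl
  rcases h : B.sort (· ≤ ·) with _ | ⟨r, t⟩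
  · obtain ⟨x, hx⟩ := π.1.nonempty_of_mem_parts hB
    rw [← Finset.mem_sort (· ≤ ·), h] at hx
    simp at hx
  · refine ⟨r, t, rfl, ?_⟩
    have hr : r ∈ B := by
      rw [← Finset.mem_sort (· ≤ ·), h]
      simp
    rw [π.1.part_eq_of_mem hB hr, h]

theorem sort_part_mem_lists (π : EvenPartition n) (r : Fin (2 * n)) :
    (π.1.part r).sort (· ≤ ·) ∈ π.lists :=
  Finset.mem_image_of_mem _ (π.1.part_mem.2 (Finset.mem_univ r))

theorem lists_filter_subset {π ρ : EvenPartition n} {p : Fin (2 * n)}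
    (h : ∀ r < p, π.1.part r = ρ.1.part r) :
    π.lists.filter (· < [p]) ⊆ ρ.lists.filter (· < [p]) := by
  intro l hl
  rw [Finset.mem_filter] at hl ⊢
  refine ⟨?_, hl.2⟩
  obtain ⟨r, t, h1, h2⟩ := exists_cons_of_mem_lists hl.1
  have hr : r < p := by
    have := hl.2
    rwa [h1, List.lt_singleton_iff] at this
  rw [h2, h r hr]
  exact ρ.sort_part_mem_lists r

/-- Cut the sorted list of blocks at the threshold `[p]`. Every remaining block has minimum at least
`p`, so the block `{p, q}` comes next. -/
theorem exists_word_eq {π : EvenPartition n} {p q : Fin (2 * n)} (hp : π.1.part p = {p, q})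
    (hpq : p < q) :
    ∃ t, π.word = ((π.lists.filter (· < [p])).sort (· ≤ ·)).flatten ++ p :: q :: t := by
  obtain ⟨t, ht⟩ := Finset.exists_sort_eq_cons (s := π.lists.filter ([p] ≤ ·)) (m := [p, q])
    (by
      rw [Finset.mem_filter, ← Finset.sort_pair hpq, ← hp]
      refine ⟨π.sort_part_mem_lists p, ?_⟩
      rw [hp, Finset.sort_pair hpq, ← not_lt, List.lt_singleton_iff]
      exact lt_irrefl p)
    (by
      intro l hl
      rw [Finset.mem_filter] at hl
      obtain ⟨r, t, h1, h2⟩ := exists_cons_of_mem_lists hl.1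
      have hr : ¬ r < p := by
        have := hl.2
        rwa [h1, ← not_lt, List.lt_singleton_iff] at this
      rcases eq_or_lt_of_le (not_lt.1 hr) with rfl | hr
      · rw [h2, hp, Finset.sort_pair hpq]
      · rw [h1]
        exact (List.cons_lt_cons_iff.2 (Or.inl hr)).le)
  refine ⟨t.flatten, ?_⟩
  change ((π.lists.sort (· ≤ ·)).flatten) = _
  rw [Finset.sort_eq_append_filter_lt π.lists [p], ht, List.flatten_append]
  congr!

/-- Two partitions are compared by their words at the first element at which they differ. -/
theorem word_lt_word {π ρ : EvenPartition n} {p q q' : Fin (2 * n)}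
    (h : ∀ r < p, π.1.part r = ρ.1.part r) (hπ : π.1.part p = {p, q}) (hρ : ρ.1.part p = {p, q'})
    (hpq : p < q) (hq : q < q') : π.word < ρ.word := by
  obtain ⟨t, ht⟩ := exists_word_eq hπ hpq
  obtain ⟨t', ht'⟩ := exists_word_eq hρ (hpq.trans hq)
  -- Blocks with minimum below `p` are common to both partitions, so the prefixes agree and the
  -- words first differ at `q` against `q'`.
  rw [ht, ht', (lists_filter_subset h).antisymm (lists_filter_subset fun r hr => (h r hr).symm)]
  apply List.append_left_lt
  rw [List.cons_lt_cons_iff, List.cons_lt_cons_iff]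
  exact Or.inr ⟨rfl, Or.inl hq⟩

/-! ### The minimal even partitions -/

theorem eq_of_part_eq {π ρ : EvenPartition n} (h : ∀ a, π.1.part a = ρ.1.part a) : π = ρ :=
  le_antisymm (le_iff_mem_part.2 fun a b => by simp [h]) (le_iff_mem_part.2 fun a b => by simp [h])

theorem even_card_part (π : EvenPartition n) (a : Fin (2 * n)) : Even (π.1.part a).card :=
  π.2 _ (π.1.part_mem.2 (Finset.mem_univ a))

theorem two_le_card_part (π : EvenPartition n) (a : Fin (2 * n)) : 2 ≤ (π.1.part a).card := by
  have h1 : 0 < (π.1.part a).card := Finset.card_pos.2 ⟨a, π.1.mem_part_univ a⟩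
  obtain ⟨k, hk⟩ := π.even_card_part a
  omega

open Classical in
/-- The partition into the classes of an equivalence relation with even classes. -/
def ofSetoid (s : Setoid (Fin (2 * n)))
    (h : ∀ a, Even (Finset.univ.filter fun b => s a b).card) : EvenPartition n :=
  ⟨Finpartition.ofSetoid s, by
    intro B hB
    obtain ⟨a, ha⟩ := Finpartition.nonempty_of_mem_parts _ hB
    rw [← Finpartition.part_eq_of_mem _ hB ha]
    convert h a using 2
    ext b
    rw [Finpartition.mem_part_ofSetoid_iff_rel]
    simp⟩

open Classical in
theorem mem_part_ofSetoid {s : Setoid (Fin (2 * n))}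
    {h : ∀ a, Even (Finset.univ.filter fun b => s a b).card} {a b : Fin (2 * n)} :
    b ∈ (ofSetoid s h).1.part a ↔ s a b :=
  Finpartition.mem_part_ofSetoid_iff_rel

theorem isMin_of_card_part {π : EvenPartition n} (h : ∀ a, (π.1.part a).card = 2) : IsMin π := by
  intro ρ hρ
  refine le_iff_mem_part.2 fun a b hab => ?_
  have hsub : ρ.1.part b ⊆ π.1.part b := fun c => le_iff_mem_part.1 hρ c b
  rwa [Finset.eq_of_subset_of_card_le hsub (by rw [h]; exact ρ.two_le_card_part b)]

/-- A pair `T` inside the block of `a` can be split off, leaving an even remainder. The refinement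
obtained is an even partition, so minimality forces the block to equal `T`. -/
theorem card_part_of_isMin {π : EvenPartition n} (h : IsMin π) (a : Fin (2 * n)) :
    (π.1.part a).card = 2 := by
  classical
  obtain ⟨T, hT, hT2⟩ := Finset.exists_subset_card_eq (π.two_le_card_part a)
  let s : Setoid (Fin (2 * n)) :=
    { r := fun x y => π.1.part x = π.1.part y ∧ (x ∈ T ↔ y ∈ T)
      iseqv := ⟨fun x => ⟨rfl, Iff.rfl⟩, fun h => ⟨h.1.symm, h.2.symm⟩,
        fun h h' => ⟨h.1.trans h'.1, h.2.trans h'.2⟩⟩ }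
  have hs : ∀ x y, s x y ↔ y ∈ π.1.part x ∧ (x ∈ T ↔ y ∈ T) := fun x y => by
    rw [π.1.mem_part_iff_part_eq_part (by simp) (by simp), eq_comm]
    exact Iff.rfl
  have heven : ∀ x, Even (Finset.univ.filter fun y => s x y).card := by
    intro x
    by_cases hx : x ∈ π.1.part a
    · have hxa : π.1.part x = π.1.part a :=
        (π.1.mem_part_iff_part_eq_part (by simp) (by simp)).1 hx
      by_cases hxT : x ∈ T
      · have : (Finset.univ.filter fun y => s x y) = T := by
          ext y
          simp only [Finset.mem_filter, Finset.mem_univ, true_and, hs, hxT, true_iff, hxa]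
          exact ⟨fun h => h.2, fun h => ⟨hT h, h⟩⟩
        rw [this, hT2]
        exact even_two
      · have : (Finset.univ.filter fun y => s x y) = π.1.part a \ T := by
          ext y
          simp only [Finset.mem_filter, Finset.mem_univ, true_and, hs, hxT, false_iff, hxa,
            Finset.mem_sdiff]
        rw [this, Finset.card_sdiff_of_subset hT, hT2]
        exact (π.even_card_part a).tsub even_two
    · have : (Finset.univ.filter fun y => s x y) = π.1.part x := by
        ext y
        simp only [Finset.mem_filter, Finset.mem_univ, true_and, hs, and_iff_left_iff_imp]
        intro hy
        have h1 : x ∉ T := fun h => hx (hT h)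
        have h2 : y ∉ T := fun h => hx (π.1.mem_part_trans (π.1.mem_part_comm.1 hy) (hT h))
        simp [h1, h2]
      rw [this]
      exact π.even_card_part x
  have hle : ofSetoid s heven ≤ π := le_iff_mem_part.2 fun x y hxy => by
    rw [mem_part_ofSetoid] at hxy
    exact ((hs _ _).1 hxy).1
  have hge := le_iff_mem_part.1 (h hle)
  obtain ⟨t, ht⟩ : T.Nonempty := Finset.card_pos.1 (by omega)
  have : π.1.part a = T := by
    refine Finset.Subset.antisymm (fun x hx => ?_) hT
    have := hge x t (π.1.mem_part_trans hx (π.1.mem_part_comm.1 (hT ht)))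
    rw [mem_part_ofSetoid] at this
    exact ((hs _ _).1 this).2.1 ht
  rw [this, hT2]

theorem exists_part_eq_pair {π : EvenPartition n} (h : IsMin π) (a : Fin (2 * n)) :
    ∃ b ≠ a, π.1.part a = {a, b} := by
  obtain ⟨x, y, hxy, hB⟩ := Finset.card_eq_two.1 (card_part_of_isMin h a)
  have ha := π.1.mem_part_univ a
  rw [hB, Finset.mem_insert, Finset.mem_singleton] at ha
  rcases ha with rfl | rfl
  · exact ⟨y, hxy.symm, hB⟩
  · exact ⟨x, hxy, hB.trans (Finset.pair_comm _ _)⟩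

theorem part_eq_of_mem {π : EvenPartition n} {a b : Fin (2 * n)} (h : b ∈ π.1.part a) :
    π.1.part b = π.1.part a :=
  (π.1.mem_part_iff_part_eq_part (by simp) (by simp)).1 h

/-- Two different minimal partitions differ first at an element which is the smallest one of its
block in both. -/
theorem exists_first_difference {π ρ : EvenPartition n} (hπ : IsMin π) (hρ : IsMin ρ)
    (h : π ≠ ρ) : ∃ p q q', (∀ r < p, π.1.part r = ρ.1.part r) ∧ π.1.part p = {p, q} ∧
      ρ.1.part p = {p, q'} ∧ p < q ∧ p < q' ∧ q ≠ q' := by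
  obtain ⟨p, hp, hmin⟩ : ∃ p, π.1.part p ≠ ρ.1.part p ∧ ∀ r < p, π.1.part r = ρ.1.part r := by
    by_contra! hcon
    refine h (eq_of_part_eq fun a => ?_)
    induction a using WellFoundedLT.induction with
    | _ a ih =>
      by_contra hne
      obtain ⟨r, hr, hne'⟩ := hcon a hne
      exact hne' (ih r hr)
  -- A partner `q < p` would have the same block in both partitions, and that block contains `p`,
  -- contradicting the difference at `p`.
  have key : ∀ {π ρ : EvenPartition n} {p q : Fin (2 * n)}, π.1.part p ≠ ρ.1.part p →
      (∀ r < p, π.1.part r = ρ.1.part r) → π.1.part p = {p, q} → q ≠ p → p < q := by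
    intro π ρ p q hp hmin hq hqp
    refine lt_of_le_of_ne (not_lt.1 fun hlt => hp ?_) hqp.symm
    have h1 : q ∈ π.1.part p := by simp [hq]
    have h2 := part_eq_of_mem h1
    rw [← h2, hmin q hlt]
    have h3 : p ∈ ρ.1.part q := by
      rw [← hmin q hlt]
      exact π.1.mem_part_comm.1 h1
    exact (part_eq_of_mem h3).symm
  obtain ⟨q, hq, hπq⟩ := exists_part_eq_pair hπ p
  obtain ⟨q', hq', hρq⟩ := exists_part_eq_pair hρ p
  refine ⟨p, q, q', hmin, hπq, hρq, key hp hmin hπq hq,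
    key hp.symm (fun r hr => (hmin r hr).symm) hρq hq', ?_⟩
  rintro rfl
  exact hp (hπq.trans hρq.symm)

theorem word_injOn_isMin {π ρ : EvenPartition n} (hπ : IsMin π) (hρ : IsMin ρ)
    (h : π.word = ρ.word) : π = ρ := by
  by_contra hne
  obtain ⟨p, q, q', h1, h2, h3, h4, h5, h6⟩ := exists_first_difference hπ hρ hne
  rcases lt_or_gt_of_ne h6 with h7 | h7
  · exact (word_lt_word h1 h2 h3 h4 h7).ne h
  · exact (word_lt_word (fun r hr => (h1 r hr).symm) h3 h2 h5 h7).ne h.symm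

/-- The image of a partition under a permutation. -/
def permute (π : EvenPartition n) (σ : Equiv.Perm (Fin (2 * n))) : EvenPartition n :=
  ofSetoid ((Setoid.ker π.1.part).comap σ.symm) (by
    classical
    intro a
    have : (Finset.univ.filter fun b => (Setoid.ker π.1.part).comap σ.symm a b) =
        (π.1.part (σ.symm a)).map σ.toEmbedding := by
      ext b
      rw [Finset.mem_map_equiv, π.1.mem_part_iff_part_eq_part (by simp) (by simp)]
      simp only [Finset.mem_filter, Finset.mem_univ, true_and]
      exact eq_comm
    rw [this, Finset.card_map]
    exact π.even_card_part _)

theorem part_permute (π : EvenPartition n) (σ : Equiv.Perm (Fin (2 * n))) (a : Fin (2 * n)) :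
    (π.permute σ).1.part a = (π.1.part (σ.symm a)).map σ.toEmbedding := by
  ext b
  rw [Finset.mem_map_equiv, π.1.mem_part_iff_part_eq_part (by simp) (by simp), permute,
    mem_part_ofSetoid]
  exact eq_comm

/-- Two crossing or nested pairs of a minimal partition can be exchanged for a partition with a
smaller word. -/
theorem exists_isMin_word_lt_of_partner {π y : EvenPartition n} (hπ : IsMin π) (hπy : π ≤ y)
    {p q r s : Fin (2 * n)} (hq : π.1.part p = {p, q}) (hs : π.1.part r = {r, s}) (hpr : p < r)
    (hrq : r < q) (hps : p < s) (hr : r ∈ y.1.part p) :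
    ∃ ρ z, IsMin ρ ∧ ρ.word < π.word ∧ π ⋖ z ∧ ρ < z ∧ z ≤ y := by
  -- The swap replaces the pairs `{p, q}` and `{r, s}` by `{p, r}` and `{q, s}`. As `p` is the least
  -- of the four elements and `r < q`, the first change in the word occurs at the partner of `p`,
  -- which decreases.
  let σ := Equiv.swap q r
  have hσ : σ.symm = σ := Equiv.symm_swap q r
  have hp : σ p = p := Equiv.swap_apply_of_ne_of_ne (hpr.trans hrq).ne hpr.ne
  have hrp : r ∉ π.1.part p := by
    rw [hq]
    simp [hpr.ne', hrq.ne]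
  have hmin : IsMin (π.permute σ) := isMin_of_card_part fun a => by
    rw [part_permute, Finset.card_map, card_part_of_isMin hπ]
  have hz := π.covBy_merge hrp
  refine ⟨π.permute σ, π.merge r p, hmin, ?_, hz, lt_of_le_of_ne ?_ ?_,
    merge_le_iff.2 ⟨hπy, hr⟩⟩
  · refine word_lt_word (p := p) (q := r) (q' := q) (fun t ht => ?_) ?_ hq hpr hrq
    · have h1 : t ∉ π.1.part p := by
        rw [hq]
        simp [ht.ne, (ht.trans (hpr.trans hrq)).ne]
      have h2 : t ∉ π.1.part r := by
        rw [hs]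
        simp [(ht.trans hpr).ne, (ht.trans hps).ne]
      have h3 : q ∉ π.1.part t := fun h => h1 (by
        rw [← part_eq_of_mem (show q ∈ π.1.part p by simp [hq])]
        exact π.1.mem_part_comm.1 h)
      have h4 : r ∉ π.1.part t := fun h => h2 (π.1.mem_part_comm.1 h)
      have hfix : ∀ x ∈ π.1.part t, σ x = x := fun x hx =>
        Equiv.swap_apply_of_ne_of_ne (fun e => h3 (e ▸ hx)) (fun e => h4 (e ▸ hx))
      rw [part_permute, hσ, hfix t (π.1.mem_part_univ t)]
      ext x
      rw [Finset.mem_map_equiv, hσ]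
      constructor
      · intro hx
        have := hfix _ hx
        rw [σ.injective this] at hx
        exact hx
      · intro hx
        rwa [hfix x hx]
    · rw [part_permute, hσ, hp, hq, Finset.map_insert, Finset.map_singleton]
      simp only [Equiv.coe_toEmbedding, hp]
      simp [σ]
  -- The swap moves elements only inside one block of the merged partition, so the permuted matching
  -- also lies below it.
  · have hσz : ∀ x, σ x ∈ (π.merge r p).1.part x := by
      have h1 : p ∈ (π.merge r p).1.part r :=
        (π.merge r p).1.mem_part_comm.1 (π.mem_part_merge r p)
      have h2 : q ∈ (π.merge r p).1.part p :=
        le_iff_mem_part.1 (π.le_merge r p) _ _ (by simp [hq])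
      have h3 := (π.merge r p).1.mem_part_trans h2 h1
      intro x
      by_cases h4 : x = q
      · subst h4
        simpa [σ] using (π.merge r p).1.mem_part_comm.1 h3
      by_cases h5 : x = r
      · subst h5
        simpa [σ] using h3
      rw [show σ x = x from Equiv.swap_apply_of_ne_of_ne h4 h5]
      exact (π.merge r p).1.mem_part_univ x
    refine le_iff_mem_part.2 fun a b hab => ?_
    rw [part_permute, Finset.mem_map_equiv, hσ] at hab
    have h1 := le_iff_mem_part.1 (π.le_merge r p) _ _ hab
    have h2 := (π.merge r p).1.mem_part_comm.1 (hσz a)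
    exact (π.merge r p).1.mem_part_trans ((π.merge r p).1.mem_part_trans h2 h1) (hσz b)
  · intro e
    rw [e] at hmin
    exact hmin.not_lt hz.lt

/-- Let `s` be the partner of `r`. If `p < s`, the pair `{p, q}` is the one to be shortened. If `s <
p`, then `s < p < r < q`: the pairs cross, and the same argument applies with their roles exchanged.
-/
theorem exists_isMin_word_lt {π y : EvenPartition n} (hπ : IsMin π) (hπy : π ≤ y)
    {p q r : Fin (2 * n)} (hq : π.1.part p = {p, q}) (hpr : p < r)
    (hrq : r < q) (hr : r ∈ y.1.part p) :
    ∃ ρ z, IsMin ρ ∧ ρ.word < π.word ∧ π ⋖ z ∧ ρ < z ∧ z ≤ y := by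
  obtain ⟨s, hsr, hs⟩ := exists_part_eq_pair hπ r
  rcases lt_trichotomy p s with h | h | h
  · exact exists_isMin_word_lt_of_partner hπ hπy hq hs hpr hrq h hr
  · subst h
    have : π.1.part p = π.1.part r := part_eq_of_mem (by simp [hs])
    have hr' : r ∈ π.1.part p := this ▸ π.1.mem_part_univ r
    rw [hq] at hr'
    simp [hpr.ne', hrq.ne] at hr'
  · have hs' : π.1.part s = {s, r} := by
      rw [part_eq_of_mem (show s ∈ π.1.part r by simp [hs]), hs, Finset.pair_comm]
    refine exists_isMin_word_lt_of_partner hπ hπy hs' hq h hpr (h.trans (hpr.trans hrq)) ?_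
    have hsr' : r ∈ y.1.part s := le_iff_mem_part.1 hπy _ _ (by simp [hs'])
    exact y.1.mem_part_trans (y.1.mem_part_comm.1 hr) hsr'

/-- The exchange property of the lexicographic order on minimal even partitions. -/
theorem exists_isMin_word_lt_of_word_lt {π ρ y : EvenPartition n} (hπ : IsMin π) (hρ : IsMin ρ)
    (h : ρ.word < π.word) (hπy : π ≤ y) (hρy : ρ ≤ y) :
    ∃ ρ z, IsMin ρ ∧ ρ.word < π.word ∧ π ⋖ z ∧ ρ < z ∧ z ≤ y := by
  have hne : ρ ≠ π := fun e => by simp [e] at h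
  obtain ⟨p, q, q', h1, h2, h3, h4, h5, h6⟩ := exists_first_difference hρ hπ hne
  rcases lt_or_gt_of_ne h6 with h7 | h7
  · exact exists_isMin_word_lt hπ hπy h3 h4 h7 (le_iff_mem_part.1 hρy _ _ (by simp [h2]))
  · exact absurd h (word_lt_word (fun r hr => (h1 r hr).symm) h3 h2 h5 h7).asymm

/-- The minimal even partitions in the lexicographic order of their words. -/
theorem exists_list_isMin (n : ℕ) : ∃ l : List (EvenPartition n),
    l.Pairwise (fun π ρ => π.word < ρ.word) ∧ ∀ π, π ∈ l ↔ IsMin π := by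
  classical
  let r : EvenPartition n → EvenPartition n → Prop := fun π ρ => π.word ≤ ρ.word
  have : DecidableRel r := fun _ _ => Classical.dec _
  have : Std.Total r := ⟨fun π ρ => le_total π.word ρ.word⟩
  have : IsTrans _ r := ⟨fun π ρ τ h h' => le_trans (α := List (Fin (2 * n))) h h'⟩
  let l₀ := (Finset.univ.filter fun π : EvenPartition n => IsMin π).toList
  have hl₀ : l₀.Nodup := Finset.nodup_toList _
  have hmem : ∀ π, π ∈ l₀.insertionSort r ↔ IsMin π := fun π => by
    rw [List.mem_insertionSort]
    simp [l₀]
  have hnd : (l₀.insertionSort r).Nodup := (List.perm_insertionSort r l₀).nodup_iff.2 hl₀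
  refine ⟨l₀.insertionSort r, ?_, hmem⟩
  have h := (List.pairwise_insertionSort r l₀).and hnd
  refine h.imp_of_mem fun {π ρ} hπ hρ hh => lt_of_le_of_ne hh.1 fun e => hh.2 ?_
  exact word_injOn_isMin ((hmem _).1 hπ) ((hmem _).1 hρ) e

/-- Above a matching everything is semimodular, so condition (i) holds for any listing. At the
adjoined bottom the exchange condition is the lexicographic exchange of matchings. -/
theorem isRecursiveAtomOrdering {l : List (EvenPartition n)}
    (hl : l.Pairwise (fun π ρ => π.word < ρ.word)) (hmem : ∀ π, π ∈ l ↔ IsMin π) :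
    IsRecursiveAtomOrdering (⊥ : WithBot (EvenPartition n)) (l.map (↑)) := by
  have hnd : l.Nodup := hl.imp fun {π ρ} h e => by simp [e] at h
  have hsemi : ∀ π : EvenPartition n, ∀ L : List (WithBot (EvenPartition n)),
      (π : WithBot (EvenPartition n)) < ⊤ → L.Nodup → (∀ b, b ∈ L ↔ ↑π ⋖ b) →
      IsRecursiveAtomOrdering (π : WithBot (EvenPartition n)) L := by
    intro π L hπ hL hL'
    refine .of_semimodular (π : WithBot (EvenPartition n)) ?_ _ le_rfl hπ L hL hL'
    intro x a b y hx hxa hxb hab hay hby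
    lift x to EvenPartition n using ne_bot_of_le_ne_bot WithBot.coe_ne_bot hx
    lift a to EvenPartition n using ne_bot_of_gt hxa.lt
    lift b to EvenPartition n using ne_bot_of_gt hxb.lt
    lift y to EvenPartition n using ne_bot_of_le_ne_bot WithBot.coe_ne_bot hay
    rw [WithBot.coe_covBy_coe] at hxa hxb
    rw [WithBot.coe_le_coe] at hay hby
    obtain ⟨z, h1, h2, h3⟩ := semimodular hxa hxb (fun e => hab (by rw [e])) hay hby
    exact ⟨z, WithBot.coe_covBy_coe.2 h1, WithBot.coe_lt_coe.2 h2, WithBot.coe_le_coe.2 h3⟩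
  have hmem' : ∀ a : WithBot (EvenPartition n), a ∈ l.map (↑) ↔ ⊥ ⋖ a := by
    intro a
    induction a with
    | bot => simp
    | coe a =>
      rw [WithBot.bot_covBy_coe]
      simp [hmem]
  have hnd' : (l.map ((↑) : EvenPartition n → WithBot (EvenPartition n))).Nodup :=
    hnd.map WithBot.coe_injective
  have hbot : (⊥ : WithBot (EvenPartition n)) < ⊤ := WithBot.bot_lt_coe _
  -- In length one the definition demands the list `[⊤]`.
  by_cases hcov : (⊥ : WithBot (EvenPartition n)) ⋖ ⊤
  · have hmin : IsMin (⊤ : EvenPartition n) := WithBot.bot_covBy_coe.1 hcov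
    have h1 : ∀ π ∈ l, π = ⊤ := fun π _ => le_antisymm le_top (hmin le_top)
    have h2 : (⊤ : EvenPartition n) ∈ l := (hmem _).2 hmin
    have h3 : l = [⊤] := by
      rw [List.eq_replicate_of_mem h1] at hnd h2 ⊢
      have h3 := List.nodup_replicate.1 hnd
      have h4 : l.length ≠ 0 := fun h0 => by simp [h0] at h2
      rw [show l.length = 1 by omega]
      rfl
    rw [h3]
    exact .length_one _ hcov
  · refine .of_forall _ _ hbot hcov hnd' hmem' ?_ ?_
    · intro a ha hat L hL hL'
      obtain ⟨π, hπ, rfl⟩ := List.mem_map.1 ha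
      exact hsemi π L hat hL hL'
    · intro i j hij y hiy hjy
      have hlen : (l.map ((↑) : EvenPartition n → WithBot (EvenPartition n))).length = l.length :=
        List.length_map _
      have hget : ∀ i : Fin (l.map ((↑) : EvenPartition n → WithBot (EvenPartition n))).length,
          (l.map (↑)).get i = ((l.get (i.cast hlen) : EvenPartition n) :
            WithBot (EvenPartition n)) := fun i => by simp
      rw [hget] at hiy hjy
      lift y to EvenPartition n using ne_bot_of_gt hiy
      rw [WithBot.coe_lt_coe] at hiy hjy
      have hlt : (l.get (i.cast hlen)).word < (l.get (j.cast hlen)).word :=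
        List.pairwise_iff_get.1 hl _ _ hij
      obtain ⟨ρ, z, h1, h2, h3, h4, h5⟩ := exists_isMin_word_lt_of_word_lt
        ((hmem _).1 (l.get_mem _)) ((hmem _).1 (l.get_mem _)) hlt hjy.le hiy.le
      obtain ⟨k, rfl⟩ := List.mem_iff_get.1 ((hmem ρ).2 h1)
      refine ⟨k.cast hlen.symm, ?_, z, ?_, ?_, ?_⟩
      · by_contra hkj
        rcases eq_or_lt_of_le (not_lt.1 hkj) with e | e
        · have : k = j.cast hlen := by rw [e]; rfl
          rw [this] at h2
          exact lt_irrefl _ h2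
        · exact (List.pairwise_iff_get.1 hl (j.cast hlen) k e).asymm h2
      · rw [hget]
        exact WithBot.coe_covBy_coe.2 h3
      · rw [hget]
        exact WithBot.coe_lt_coe.2 h4
      · exact WithBot.coe_le_coe.2 h5

end EvenPartition

/-! ### Maximal chains -/

section MaxChain

variable {P : Type*} [PartialOrder P]

theorem Finset.isChain_insert [DecidableEq P] {F : Finset P} {a : P}
    (hF : IsChain (· ≤ ·) (F : Set P)) (h : ∀ y ∈ F, a ≤ y ∨ y ≤ a) :
    IsChain (· ≤ ·) ((insert a F : Finset P) : Set P) := by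
  rw [Finset.coe_insert]
  exact hF.insert fun y hy _ => h y hy

theorem IsChain.exists_least {F : Finset P} (hF : IsChain (· ≤ ·) (F : Set P))
    (hne : F.Nonempty) : ∃ a ∈ F, ∀ y ∈ F, a ≤ y := by
  obtain ⟨a, ha⟩ := F.exists_minimal hne
  refine ⟨a, ha.prop, fun y hy => ?_⟩
  rcases hF.total ha.prop hy with h | h
  · exact h
  · exact ha.le_of_le hy h

variable [OrderTop P]

/-- `F` is a maximal chain of the open interval `(x, ⊤)`. -/
def IsMaxChainAbove (x : P) (F : Finset P) : Prop :=
  Maximal (fun F : Finset P => IsChain (· ≤ ·) (F : Set P) ∧ ∀ y ∈ F, x < y ∧ y < ⊤) F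

theorem IsMaxChainAbove.eq_empty {x : P} {F : Finset P} (hx : x ⋖ ⊤) (hF : IsMaxChainAbove x F) :
    F = ∅ := by
  rw [Finset.eq_empty_iff_forall_notMem]
  exact fun y hy => hx.2 (hF.prop.2 y hy).1 (hF.prop.2 y hy).2

theorem exists_isMaxChainAbove_ge [Finite P] {x : P} {C : Finset P}
    (hC : IsChain (· ≤ ·) (C : Set P)) (hC' : ∀ y ∈ C, x < y ∧ y < ⊤) :
    ∃ F, C ⊆ F ∧ IsMaxChainAbove x F := by
  have := Fintype.ofFinite P
  obtain ⟨F, hF, hm⟩ := Set.Finite.exists_le_maximal (α := Finset P)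
    (s := {F | IsChain (· ≤ ·) (F : Set P) ∧ ∀ y ∈ F, x < y ∧ y < ⊤}) (Set.toFinite _) ⟨hC, hC'⟩
  exact ⟨F, hF, hm⟩

/-- The least element of a maximal chain is an atom, because anything strictly below it in the
interval could be inserted. Removing it leaves a maximal chain of the smaller interval. Together
with `IsMaxChainAbove.insert_atom`, this is the recursion used for ranks and shellings. -/
theorem IsMaxChainAbove.exists_atom [DecidableEq P] {x : P} {F : Finset P} (hx : x < ⊤)
    (hx' : ¬ x ⋖ ⊤) (hF : IsMaxChainAbove x F) :
    ∃ a ∈ F, x ⋖ a ∧ a < ⊤ ∧ (∀ y ∈ F, a ≤ y) ∧ IsMaxChainAbove a (F.erase a) := by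
  have hmem : ∀ c, x < c → c < ⊤ → (∀ y ∈ F, c ≤ y ∨ y ≤ c) → c ∈ F := by
    intro c h1 h2 h3
    refine hF.le_of_ge (y := insert c F) ⟨Finset.isChain_insert hF.prop.1 h3, ?_⟩
      (Finset.subset_insert _ _) (Finset.mem_insert_self _ _)
    intro y hy
    rcases Finset.mem_insert.1 hy with rfl | hy
    · exact ⟨h1, h2⟩
    · exact hF.prop.2 y hy
  have hne : F.Nonempty := by
    rw [Finset.nonempty_iff_ne_empty]
    rintro rfl
    obtain ⟨c, h1, h2⟩ := exists_lt_lt_of_not_covBy hx hx'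
    exact absurd (hmem c h1 h2 (by simp)) (by simp)
  obtain ⟨a, ha, hmin⟩ := hF.prop.1.exists_least hne
  refine ⟨a, ha, ⟨(hF.prop.2 a ha).1, fun c h1 h2 => ?_⟩, (hF.prop.2 a ha).2, hmin,
    ⟨⟨hF.prop.1.mono (by simp), fun y hy => ?_⟩, fun G hG hle y hy => ?_⟩⟩
  · have := hmem c h1 (h2.trans (hF.prop.2 a ha).2) fun y hy => Or.inl (h2.le.trans (hmin y hy))
    exact (hmin c this).not_gt h2
  · rw [Finset.mem_erase] at hy
    exact ⟨(hmin y hy.2).lt_of_ne hy.1.symm, (hF.prop.2 y hy.2).2⟩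
  · have h1 := hF.le_of_ge (y := insert a G)
      ⟨Finset.isChain_insert hG.1 fun y hy => Or.inl (hG.2 y hy).1.le, fun y hy => by
        rcases Finset.mem_insert.1 hy with rfl | hy
        · exact hF.prop.2 _ ha
        · exact ⟨(hF.prop.2 _ ha).1.trans (hG.2 y hy).1, (hG.2 y hy).2⟩⟩
      (fun y hy => by
        by_cases h : y = a
        · simp [h]
        · exact Finset.mem_insert_of_mem (hle (Finset.mem_erase.2 ⟨h, hy⟩)))
    exact Finset.mem_erase.2 ⟨(hG.2 y hy).1.ne', h1 (Finset.mem_insert_of_mem hy)⟩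

theorem IsMaxChainAbove.insert_atom [DecidableEq P] {x a : P} {F : Finset P} (ha : x ⋖ a)
    (ha' : a < ⊤) (hF : IsMaxChainAbove a F) : IsMaxChainAbove x (insert a F) := by
  refine ⟨⟨Finset.isChain_insert hF.prop.1 fun y hy => Or.inl (hF.prop.2 y hy).1.le, ?_⟩, ?_⟩
  · intro y hy
    rcases Finset.mem_insert.1 hy with rfl | hy
    · exact ⟨ha.lt, ha'⟩
    · exact ⟨ha.lt.trans (hF.prop.2 y hy).1, (hF.prop.2 y hy).2⟩
  · intro G hG hle y hy
    have haG : a ∈ G := hle (Finset.mem_insert_self _ _)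
    have h1 := hF.le_of_ge (y := G.erase a) ⟨hG.1.mono (by simp), fun w hw => by
        rw [Finset.mem_erase] at hw
        refine ⟨?_, (hG.2 w hw.2).2⟩
        rcases hG.1.total haG hw.2 with h | h
        · exact h.lt_of_ne hw.1.symm
        · exact absurd (h.lt_of_ne hw.1) (ha.2 (hG.2 w hw.2).1)⟩
      (fun w hw => Finset.mem_erase.2 ⟨(hF.prop.2 w hw).1.ne', hle (Finset.mem_insert_of_mem hw)⟩)
    by_cases h : y = a
    · simp [h]
    · exact Finset.mem_insert_of_mem (h1 (Finset.mem_erase.2 ⟨h, hy⟩))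

/-- In a graded poset all maximal chains have the same length. -/
theorem IsMaxChainAbove.card_add [Finite P] (ρ : P → ℕ) (hρ : ∀ a b : P, a ⋖ b → ρ b + 1 = ρ a)
    (x : P) : x < ⊤ → ∀ F, IsMaxChainAbove x F → F.card + 1 + ρ ⊤ = ρ x := by
  classical
  induction x using (Finite.wellFounded_of_trans_of_irrefl (α := P) (· > ·)).induction with
  | _ x ih =>
    intro hx F hF
    by_cases hx' : x ⋖ ⊤
    · rw [hF.eq_empty hx', ← hρ _ _ hx']
      simp [add_comm]
    · obtain ⟨a, ha, hxa, hat, -, hF'⟩ := hF.exists_atom hx hx'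
      have := ih a hxa.lt hat _ hF'
      rw [← hρ _ _ hxa, ← this, ← Finset.card_erase_add_one ha]
      ring

/-! ### Recursive atom orderings give shellings -/

theorem IsRecursiveAtomOrdering.covBy_or {x : P} {l : List P} (h : IsRecursiveAtomOrdering x l) :
    x ⋖ ⊤ ∨ ∀ a, a ∈ l ↔ x ⋖ a := by
  cases h with
  | length_one _ hx => exact Or.inl hx
  | step _ _ hx hx' nodup mem_iff => exact Or.inr mem_iff

theorem IsRecursiveAtomOrdering.lt_top {x : P} {l : List P} (h : IsRecursiveAtomOrdering x l) :
    x < ⊤ := by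
  cases h with
  | length_one _ hx => exact hx.lt
  | step _ _ hx => exact hx

/-- A recursive atom ordering of `[x, ⊤]` induces a ranking of the maximal chains of `(x, ⊤)` which
describes a shelling and is compatible with the ordering of the atoms. -/
theorem IsRecursiveAtomOrdering.exists_rank [Finite P] {x : P} {l : List P}
    (h : IsRecursiveAtomOrdering x l) :
    ∃ f : Finset P → List ℕ, Set.InjOn f {F | IsMaxChainAbove x F} ∧
      (∀ E F, IsMaxChainAbove x E → IsMaxChainAbove x F → f E < f F →
        ∃ E', IsMaxChainAbove x E' ∧ f E' < f F ∧ ∃ v ∈ F, v ∉ E ∧ ∀ w ∈ F, w ≠ v → w ∈ E') ∧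
      (¬ x ⋖ ⊤ → ∀ E F, IsMaxChainAbove x E → IsMaxChainAbove x F → ∀ i j : Fin l.length, i < j →
        l.get i ∈ E → l.get j ∈ F → f E < f F) := by
  classical
  induction h with
  | length_one x hx =>
    refine ⟨fun _ => [], fun E hE F hF _ => ?_, fun E F _ _ h => by simp at h,
      fun h => absurd hx h⟩
    rw [IsMaxChainAbove.eq_empty hx hE, IsMaxChainAbove.eq_empty hx hF]
  | step x l hx hx' nodup mem_iff L rec_ordering come_first exchange ih =>
    choose g hinj hcrit hcompat using ih
    have hatom : ∀ j, x ⋖ l.get j := fun j => (mem_iff _).1 (l.get_mem j)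
    have hatop : ∀ j, l.get j < ⊤ := fun j => (rec_ordering j).lt_top
    have huniq : ∀ F, IsMaxChainAbove x F → ∀ i j, l.get i ∈ F → l.get j ∈ F → i = j := by
      intro F hF i j hi hj
      apply nodup.injective_get
      have key : ∀ i j, l.get i ∈ F → l.get j ∈ F → l.get i ≤ l.get j → l.get i = l.get j :=
        fun i j hi hj hle => (eq_or_lt_of_le hle).resolve_right
          fun hlt => (hatom j).2 (hatom i).lt hlt
      rcases hF.prop.1.total hi hj with h | h
      · exact key i j hi hj h
      · exact (key j i hj hi h).symm
    have hex : ∀ F, IsMaxChainAbove x F → ∃ j, l.get j ∈ F ∧ (∀ y ∈ F, l.get j ≤ y) ∧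
        IsMaxChainAbove (l.get j) (F.erase (l.get j)) := by
      intro F hF
      obtain ⟨a, ha, hxa, -, hmin, hF'⟩ := hF.exists_atom hx hx'
      obtain ⟨j, rfl⟩ := List.mem_iff_get.1 ((mem_iff a).2 hxa)
      exact ⟨j, ha, hmin, hF'⟩
    -- The rank is the index of the atom followed by the rank of the remainder in `[aⱼ, ⊤]`. The
    -- value `[]` never occurs on a maximal chain.
    let f : Finset P → List ℕ := fun F =>
      if h : ∃ j, l.get j ∈ F then h.choose.val :: g h.choose (F.erase (l.get h.choose)) else []
    have hf : ∀ F, IsMaxChainAbove x F → ∀ j, l.get j ∈ F →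
        f F = j.val :: g j (F.erase (l.get j)) := by
      intro F hF j hj
      have h : ∃ j, l.get j ∈ F := ⟨j, hj⟩
      have e : h.choose = j := huniq F hF _ _ h.choose_spec hj
      simp only [f, dif_pos h]
      rw [e]
    have hcomp : ∀ E F, IsMaxChainAbove x E → IsMaxChainAbove x F → ∀ i j : Fin l.length, i < j →
        l.get i ∈ E → l.get j ∈ F → f E < f F := by
      intro E F hE hF i j hij hi hj
      rw [hf E hE i hi, hf F hF j hj, List.cons_lt_cons_iff]
      exact Or.inl hij
    refine ⟨f, ?_, ?_, fun _ => hcomp⟩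
    · intro E hE F hF hEF
      obtain ⟨i, hi, -, hE'⟩ := hex E hE
      obtain ⟨j, hj, -, hF'⟩ := hex F hF
      rw [hf E hE i hi, hf F hF j hj, List.cons.injEq] at hEF
      obtain rfl : i = j := Fin.ext hEF.1
      have := hinj i hE' hF' hEF.2
      rw [← Finset.insert_erase hi, this, Finset.insert_erase hj]
    · intro E F hE hF hEF
      obtain ⟨i, hi, hEmin, hE'⟩ := hex E hE
      obtain ⟨j, hj, hFmin, hF'⟩ := hex F hF
      have hEF₀ := hEF
      rw [hf E hE i hi, hf F hF j hj, List.cons_lt_cons_iff] at hEF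
      rcases hEF with hij | ⟨hij, hlt⟩
      swap
      -- Equal atoms: apply the recursive criterion in the upper interval and put the atom back.
      · obtain rfl : i = j := Fin.ext hij
        obtain ⟨E', h1, h2, v, h3, h4, h5⟩ := hcrit i _ _ hE' hF' hlt
        rw [Finset.mem_erase] at h3
        refine ⟨insert (l.get i) E', h1.insert_atom (hatom i) (hatop i), ?_, v, h3.2, fun hv =>
          h4 (Finset.mem_erase.2 ⟨h3.1, hv⟩), fun w hw hwv => ?_⟩
        · have hn : l.get i ∉ E' := fun hh => lt_irrefl _ (h1.prop.2 _ hh).1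
          rw [hf _ (h1.insert_atom (hatom i) (hatop i)) i (Finset.mem_insert_self _ _), hf F hF i hj,
            List.cons_lt_cons_iff, Finset.erase_insert hn]
          exact Or.inr ⟨rfl, h2⟩
        · by_cases hwa : w = l.get i
          · simp [hwa]
          · exact Finset.mem_insert_of_mem (h5 w (Finset.mem_erase.2 ⟨hwa, hw⟩) hwv)
      have hij : i < j := hij
      have hjE : l.get j ∉ E := fun hh => hij.ne (huniq E hE _ _ hi hh)
      have hiF : l.get i ∉ F := fun hh => hij.ne (huniq F hF _ _ hh hj)
      -- If the remainder of `F` lies above an earlier atom `aₖ`, replacing `aⱼ` by `aₖ` gives `E'`,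
      -- and `v = aⱼ` works.
      by_cases hk : ∃ k < j, ∀ y ∈ F.erase (l.get j), l.get k < y
      · obtain ⟨k, hkj, hk⟩ := hk
        obtain ⟨E', h1, h2⟩ := exists_isMaxChainAbove_ge (x := x) (C := insert (l.get k)
          (F.erase (l.get j))) (Finset.isChain_insert hF'.prop.1 fun y hy => Or.inl (hk y hy).le)
          (fun y hy => by
            rcases Finset.mem_insert.1 hy with rfl | hy
            · exact ⟨(hatom k).lt, hatop k⟩
            · exact hF.prop.2 y (Finset.mem_of_mem_erase hy))
        refine ⟨E', h2, hcomp E' F h2 hF k j hkj (h1 (Finset.mem_insert_self _ _)) hj, l.get j, hj,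
          hjE, fun w hw hwv => h1 (Finset.mem_insert_of_mem (Finset.mem_erase.2 ⟨hwv, hw⟩))⟩
      · have hcov : ¬ l.get j ⋖ ⊤ := by
          intro hcov
          refine hk ⟨i, hij, ?_⟩
          rw [hF'.eq_empty hcov]
          simp
        obtain ⟨b, hb, hjb, hbt, hbmin, -⟩ := hF'.exists_atom (hatop j) hcov
        -- Otherwise the second element `b` of `F` lies above no earlier atom, so it comes late
        -- among the atoms of `[aⱼ, ⊤]`.
        have hbk : ¬ ∃ k < j, l.get k ≤ b := by
          rintro ⟨k, hkj, hkb⟩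
          refine hk ⟨k, hkj, fun y hy => (lt_of_le_of_ne hkb ?_).trans_le (hbmin y hy)⟩
          rintro rfl
          exact (hatom k).2 (hatom j).lt hjb.lt
        -- Take `y` to be the least common element of `E` and `F`, or the top if there is none.
        obtain ⟨y, hiy, hjy, hymin⟩ : ∃ y, l.get i < y ∧ l.get j < y ∧
            ∀ w ∈ F, w ∈ E → y ≤ w := by
          by_cases hne : (F ∩ E).Nonempty
          · obtain ⟨y, hy, hmin⟩ := IsChain.exists_least (F := F ∩ E)
              (hF.prop.1.mono (by simp)) hne
            rw [Finset.mem_inter] at hy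
            refine ⟨y, (hEmin y hy.2).lt_of_ne fun e => hiF (e ▸ hy.1),
              (hFmin y hy.1).lt_of_ne fun e => hjE (e ▸ hy.2), fun w hw hw' =>
              hmin w (Finset.mem_inter.2 ⟨hw, hw'⟩)⟩
          · refine ⟨⊤, hatop i, hatop j, fun w hw hw' => ?_⟩
            exact absurd ⟨w, Finset.mem_inter.2 ⟨hw, hw'⟩⟩ hne
        obtain ⟨k, hkj, z, hjz, hkz, hzy⟩ := exchange i j hij y hiy hjy
        have hzt : z < ⊤ := lt_top_iff_ne_top.2 fun e => hcov (e ▸ hjz)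
        have hmemL := (rec_ordering j).covBy_or.resolve_left hcov
        obtain ⟨s, hs⟩ := List.mem_iff_get.1 ((hmemL z).2 hjz)
        obtain ⟨t, ht⟩ := List.mem_iff_get.1 ((hmemL b).2 hjb)
        -- The exchange atom `z` lies above an earlier atom and `b` does not, so `come_first` lists
        -- `z` before `b`.
        have hst : s < t := by
          rcases lt_trichotomy s t with h | h | h
          · exact h
          · refine absurd ⟨k, hkj, ?_⟩ hbk
            rw [← ht, ← h, hs]
            exact hkz.le
          · refine absurd ?_ hbk
            have := List.pairwise_iff_get.1 (come_first j) t s h ⟨k, hkj, by rw [hs]; exact hkz.le⟩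
            rwa [ht] at this
        -- A maximal chain above `aⱼ` through `z` and the part of `F` from `y` on precedes `F`
        -- without `aⱼ`. It contains `F ∩ E`, so the vertex `v` that the recursive criterion finds
        -- outside it is also outside `E`.
        have hC : IsChain (· ≤ ·) ((insert z (F.filter (y ≤ ·)) : Finset P) : Set P) :=
          Finset.isChain_insert (hF.prop.1.mono fun w hw => (Finset.mem_filter.1 hw).1) fun w hw =>
            Or.inl (hzy.trans (Finset.mem_filter.1 hw).2)
        obtain ⟨E₂, h1, h2⟩ := exists_isMaxChainAbove_ge (x := l.get j) hC (fun w hw => by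
          rcases Finset.mem_insert.1 hw with rfl | hw
          · exact ⟨hjz.lt, hzt⟩
          · rw [Finset.mem_filter] at hw
            exact ⟨hjy.trans_le hw.2, (hF.prop.2 w hw.1).2⟩)
        have hlt := hcompat j hcov E₂ _ h2 hF' s t hst (hs ▸ h1 (Finset.mem_insert_self _ _))
          (ht ▸ hb)
        obtain ⟨E', h3, h4, v, h5, h6, h7⟩ := hcrit j _ _ h2 hF' hlt
        rw [Finset.mem_erase] at h5
        refine ⟨insert (l.get j) E', h3.insert_atom (hatom j) (hatop j), ?_, v, h5.2, fun hv => h6 ?_,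
          fun w hw hwv => ?_⟩
        · have hn : l.get j ∉ E' := fun hh => lt_irrefl _ (h3.prop.2 _ hh).1
          rw [hf _ (h3.insert_atom (hatom j) (hatop j)) j (Finset.mem_insert_self _ _), hf F hF j hj,
            List.cons_lt_cons_iff, Finset.erase_insert hn]
          exact Or.inr ⟨rfl, h4⟩
        · exact h1 (Finset.mem_insert_of_mem (Finset.mem_filter.2 ⟨h5.2, hymin v h5.2 hv⟩))
        · by_cases hwa : w = l.get j
          · simp [hwa]
          · exact Finset.mem_insert_of_mem (h7 w (Finset.mem_erase.2 ⟨hwa, hw⟩) hwv)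

end MaxChain

/-! ### Shellings of order complexes -/

/-- A shelling, listed in reverse order: every facet `F` meets each earlier facet `E` inside a
codimension one face of `F` which is contained in an earlier facet. -/
inductive IsReverseShelling {V : Type*} : List (Finset V) → Prop
  | nil : IsReverseShelling []
  | cons (F : Finset V) (S : List (Finset V)) (hS : IsReverseShelling S)
      (h : ∀ E ∈ S, ∃ E' ∈ S, ∃ v ∈ F, v ∉ E ∧ ∀ w ∈ F, w ≠ v → w ∈ E') :
      IsReverseShelling (F :: S)

/-- The facets of a complex can be listed in the order of a ranking which describes a shelling. -/
theorem AbstractSimplicialComplex.exists_isShelling_of_rank {V α : Type*} [Finite V]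
    [LinearOrder α] (K : AbstractSimplicialComplex V) (f : Finset V → α)
    (hinj : Set.InjOn f {F | K.IsFacet F})
    (hcrit : ∀ E F, K.IsFacet E → K.IsFacet F → f E < f F →
      ∃ E', K.IsFacet E' ∧ f E' < f F ∧ ∃ v ∈ F, v ∉ E ∧ ∀ w ∈ F, w ≠ v → w ∈ E') :
    ∃ l, K.IsShelling l ∧ IsReverseShelling l.reverse := by
  classical
  have := Fintype.ofFinite V
  let r : Finset V → Finset V → Prop := fun E F => f E ≤ f F
  have : DecidableRel r := fun _ _ => Classical.dec _
  have : Std.Total r := ⟨fun E F => le_total (f E) (f F)⟩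
  have : IsTrans _ r := ⟨fun E F G h h' => le_trans (α := α) h h'⟩
  let l₀ := (Finset.univ.filter fun F : Finset V => K.IsFacet F).toList
  let l := l₀.insertionSort r
  have hmem : ∀ F, F ∈ l ↔ K.IsFacet F := fun F => by
    rw [List.mem_insertionSort]
    simp [l₀]
  have hnd : l.Nodup := (List.perm_insertionSort r l₀).nodup_iff.2 (Finset.nodup_toList _)
  have hlt : l.Pairwise fun E F => f E < f F :=
    ((List.pairwise_insertionSort r l₀).and hnd).imp_of_mem fun {E F} hE hF hh =>
      lt_of_le_of_ne hh.1 fun e => hh.2 (hinj ((hmem _).1 hE) ((hmem _).1 hF) e)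
  refine ⟨l, ⟨hnd, hmem, fun k _ G hG => ?_⟩, ?_⟩
  · obtain ⟨hGk, i, hik, hGi⟩ := hG.prop
    obtain ⟨E', h1, h2, v, h3, h4, h5⟩ := hcrit _ _ ((hmem _).1 (l.get_mem i))
      ((hmem _).1 (l.get_mem k)) (List.pairwise_iff_get.1 hlt i k hik)
    obtain ⟨j, rfl⟩ := List.mem_iff_get.1 ((hmem E').2 h1)
    have hjk : j < k := by
      by_contra hcon
      rcases eq_or_lt_of_le (not_lt.1 hcon) with e | e
      · exact absurd h2 (e ▸ lt_irrefl _)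
      · exact (List.pairwise_iff_get.1 hlt k j e).asymm h2
    -- The ridge obtained by deleting `v` lies in an earlier facet and contains `G`, so maximality
    -- makes `G` equal to it.
    have hsub : G ⊆ (l.get k).erase v := fun w hw =>
      Finset.mem_erase.2 ⟨fun e => h4 (e ▸ hGi hw), hGk hw⟩
    have := hG.le_of_ge (y := (l.get k).erase v) ⟨Finset.erase_subset _ _, j, hjk, fun w hw => by
      rw [Finset.mem_erase] at hw
      exact h5 w hw.2 hw.1⟩ hsub
    rw [hsub.antisymm this, Finset.card_erase_add_one h3]
  · have key : ∀ L : List (Finset V), L.Pairwise (fun E F => f F < f E) →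
        (∀ F ∈ L, K.IsFacet F) → (∀ F ∈ L, ∀ E, K.IsFacet E → f E < f F → E ∈ L) →
        IsReverseShelling L := by
      intro L
      induction L with
      | nil => exact fun _ _ _ => .nil
      | cons F S ih =>
        intro hL hL' hcl
        rw [List.pairwise_cons] at hL
        have hS : ∀ E, K.IsFacet E → f E < f F → E ∈ S := fun E hE hEF =>
          (List.mem_cons.1 (hcl F (by simp) E hE hEF)).resolve_left fun e =>
            absurd hEF (e ▸ lt_irrefl _)
        refine .cons F S (ih hL.2 (fun E hE => hL' E (by simp [hE])) fun G hG E hE hEG => ?_)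
          fun E hE => ?_
        · exact hS E hE (hEG.trans (hL.1 G hG))
        · obtain ⟨E', h1, h2, h3⟩ := hcrit E F (hL' E (by simp [hE])) (hL' F (by simp)) (hL.1 E hE)
          exact ⟨E', hS E' h1 h2, h3⟩
    refine key _ (List.pairwise_reverse.2 hlt) (fun F hF => (hmem F).1 (List.mem_reverse.1 hF)) ?_
    exact fun F _ E hE _ => List.mem_reverse.2 ((hmem E).2 hE)

/-! ### Maximal chains of the extended poset and facets of the order complex. -/

section Proper

variable {Q : Type*} [PartialOrder Q] [OrderTop Q]

/-- The proper part of a poset with top, inside the poset with a bottom adjoined. -/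
def properEmbedding (Q : Type*) [PartialOrder Q] [OrderTop Q] :
    {q : Q // q ≠ ⊤} ↪o WithBot Q :=
  (OrderEmbedding.subtype _).trans WithBot.coeOrderHom

theorem bot_lt_properEmbedding (v : {q : Q // q ≠ ⊤}) : ⊥ < properEmbedding Q v :=
  WithBot.bot_lt_coe _

theorem properEmbedding_lt_top (v : {q : Q // q ≠ ⊤}) : properEmbedding Q v < ⊤ :=
  WithBot.coe_lt_coe.2 (lt_top_iff_ne_top.2 v.2)

theorem exists_properEmbedding_eq {y : WithBot Q} (h : ⊥ < y) (h' : y < ⊤) :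
    ∃ v, properEmbedding Q v = y := by
  lift y to Q using h.ne'
  exact ⟨⟨y, (WithBot.coe_lt_coe.1 h').ne⟩, rfl⟩

theorem isChain_map_properEmbedding {F : Finset {q : Q // q ≠ ⊤}} :
    IsChain (· ≤ ·) ((F.map (properEmbedding Q).toEmbedding : Finset (WithBot Q)) :
      Set (WithBot Q)) ↔ IsChain (· ≤ ·) (F : Set {q : Q // q ≠ ⊤}) := by
  rw [Finset.coe_map]
  constructor
  · intro h a ha b hb _
    have := h.total (Set.mem_image_of_mem _ ha) (Set.mem_image_of_mem _ hb)
    simpa using this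
  · intro h
    rintro _ ⟨a, ha, rfl⟩ _ ⟨b, hb, rfl⟩ _
    have := h.total ha hb
    simpa using this

theorem exists_map_properEmbedding_eq {G : Finset (WithBot Q)} (hG : ∀ y ∈ G, ⊥ < y ∧ y < ⊤) :
    ∃ F : Finset {q : Q // q ≠ ⊤}, F.map (properEmbedding Q).toEmbedding = G := by
  classical
  have : (G : Set (WithBot Q)) ⊆ Set.range (properEmbedding Q) := fun y hy =>
    exists_properEmbedding_eq (hG y hy).1 (hG y hy).2
  refine ⟨G.preimage (properEmbedding Q) (properEmbedding Q).injective.injOn, ?_⟩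
  ext y
  simp only [Finset.mem_map, Finset.mem_preimage]
  constructor
  · rintro ⟨v, hv, rfl⟩
    exact hv
  · intro hy
    obtain ⟨v, rfl⟩ := this hy
    exact ⟨v, hy, rfl⟩

theorem mem_orderComplex {P : Type*} [PartialOrder P] {F : Finset P} :
    F ∈ orderComplex P ↔ F.Nonempty ∧ IsChain (· ≤ ·) (F : Set P) := Iff.rfl

/-- Nonemptiness matters: for an empty proper part the empty chain is maximal in the open interval
but is not a face of the order complex. -/
theorem isMaxChainAbove_map_iff [Nonempty {q : Q // q ≠ ⊤}] {F : Finset {q : Q // q ≠ ⊤}} :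
    IsMaxChainAbove (⊥ : WithBot Q) (F.map (properEmbedding Q).toEmbedding) ↔
      (orderComplex {q : Q // q ≠ ⊤}).IsFacet F := by
  have hIoo : ∀ F : Finset {q : Q // q ≠ ⊤}, ∀ y ∈ F.map (properEmbedding Q).toEmbedding,
      ⊥ < y ∧ y < ⊤ := by
    intro F y hy
    obtain ⟨v, -, rfl⟩ := Finset.mem_map.1 hy
    exact ⟨bot_lt_properEmbedding v, properEmbedding_lt_top v⟩
  constructor
  · intro h
    refine ⟨⟨?_, isChain_map_properEmbedding.1 h.prop.1⟩, fun G hG hle => ?_⟩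
    · rw [Finset.nonempty_iff_ne_empty]
      rintro rfl
      obtain ⟨v⟩ := ‹Nonempty {q : Q // q ≠ ⊤}›
      have := h.le_of_ge (y := Finset.map (properEmbedding Q).toEmbedding {v})
        ⟨isChain_map_properEmbedding.2 (by simp), hIoo _⟩ (by simp)
      simp at this
    · exact Finset.map_subset_map.1 (h.le_of_ge
        ⟨isChain_map_properEmbedding.2 hG.2, hIoo _⟩ (Finset.map_subset_map.2 hle))
  · intro h
    refine ⟨⟨isChain_map_properEmbedding.2 h.prop.2, hIoo F⟩, fun G hG hle => ?_⟩
    obtain ⟨G, rfl⟩ := exists_map_properEmbedding_eq hG.2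
    rw [Finset.map_subset_map] at hle ⊢
    exact h.le_of_ge ⟨h.prop.1.mono hle, isChain_map_properEmbedding.1 hG.1⟩ hle

/-- A recursive atom ordering of a poset with a bottom adjoined yields a shelling of its proper
part. -/
theorem exists_isShelling_of_isRecursiveAtomOrdering [Finite Q] [Nonempty {q : Q // q ≠ ⊤}]
    {l : List (WithBot Q)} (h : IsRecursiveAtomOrdering (⊥ : WithBot Q) l) :
    ∃ l, (orderComplex {q : Q // q ≠ ⊤}).IsShelling l ∧ IsReverseShelling l.reverse := by
  obtain ⟨f, hinj, hcrit, -⟩ := h.exists_rank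
  refine AbstractSimplicialComplex.exists_isShelling_of_rank _
    (fun F => f (F.map (properEmbedding Q).toEmbedding)) ?_ ?_
  · intro E hE F hF hEF
    exact Finset.map_injective _
      (hinj (isMaxChainAbove_map_iff.2 hE) (isMaxChainAbove_map_iff.2 hF) hEF)
  · intro E F hE hF hEF
    obtain ⟨E', h1, h2, v, h3, h4, h5⟩ := hcrit _ _ (isMaxChainAbove_map_iff.2 hE)
      (isMaxChainAbove_map_iff.2 hF) hEF
    obtain ⟨E', rfl⟩ := exists_map_properEmbedding_eq h1.prop.2
    obtain ⟨v, hv, rfl⟩ := Finset.mem_map.1 h3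
    refine ⟨E', isMaxChainAbove_map_iff.1 h1, h2, v, hv, fun hv' => h4 (by simpa using hv'),
      fun w hw hwv => ?_⟩
    have := h5 (properEmbedding Q w) (by simpa using hw) (by simpa using hwv)
    simpa using this

end Proper

/-! ### Ranks, purity and the smallest case of the even partition poset. -/

namespace EvenPartition

variable {n : ℕ}

theorem card_parts_of_isMin {π : EvenPartition n} (h : IsMin π) : π.1.parts.card = n := by
  have h1 := π.1.sum_card_parts
  have h2 : ∀ B ∈ π.1.parts, B.card = 2 := fun B hB => by
    obtain ⟨a, ha⟩ := π.1.nonempty_of_mem_parts hB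
    rw [← π.1.part_eq_of_mem hB ha, card_part_of_isMin h]
  rw [Finset.sum_congr rfl h2, Finset.sum_const, Finset.card_univ, Fintype.card_fin] at h1
  rw [smul_eq_mul] at h1
  omega

theorem card_parts_top (hn : 1 ≤ n) : (⊤ : EvenPartition n).1.parts.card = 1 := by
  have h1 : (⊤ : EvenPartition n).1.parts ⊆ {Finset.univ} :=
    Finpartition.parts_top_subset (Finset.univ : Finset (Fin (2 * n)))
  have h2 : ((⊤ : EvenPartition n).1.parts).Nonempty := by
    refine ⟨_, (⊤ : EvenPartition n).1.part_mem.2 (Finset.mem_univ (⟨0, by omega⟩ : Fin (2 * n)))⟩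
  exact le_antisymm (Finset.card_le_card h1) h2.card_pos

theorem card_of_isMaxChainAbove (hn : 1 ≤ n) {F : Finset (WithBot (EvenPartition n))}
    (hF : IsMaxChainAbove ⊥ F) : F.card + 1 = n := by
  -- The rank counts blocks. A matching has `n` of them, so the adjoined bottom receives `n + 1`.
  let ρ : WithBot (EvenPartition n) → ℕ :=
    fun x => WithBot.recBotCoe (n + 1) (fun π : EvenPartition n => π.1.parts.card) x
  have h := IsMaxChainAbove.card_add ρ (fun a b hab => ?_) ⊥ (WithBot.bot_lt_coe _) F hF
  · have h1 : ρ ⊤ = 1 := card_parts_top hn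
    have h2 : ρ ⊥ = n + 1 := rfl
    omega
  · lift b to EvenPartition n using ne_bot_of_gt hab.lt
    induction a with
    | bot => exact congrArg (· + 1) (card_parts_of_isMin (WithBot.bot_covBy_coe.1 hab))
    | coe a => exact card_parts_covBy (WithBot.coe_covBy_coe.1 hab)

theorem nonempty_proper (hn : 2 ≤ n) : Nonempty (EvenPartitionProper n) := by
  obtain ⟨m, -, hm⟩ := Set.Finite.exists_le_minimal (Set.toFinite (Set.univ : Set (EvenPartition n)))
    (Set.mem_univ ⊤)
  have hmin : IsMin m := fun a ha => hm.le_of_le (Set.mem_univ a) ha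
  refine ⟨⟨m, fun e => ?_⟩⟩
  have := card_parts_of_isMin hmin
  rw [e, card_parts_top (by omega)] at this
  omega

theorem isEmpty_proper : IsEmpty (EvenPartitionProper 1) := by
  refine ⟨fun π => ?_⟩
  have h1 : 0 < π.1.1.parts.card :=
    Finset.card_pos.2 ⟨_, π.1.1.part_mem.2 (Finset.mem_univ (⟨0, by omega⟩ : Fin (2 * 1)))⟩
  have := card_parts_lt (lt_top_iff_ne_top.2 π.2)
  obtain ⟨m, hle, hm⟩ := Set.Finite.exists_le_minimal
    (Set.toFinite (Set.univ : Set (EvenPartition 1))) (Set.mem_univ π.1)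
  have hmin : IsMin m := fun a ha => hm.le_of_le (Set.mem_univ a) ha
  have h2 := card_parts_of_isMin hmin
  have h3 := card_parts_lt (hle.trans_lt (lt_top_iff_ne_top.2 π.2))
  rw [card_parts_top le_rfl] at h3
  omega

theorem card_of_isFacet (hn : 2 ≤ n) {F : Finset (EvenPartitionProper n)}
    (hF : (orderComplex (EvenPartitionProper n)).IsFacet F) : F.card + 1 = n := by
  have := nonempty_proper hn
  have h := card_of_isMaxChainAbove (by omega) (isMaxChainAbove_map_iff.2 hF)
  rwa [Finset.card_map] at h

end EvenPartition

/-! ### Pushing masses -/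

section PushMass

variable {V : Type*} [DecidableEq V]

/-- Push the mass of the vertices in `R` towards `u`. -/
def pushMass (R : Finset V) (hR : R.Nonempty) (u : V) (t : ℝ) (w : V → ℝ) : V → ℝ := fun v =>
  w v + t * R.inf' hR w * ((if v = u then (R.card : ℝ) else 0) - if v ∈ R then 1 else 0)

theorem continuous_pushMass (R : Finset V) (hR : R.Nonempty) (u : V) :
    Continuous fun p : ℝ × (V → ℝ) => pushMass R hR u p.1 p.2 := by
  refine continuous_pi fun v => ?_
  unfold pushMass
  have : Continuous fun p : ℝ × (V → ℝ) => R.inf' hR p.2 :=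
    Continuous.finset_inf'_apply hR fun i _ => (continuous_apply i).comp continuous_snd
  fun_prop

/-- The mass taken from each vertex of `R` is proportional to the minimum over `R`. Hence points
whose support does not contain `R`, in particular all points of the old complex, stay fixed. -/
theorem pushMass_of_eq_zero {R : Finset V} (hR : R.Nonempty) (u : V) (t : ℝ) {w : V → ℝ}
    (hw : ∀ v, 0 ≤ w v) {v : V} (hv : v ∈ R) (h : w v = 0) : pushMass R hR u t w = w := by
  have : R.inf' hR w = 0 :=
    le_antisymm (h ▸ Finset.inf'_le w hv) ((Finset.le_inf'_iff hR w).2 fun v _ => hw v)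
  funext v
  simp [pushMass, this]

theorem pushMass_nonneg {R : Finset V} (hR : R.Nonempty) {u : V} (hu : u ∉ R) {t : ℝ}
    (ht : t ∈ unitInterval) {w : V → ℝ} (hw : ∀ v, 0 ≤ w v) (v : V) :
    0 ≤ pushMass R hR u t w v := by
  have hm : 0 ≤ R.inf' hR w := (Finset.le_inf'_iff hR w).2 fun v _ => hw v
  have htm := mul_nonneg ht.1 hm
  unfold pushMass
  by_cases h1 : v ∈ R
  · have h2 : v ≠ u := fun e => hu (e ▸ h1)
    have h3 : R.inf' hR w ≤ w v := Finset.inf'_le w h1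
    have h4 : t * R.inf' hR w ≤ 1 * R.inf' hR w := mul_le_mul_of_nonneg_right ht.2 hm
    simp only [h2, h1, if_true, if_false]
    linarith
  · simp only [h1, if_false, sub_zero]
    refine add_nonneg (hw v) (mul_nonneg htm ?_)
    split_ifs <;> positivity

theorem pushMass_eq_zero {R : Finset V} (hR : R.Nonempty) {u v : V} {t : ℝ} {w : V → ℝ}
    (h1 : v ≠ u) (h2 : v ∉ R) (h3 : w v = 0) : pushMass R hR u t w v = 0 := by
  simp [pushMass, h1, h2, h3]

/-- Toggling `u` is a sign-reversing involution on the sets between `R` and `F`. -/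
theorem sum_neg_one_pow_card_filter {R F : Finset V} {u : V} (huF : u ∈ F) (huR : u ∉ R) :
    ∑ G ∈ F.powerset.filter (R ⊆ ·), (-1 : ℤ) ^ G.card = 0 := by
  refine Finset.sum_involution (fun G _ => if u ∈ G then G.erase u else insert u G) ?_ ?_ ?_ ?_
  · intro G _
    split_ifs with h
    · rw [← Finset.card_erase_add_one h, pow_succ]
      ring
    · rw [Finset.card_insert_of_notMem h, pow_succ]
      ring
  · intro G _ _ h
    by_cases hu : u ∈ G
    · rw [if_pos hu] at h
      exact Finset.notMem_erase u G (by rw [h]; exact hu)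
    · rw [if_neg hu] at h
      exact hu (h ▸ Finset.mem_insert_self u G)
  · intro G hG
    rw [Finset.mem_filter, Finset.mem_powerset] at hG ⊢
    split_ifs with h
    · exact ⟨(Finset.erase_subset _ _).trans hG.1, Finset.subset_erase.2 ⟨hG.2, huR⟩⟩
    · exact ⟨Finset.insert_subset huF hG.1, hG.2.trans (Finset.subset_insert _ _)⟩
  · intro G _
    by_cases hu : u ∈ G
    · simp [hu, Finset.insert_erase]
    · simp [hu]

/-- The restriction of a facet of a shelling: the new faces are those which contain it. -/
theorem exists_restriction {F : Finset V} {S : List (Finset V)}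
    (h : ∀ E ∈ S, ∃ E' ∈ S, ∃ v ∈ F, v ∉ E ∧ ∀ w ∈ F, w ≠ v → w ∈ E') :
    ∃ R ⊆ F, ∀ G ⊆ F, (∃ E ∈ S, G ⊆ E) ↔ ¬ R ⊆ G := by
  classical
  -- The restriction consists of the vertices `v` for which `F` without `v` lies in an earlier
  -- facet.
  refine ⟨F.filter fun v => ∃ E ∈ S, ∀ w ∈ F, w ≠ v → w ∈ E, Finset.filter_subset _ _,
    fun G hG => ⟨?_, fun hR => ?_⟩⟩
  · rintro ⟨E, hE, hGE⟩ hR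
    obtain ⟨E', hE', v, hv, hvE, hw⟩ := h E hE
    exact hvE (hGE (hR (Finset.mem_filter.2 ⟨hv, E', hE', hw⟩)))
  · obtain ⟨v, hv, hvG⟩ := Finset.not_subset.1 hR
    obtain ⟨hvF, E, hE, hw⟩ := Finset.mem_filter.1 hv
    exact ⟨E, hE, fun w hwG => hw w (hG hwG) fun e => hvG (e ▸ hwG)⟩

end PushMass

/-! ### Realizations of families of faces -/

section Realization

variable {V : Type*} [Fintype V]

/-- The points of `ℝ^V` with nonnegative coordinates of sum `1` supported on a member of `A`. -/
def faceRealization (A : Finset (Finset V)) : Set (V → ℝ) :=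
  {w | (∀ v, 0 ≤ w v) ∧ ∑ v, w v = 1 ∧ ∃ s ∈ A, ∀ v ∉ s, w v = 0}

/-- A family of faces may contain the empty set, which is convenient for Euler characteristics. It
contributes no points, since the coordinates sum to one. -/
theorem AbstractSimplicialComplex.realization_eq (K : AbstractSimplicialComplex V)
    (A : Finset (Finset V)) (hA : ∀ s : Finset V, s.Nonempty → (s ∈ A ↔ s ∈ K)) :
    K.realization = faceRealization A := by
  ext w
  have hsum : ∀ s : Finset V, (∀ v ∉ s, w v = 0) → ∑ v ∈ s, w v = ∑ v, w v := fun s hs =>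
    Finset.sum_subset (Finset.subset_univ s) fun v _ hv => hs v hv
  constructor
  · rintro ⟨h0, s, hs, hsupp, h1⟩
    refine ⟨h0, by rw [← hsum s hsupp, h1], s, (hA s ?_).2 hs, hsupp⟩
    exact (K.isRelLowerSet_faces hs).1
  · rintro ⟨h0, h1, s, hs, hsupp⟩
    have h2 := (hsum s hsupp).trans h1
    refine ⟨h0, s, (hA s ?_).1 hs, hsupp, h2⟩
    rw [Finset.nonempty_iff_ne_empty]
    rintro rfl
    simp at h2

theorem isClosed_faceRealization (A : Finset (Finset V)) : IsClosed (faceRealization A) := by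
  have : faceRealization A = {w | ∀ v, 0 ≤ w v} ∩ ({w | ∑ v, w v = 1} ∩
      ⋃ s ∈ A, {w | ∀ v ∉ s, w v = 0}) := by
    ext w
    simp [faceRealization]
  rw [this]
  refine IsClosed.inter ?_ (IsClosed.inter ?_ ?_)
  · simp only [Set.ofPred_forall]
    exact isClosed_iInter fun v => isClosed_le continuous_const (continuous_apply v)
  · exact isClosed_eq (by fun_prop) continuous_const
  · refine Set.Finite.isClosed_biUnion A.finite_toSet fun s _ => ?_
    simp only [Set.ofPred_forall]
    exact isClosed_iInter fun v => isClosed_iInter fun _ =>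
      isClosed_eq (continuous_apply v) continuous_const

theorem isCompact_faceRealization (A : Finset (Finset V)) : IsCompact (faceRealization A) := by
  refine (isCompact_univ_pi fun _ : V => isCompact_Icc (a := (0 : ℝ)) (b := 1)).of_isClosed_subset
    (isClosed_faceRealization A) fun w hw v _ => ⟨hw.1 v, ?_⟩
  rw [← hw.2.1]
  exact Finset.single_le_sum (fun v _ => hw.1 v) (Finset.mem_univ v)

theorem faceRealization_mono {A A' : Finset (Finset V)} (h : A ⊆ A') :
    faceRealization A ⊆ faceRealization A' :=
  fun _ hw => ⟨hw.1, hw.2.1, hw.2.2.imp fun _ hs => ⟨h hs.1, hs.2⟩⟩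

theorem contractibleSpace_faceRealization_powerset {F : Finset V} (hF : F.Nonempty) :
    ContractibleSpace (faceRealization F.powerset) := by
  classical
  have heq : faceRealization F.powerset =
      {w | (∀ v, 0 ≤ w v) ∧ ∑ v, w v = 1 ∧ ∀ v ∉ F, w v = 0} := by
    ext w
    refine and_congr_right fun _ => and_congr_right fun _ => ⟨?_, fun h => ⟨F, by simp, h⟩⟩
    rintro ⟨s, hs, h⟩ v hv
    exact h v fun hv' => hv (Finset.mem_powerset.1 hs hv')
  have hconv : Convex ℝ (faceRealization F.powerset) := by
    rw [heq]
    rintro x ⟨hx0, hx1, hx2⟩ y ⟨hy0, hy1, hy2⟩ a b ha hb hab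
    refine ⟨fun v => ?_, ?_, fun v hv => ?_⟩
    · exact add_nonneg (mul_nonneg ha (hx0 v)) (mul_nonneg hb (hy0 v))
    · simp only [Pi.add_apply, Pi.smul_apply, smul_eq_mul, Finset.sum_add_distrib,
        ← Finset.mul_sum, hx1, hy1, mul_one, hab]
    · simp [hx2 v hv, hy2 v hv]
  obtain ⟨u, hu⟩ := hF
  refine hconv.contractibleSpace ⟨Pi.single u 1, ?_⟩
  rw [heq]
  refine ⟨fun v => ?_, by simp, fun v hv => ?_⟩
  · by_cases h : v = u
    · subst h; simp
    · simp [h]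
  · rw [Pi.single_eq_of_ne]
    rintro rfl
    exact hv hu

/-! ### Elementary collapses -/

variable [DecidableEq V]

theorem sum_pushMass {R : Finset V} (hR : R.Nonempty) (u : V) (t : ℝ) (w : V → ℝ) :
    ∑ v, pushMass R hR u t w v = ∑ v, w v := by
  unfold pushMass
  rw [Finset.sum_add_distrib, ← Finset.mul_sum, Finset.sum_sub_distrib]
  simp

/-- Attaching the faces between `R` and `F`, where `R` is neither empty nor equal to `F`, does not
change the homotopy type. -/
theorem contractibleSpace_faceRealization_union {A : Finset (Finset V)} {R F : Finset V} {u : V}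
    (hR : R.Nonempty) (hRF : R ⊆ F) (huF : u ∈ F) (huR : u ∉ R)
    (hA : ∀ s ∈ A, ∀ s' ⊆ s, s' ∈ A) (hRA : R ∉ A) (hbd : ∀ v ∈ R, F.erase v ∈ A)
    [ContractibleSpace (faceRealization A)] :
    ContractibleSpace (faceRealization (A ∪ F.powerset.filter (R ⊆ ·))) := by
  set A' := A ∪ F.powerset.filter (R ⊆ ·) with hA'
  have hAA' : A ⊆ A' := Finset.subset_union_left
  have hfix : ∀ w ∈ faceRealization A, ∀ t, pushMass R hR u t w = w := by
    rintro w ⟨h0, -, s, hs, hsupp⟩ t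
    obtain ⟨v, hv, hvs⟩ := Finset.not_subset.1 fun h => hRA (hA s hs R h)
    exact pushMass_of_eq_zero hR u t h0 hv (hsupp v hvs)
  have hmem : ∀ t ∈ unitInterval, ∀ w ∈ faceRealization A',
      pushMass R hR u t w ∈ faceRealization A' := by
    rintro t ht w ⟨h0, h1, s, hs, hsupp⟩
    rcases Finset.mem_union.1 hs with hs | hs
    · rw [hfix w ⟨h0, h1, s, hs, hsupp⟩]
      exact ⟨h0, h1, s, hAA' hs, hsupp⟩
    · rw [Finset.mem_filter, Finset.mem_powerset] at hs
      refine ⟨pushMass_nonneg hR huR ht h0, by rw [sum_pushMass, h1], F,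
        Finset.mem_union_right _ (by simp [hRF]), fun v hv => ?_⟩
      exact pushMass_eq_zero hR (fun e => hv (e ▸ huF)) (fun h => hv (hRF h))
        (hsupp v fun h => hv (hs.1 h))
  -- At time one a vertex of `R` of minimal mass has lost everything, so the point lands on a face
  -- `F.erase v₀`, which lies in `A`.
  have hret : ∀ w ∈ faceRealization A', pushMass R hR u 1 w ∈ faceRealization A := by
    rintro w ⟨h0, h1, s, hs, hsupp⟩
    rcases Finset.mem_union.1 hs with hs | hs
    · rw [hfix w ⟨h0, h1, s, hs, hsupp⟩]
      exact ⟨h0, h1, s, hs, hsupp⟩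
    · rw [Finset.mem_filter, Finset.mem_powerset] at hs
      obtain ⟨v₀, hv₀, hmin⟩ := Finset.exists_mem_eq_inf' hR w
      refine ⟨pushMass_nonneg hR huR ⟨zero_le_one, le_rfl⟩ h0, by rw [sum_pushMass, h1],
        F.erase v₀, hbd v₀ hv₀, fun v hv => ?_⟩
      by_cases h : v = v₀
      · subst h
        have h2 : v ≠ u := fun e => huR (e ▸ hv₀)
        simp [pushMass, h2, hv₀, hmin]
      · have hvF : v ∉ F := fun h' => hv (Finset.mem_erase.2 ⟨h, h'⟩)
        exact pushMass_eq_zero hR (fun e => hvF (e ▸ huF)) (fun h => hvF (hRF h))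
          (hsupp v fun h => hvF (hs.1 h))
  let i : C(faceRealization A, faceRealization A') :=
    ⟨Set.inclusion (faceRealization_mono hAA'), continuous_inclusion _⟩
  let r : C(faceRealization A', faceRealization A) :=
    ⟨fun w => ⟨pushMass R hR u 1 w.1, hret w.1 w.2⟩,
      ((continuous_pushMass R hR u).comp
        (continuous_const.prodMk continuous_subtype_val)).subtype_mk _⟩
  have hri : r.comp i = ContinuousMap.id _ := by
    ext1 w
    exact Subtype.ext (hfix w.1 w.2 1)
  let H : (ContinuousMap.id (faceRealization A')).Homotopy (i.comp r) :=
    { toFun := fun p => ⟨pushMass R hR u p.1 p.2.1, hmem _ p.1.2 _ p.2.2⟩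
      continuous_toFun := ((continuous_pushMass R hR u).comp
        ((continuous_subtype_val.comp continuous_fst).prodMk
          (continuous_subtype_val.comp continuous_snd))).subtype_mk _
      map_zero_left := fun w => Subtype.ext (by funext v; simp [pushMass])
      map_one_left := fun w => rfl }
  let e : faceRealization A' ≃ₕ faceRealization A :=
    { toFun := r
      invFun := i
      left_inv := ⟨H.symm⟩
      right_inv := by rw [hri] }
  exact e.contractibleSpace

/-! ### The structure of shellable complexes -/

/-- A pure shellable complex consists of a contractible subcomplex `A` and of facets `B` whose
boundaries lie in `A`. -/
theorem IsReverseShelling.exists_contractible {S : List (Finset V)} (hS : IsReverseShelling S)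
    {c : ℕ} (hc : 0 < c) (hne : S ≠ []) (hcard : ∀ F ∈ S, F.card = c) :
    ∃ A B : Finset (Finset V), Disjoint A B ∧ (∀ G, G ∈ A ∪ B ↔ ∃ F ∈ S, G ⊆ F) ∧
      (∀ s ∈ A, ∀ s' ⊆ s, s' ∈ A) ∧ (∀ F ∈ B, F.card = c ∧ ∀ v ∈ F, F.erase v ∈ A) ∧
      ContractibleSpace (faceRealization A) ∧ ∑ G ∈ A, (-1 : ℤ) ^ G.card = 0 := by
  induction hS with
  | nil => exact absurd rfl hne
  | cons F S hS h ih =>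
    have hFc : F.card = c := hcard F (by simp)
    by_cases hS0 : S = []
    · subst hS0
      have hFn : F.Nonempty := Finset.card_pos.1 (by omega)
      refine ⟨F.powerset, ∅, by simp, by simp, fun s hs s' hs' => ?_, by simp,
        contractibleSpace_faceRealization_powerset hFn, ?_⟩
      · exact Finset.mem_powerset.2 (hs'.trans (Finset.mem_powerset.1 hs))
      · exact Finset.sum_powerset_neg_one_pow_card_of_nonempty hFn
    · obtain ⟨A, B, hAB, hmem, hA, hB, hcontr, hsum⟩ :=
        ih hS0 fun E hE => hcard E (List.mem_cons_of_mem _ hE)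
      obtain ⟨R, hRF, hR⟩ := exists_restriction h
      -- Members of `B` have full size, so an old proper face of `F` belongs to `A`.
      have hnotB : ∀ G ⊆ F, G ≠ F → G ∈ A ∪ B → G ∈ A := by
        intro G hG hne hGm
        refine (Finset.mem_union.1 hGm).resolve_right fun hGB => hne ?_
        exact Finset.eq_of_subset_of_card_le hG (by rw [(hB G hGB).1, hFc])
      have herase : ∀ v ∈ R, F.erase v ∈ A := by
        intro v hv
        refine hnotB _ (Finset.erase_subset _ _) (fun e => ?_) ((hmem _).2 ((hR _
          (Finset.erase_subset _ _)).2 fun hh => Finset.notMem_erase v F (hh hv)))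
        exact Finset.notMem_erase v F (e.symm ▸ hRF hv)
      have hnew : ∀ G, G ∈ F.powerset.filter (R ⊆ ·) → G ∉ A ∪ B := by
        intro G hG
        rw [Finset.mem_filter, Finset.mem_powerset] at hG
        rw [hmem, hR G hG.1]
        exact fun hn => hn hG.2
      have hmem' : ∀ G, (∃ E ∈ F :: S, G ⊆ E) ↔
          G ∈ A ∪ B ∨ G ∈ F.powerset.filter (R ⊆ ·) := by
        intro G
        rw [hmem, Finset.mem_filter, Finset.mem_powerset]
        constructor
        · rintro ⟨E, hE, hGE⟩
          rcases List.mem_cons.1 hE with rfl | hE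
          · by_cases hRG : R ⊆ G
            · exact Or.inr ⟨hGE, hRG⟩
            · exact Or.inl ((hR G hGE).2 hRG)
          · exact Or.inl ⟨E, hE, hGE⟩
        · rintro (⟨E, hE, hGE⟩ | hG)
          · exact ⟨E, List.mem_cons_of_mem _ hE, hGE⟩
          · exact ⟨F, by simp, hG.1⟩
      -- If `R = F`, the facet is the only new face and is set aside in `B`. Otherwise the new faces
      -- are added to `A` by a collapse, and their signs cancel in pairs.
      by_cases hRe : R = F
      · subst hRe
        have hsing : R.powerset.filter (R ⊆ ·) = {R} := by
          ext G
          rw [Finset.mem_filter, Finset.mem_powerset, Finset.mem_singleton]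
          exact ⟨fun hh => hh.1.antisymm hh.2, fun e => by subst e; simp⟩
        rw [hsing] at hnew hmem'
        have hRn := hnew R (by simp)
        refine ⟨A, insert R B, ?_, fun G => ?_, hA, fun E hE => ?_, hcontr, hsum⟩
        · rw [Finset.disjoint_insert_right]
          exact ⟨fun hh => hRn (Finset.mem_union_left _ hh), hAB⟩
        · rw [hmem']
          simp only [Finset.mem_union, Finset.mem_insert, Finset.mem_singleton]
          tauto
        · rcases Finset.mem_insert.1 hE with rfl | hE
          · exact ⟨hFc, herase⟩
          · exact hB E hE
      · obtain ⟨u, huF, huR⟩ := Finset.exists_of_ssubset (lt_of_le_of_ne hRF hRe)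
        have hRn : R.Nonempty := by
          rw [Finset.nonempty_iff_ne_empty]
          rintro rfl
          obtain ⟨E, hE⟩ := List.exists_mem_of_ne_nil S hS0
          exact (hR ∅ (by simp)).1 ⟨E, hE, by simp⟩ (by simp)
        have hdisj : Disjoint A (F.powerset.filter (R ⊆ ·)) := by
          rw [Finset.disjoint_right]
          exact fun G hG hGA => hnew G hG (Finset.mem_union_left _ hGA)
        refine ⟨A ∪ F.powerset.filter (R ⊆ ·), B, ?_, fun G => ?_, ?_, fun E hE => ?_, ?_, ?_⟩
        · rw [Finset.disjoint_union_left]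
          refine ⟨hAB, Finset.disjoint_left.2 fun G hG hGB => ?_⟩
          exact hnew G hG (Finset.mem_union_right _ hGB)
        · rw [hmem']
          simp only [Finset.mem_union]
          tauto
        · intro s hs s' hs'
          rcases Finset.mem_union.1 hs with hs | hs
          · exact Finset.mem_union_left _ (hA s hs s' hs')
          · rw [Finset.mem_filter, Finset.mem_powerset] at hs
            by_cases hRs : R ⊆ s'
            · refine Finset.mem_union_right _ ?_
              rw [Finset.mem_filter, Finset.mem_powerset]
              exact ⟨hs'.trans hs.1, hRs⟩
            · refine Finset.mem_union_left _ (hnotB s' (hs'.trans hs.1) ?_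
                ((hmem _).2 ((hR _ (hs'.trans hs.1)).2 hRs)))
              rintro rfl
              exact hRs hRF
        · exact ⟨(hB E hE).1, fun v hv => Finset.mem_union_left _ ((hB E hE).2 v hv)⟩
        · refine contractibleSpace_faceRealization_union hRn hRF huF huR hA (fun hRA => ?_) herase
          exact hnew R (by simp [hRF]) (Finset.mem_union_left _ hRA)
        · rw [Finset.sum_union hdisj, hsum, sum_neg_one_pow_card_filter huF huR, add_zero]

end Realization

/-! ### Collapsing a contractible subspace -/

/-- A quotient map collapsing a subspace `S` is a homotopy equivalence if the identity is homotopic,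
relative to `S`, to a map which is constant on `S`. -/
theorem nonempty_homotopyEquiv_of_collapse {X W : Type*} [TopologicalSpace X] [TopologicalSpace W]
    [CompactSpace X] [T2Space W] (f : C(X, W)) (hf : Function.Surjective f) (S : Set X)
    (hfib : ∀ x y, f x = f y → x = y ∨ (x ∈ S ∧ y ∈ S)) (hS : ∀ x ∈ S, ∀ y ∈ S, f x = f y)
    (H : C(unitInterval × X, X)) (H0 : ∀ x, H (0, x) = x) (HS : ∀ t, ∀ x ∈ S, H (t, x) ∈ S)
    (H1 : ∀ x ∈ S, ∀ y ∈ S, H (1, x) = H (1, y)) : Nonempty (X ≃ₕ W) := by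
  have hq : Topology.IsQuotientMap f := f.continuous.isClosedMap.isQuotientMap f.continuous hf
  let F : C(unitInterval × X, unitInterval × W) := (ContinuousMap.id _).prodMap f
  -- The product with the interval is again a closed map from a compact to a Hausdorff space, so
  -- homotopies descend along it.
  have hF : Topology.IsQuotientMap F := F.continuous.isClosedMap.isQuotientMap F.continuous
    (Function.surjective_id.prodMap hf)
  let h₁ : C(X, X) := H.comp ((ContinuousMap.const X 1).prodMk (ContinuousMap.id X))
  have hg : Function.FactorsThrough h₁ f := by
    intro x y hxy
    rcases hfib x y hxy with rfl | ⟨hx, hy⟩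
    · rfl
    · exact H1 x hx y hy
  let g : C(W, X) := hq.lift h₁ hg
  have hgf : ∀ x, g (f x) = H (1, x) := fun x => by
    have := congrArg (fun q : C(X, X) => q x) (hq.lift_comp h₁ hg)
    exact this
  have hk : Function.FactorsThrough (f.comp H) F := by
    rintro ⟨t, x⟩ ⟨t', y⟩ hxy
    obtain ⟨rfl, h⟩ : t = t' ∧ f x = f y := Prod.ext_iff.1 hxy
    rcases hfib x y h with rfl | ⟨hx, hy⟩
    · rfl
    · exact hS _ (HS t x hx) _ (HS t y hy)
  let k : C(unitInterval × W, W) := hF.lift (f.comp H) hk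
  have hkF : ∀ t x, k (t, f x) = f (H (t, x)) := fun t x => by
    have := congrArg (fun q : C(unitInterval × X, W) => q (t, x)) (hF.lift_comp (f.comp H) hk)
    exact this
  let HX : (ContinuousMap.id X).Homotopy (g.comp f) :=
    { toContinuousMap := H
      map_zero_left := H0
      map_one_left := fun x => (hgf x).symm }
  let HW : (ContinuousMap.id W).Homotopy (f.comp g) :=
    { toContinuousMap := k
      map_zero_left := fun w => by
        obtain ⟨x, rfl⟩ := hf w
        exact (hkF 0 x).trans (congrArg f (H0 x))
      map_one_left := fun w => by
        obtain ⟨x, rfl⟩ := hf w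
        exact (hkF 1 x).trans (congrArg f (hgf x).symm) }
  exact ⟨{ toFun := f, invFun := g, left_inv := ⟨HX.symm⟩, right_inv := ⟨HW.symm⟩ }⟩

/-- A contraction of a subspace `S` extends to the whole space if a collar of `S` can be
stretched. -/
theorem exists_homotopy_of_expansion {X : Type*} [TopologicalSpace X] (S : Set X)
    [ContractibleSpace S] (e : C(unitInterval × X, X)) (s : C(unitInterval × X, ℝ))
    (h : ∀ p, 0 ≤ s p → e p ∈ S) (he0 : ∀ x, e (0, x) = x) (hs0 : ∀ x, s (0, x) ≤ 0)
    (heS : ∀ t, ∀ x ∈ S, e (t, x) = x) (hsS : ∀ (t : unitInterval), ∀ x ∈ S, s (t, x) = t) :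
    ∃ H : C(unitInterval × X, X), (∀ x, H (0, x) = x) ∧ (∀ t, ∀ x ∈ S, H (t, x) ∈ S) ∧
      ∀ x ∈ S, ∀ y ∈ S, H (1, x) = H (1, y) := by
  classical
  obtain ⟨x₀, ⟨c⟩⟩ := id_nullhomotopic S
  let k : ℝ → X → X := fun t x =>
    if hx : x ∈ S then (c (Set.projIcc 0 1 zero_le_one t, ⟨x, hx⟩) : S).1 else x
  have hk : ∀ t x (hx : x ∈ S), k t x = (c (Set.projIcc 0 1 zero_le_one t, ⟨x, hx⟩) : S).1 :=
    fun t x hx => dif_pos hx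
  have hkc : ContinuousOn (fun p => k (s p) (e p)) {p | 0 ≤ s p} := by
    rw [continuousOn_iff_continuous_domRestrict]
    have : Set.domRestrict {p | 0 ≤ s p} (fun p => k (s p) (e p)) = fun p =>
        (c (Set.projIcc 0 1 zero_le_one (s p.1), ⟨e p.1, h p.1 p.2⟩) : S).1 := by
      funext p
      exact hk _ _ _
    rw [this]
    refine continuous_subtype_val.comp (c.continuous.comp (Continuous.prodMk ?_ ?_))
    · exact continuous_projIcc.comp (s.continuous.comp continuous_subtype_val)
    · exact (e.continuous.comp continuous_subtype_val).subtype_mk _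
  -- Follow the expansion `e` until it enters `S`, then run the contraction at time `s`. The two
  -- rules agree where `s = 0`, because the contraction starts at the identity.
  have hc : Continuous fun p => if s p ≤ 0 then e p else k (s p) (e p) := by
    refine continuous_if_le s.continuous continuous_const e.continuous.continuousOn hkc ?_
    intro p hp
    have : e p ∈ S := h p hp.ge
    rw [hp, hk _ _ this, Set.projIcc_left]
    have := c.apply_zero ⟨e p, this⟩
    exact (congrArg Subtype.val this).symm
  refine ⟨⟨_, hc⟩, fun x => ?_, fun t x hx => ?_, fun x hx y hy => ?_⟩
  · simp [hs0, he0]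
  · simp only [ContinuousMap.coe_mk, heS t x hx]
    split_ifs
    · exact hx
    · rw [hk _ _ hx]
      exact (c (_, _)).2
  · have hone : ∀ x ∈ S, (if s (1, x) ≤ 0 then e (1, x) else k (s (1, x)) (e (1, x))) = x₀.1 := by
      intro x hx
      rw [heS 1 x hx, hsS 1 x hx, if_neg (by simp), hk _ _ hx]
      have := c.apply_one ⟨x, hx⟩
      rw [Set.Icc.coe_one, Set.projIcc_right]
      exact congrArg Subtype.val this
    exact (hone x hx).trans (hone y hy).symm

/-! ### Wedges of spheres -/

theorem sphereBase_mem (d : ℕ) :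
    sphereBase (d + 1) ∈ Metric.sphere (0 : EuclideanSpace ℝ (Fin (d + 1))) 1 := by
  rw [mem_sphere_zero_iff_norm, EuclideanSpace.norm_eq, Real.sqrt_eq_one]
  simp [sphereBase]

/-- The coordinates of a point of a wedge of spheres. -/
def wedgeCoord (r d : ℕ) (i : Fin r) :
    SphereWedge r (d + 1) → Metric.sphere (0 : EuclideanSpace ℝ (Fin (d + 1))) 1 :=
  Quotient.lift (fun x => if x.1 = i then x.2 else ⟨_, sphereBase_mem d⟩) (by
    rintro ⟨j, x⟩ ⟨j', y⟩ (h | ⟨h, h'⟩)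
    · rw [h]
    · have hx : x = ⟨_, sphereBase_mem d⟩ := Subtype.ext h
      have hy : y = ⟨_, sphereBase_mem d⟩ := Subtype.ext h'
      simp [hx, hy])

theorem wedgeCoord_mk {r d : ℕ} (i j : Fin r)
    (x : Metric.sphere (0 : EuclideanSpace ℝ (Fin (d + 1))) 1) :
    wedgeCoord r d i (Quotient.mk _ (j, x)) = if j = i then x else ⟨_, sphereBase_mem d⟩ := rfl

theorem continuous_wedgeCoord (r d : ℕ) (i : Fin r) : Continuous (wedgeCoord r d i) := by
  refine continuous_quot_lift _ ?_
  rw [continuous_prod_of_discrete_left]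
  intro j
  by_cases h : j = i
  · simpa [h] using continuous_id'
  · simpa [h] using continuous_const

/-- Embedding the wedge in a product of spheres makes it Hausdorff and lets equality and continuity
be checked coordinatewise. -/
theorem wedgeCoord_injective {r d : ℕ} {x y : SphereWedge r (d + 1)}
    (h : ∀ i, wedgeCoord r d i x = wedgeCoord r d i y) : x = y := by
  induction x using Quotient.inductionOn with
  | _ x =>
  induction y using Quotient.inductionOn with
  | _ y =>
  obtain ⟨i, x⟩ := x
  obtain ⟨j, y⟩ := y
  have h1 := h i
  have h2 := h j
  rw [wedgeCoord_mk, wedgeCoord_mk] at h1 h2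
  by_cases hij : i = j
  · subst hij
    rw [if_pos rfl, if_pos rfl] at h1
    rw [h1]
  · rw [if_pos rfl, if_neg (Ne.symm hij)] at h1
    rw [if_pos rfl, if_neg hij] at h2
    apply Quotient.sound
    exact Or.inr ⟨congrArg Subtype.val h1, congrArg Subtype.val h2.symm⟩

instance (r d : ℕ) : T2Space (SphereWedge r (d + 1)) :=
  T2Space.of_injective_continuous
    (f := fun x i => wedgeCoord r d i x) (fun _ _ h => wedgeCoord_injective (congrFun h))
    (continuous_pi fun i => continuous_wedgeCoord r d i)

theorem continuous_of_wedgeCoord {X : Type*} [TopologicalSpace X] {r d : ℕ}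
    {f : X → SphereWedge r (d + 1)} (hf : ∀ i, Continuous fun x => wedgeCoord r d i (f x)) :
    Continuous f := by
  have : Topology.IsClosedEmbedding (fun (x : SphereWedge r (d + 1)) i => wedgeCoord r d i x) :=
    Continuous.isClosedEmbedding (continuous_pi fun i => continuous_wedgeCoord r d i)
      (fun _ _ h => wedgeCoord_injective (congrFun h))
  exact this.isEmbedding.continuous_iff.2 (continuous_pi hf)

/-! ### Maps of simplices onto spheres -/

section Cell

variable {V : Type*} {d : ℕ}

/-- The smallest of the coordinates at the vertices listed by `ε`. -/
def minCoord (ε : Fin (d + 1) → V) (w : V → ℝ) : ℝ :=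
  Finset.univ.inf' Finset.univ_nonempty fun j => w (ε j)

theorem minCoord_le (ε : Fin (d + 1) → V) (w : V → ℝ) (j : Fin (d + 1)) : minCoord ε w ≤ w (ε j) :=
  Finset.inf'_le (fun j => w (ε j)) (Finset.mem_univ j)

theorem exists_minCoord_eq (ε : Fin (d + 1) → V) (w : V → ℝ) : ∃ j, minCoord ε w = w (ε j) := by
  obtain ⟨j, -, hj⟩ := Finset.exists_mem_eq_inf' Finset.univ_nonempty fun j => w (ε j)
  exact ⟨j, hj⟩

theorem minCoord_nonneg (ε : Fin (d + 1) → V) {w : V → ℝ} (hw : ∀ v, 0 ≤ w v) :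
    0 ≤ minCoord ε w := by
  obtain ⟨j, hj⟩ := exists_minCoord_eq ε w
  rw [hj]
  exact hw _

theorem minCoord_eq_zero (ε : Fin (d + 1) → V) {w : V → ℝ} (hw : ∀ v, 0 ≤ w v) {j : Fin (d + 1)}
    (h : w (ε j) = 0) : minCoord ε w = 0 :=
  le_antisymm (h ▸ minCoord_le ε w j) (minCoord_nonneg ε hw)

theorem continuous_minCoord (ε : Fin (d + 1) → V) : Continuous (minCoord ε) :=
  Continuous.finset_inf'_apply _ fun j _ => continuous_apply (ε j)

/-- The denominator of `cellMap`. -/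
def cellDenom (ε : Fin (d + 1) → V) (w : V → ℝ) : ℝ :=
  minCoord ε w ^ 2 + ∑ j, (w (ε j) - w (ε 0)) ^ 2 + (1 - ∑ j, w (ε j)) ^ 2

/-- The summand `(1 - ∑ j, w (ε j)) ^ 2` vanishes on the simplex. Off it, it excludes the only other
zero, where all listed coordinates are zero. -/
theorem cellDenom_pos (ε : Fin (d + 1) → V) (w : V → ℝ) : 0 < cellDenom ε w := by
  have h1 : 0 ≤ minCoord ε w ^ 2 := sq_nonneg _
  have h2 : 0 ≤ ∑ j, (w (ε j) - w (ε 0)) ^ 2 := Finset.sum_nonneg fun _ _ => sq_nonneg _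
  have h3 : 0 ≤ (1 - ∑ j, w (ε j)) ^ 2 := sq_nonneg _
  refine lt_of_le_of_ne (by unfold cellDenom; positivity) fun h => ?_
  unfold cellDenom at h
  have e1 : minCoord ε w = 0 := pow_eq_zero_iff (two_ne_zero) |>.1 (by linarith)
  have e2 : ∑ j, (w (ε j) - w (ε 0)) ^ 2 = 0 := by linarith
  have e3 : 1 - ∑ j, w (ε j) = 0 := pow_eq_zero_iff (two_ne_zero) |>.1 (by linarith)
  rw [Finset.sum_eq_zero_iff_of_nonneg fun _ _ => sq_nonneg _] at e2
  have e4 : ∀ j, w (ε j) = w (ε 0) := fun j => by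
    have := pow_eq_zero_iff (two_ne_zero) |>.1 (e2 j (Finset.mem_univ j))
    linarith
  obtain ⟨j, hj⟩ := exists_minCoord_eq ε w
  have e5 : ∀ j, w (ε j) = 0 := fun i => by rw [e4 i, ← e4 j, ← hj, e1]
  simp [e5] at e3

/-- The map from a simplex to a sphere which collapses the boundary to the base point. -/
def cellMap (ε : Fin (d + 1) → V) (w : V → ℝ) : EuclideanSpace ℝ (Fin (d + 1)) :=
  WithLp.toLp 2 fun j => (if j.val = 0 then 1 - 2 * minCoord ε w ^ 2 / cellDenom ε w else 0) +
    2 * minCoord ε w * (w (ε j) - w (ε 0)) / cellDenom ε w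

theorem cellMap_zero (ε : Fin (d + 1) → V) (w : V → ℝ) :
    cellMap ε w 0 = 1 - 2 * minCoord ε w ^ 2 / cellDenom ε w := by
  simp [cellMap]

theorem cellMap_of_ne (ε : Fin (d + 1) → V) (w : V → ℝ) {j : Fin (d + 1)} (hj : j ≠ 0) :
    cellMap ε w j = 2 * minCoord ε w * (w (ε j) - w (ε 0)) / cellDenom ε w := by
  simp [cellMap, hj]

theorem continuous_cellMap (ε : Fin (d + 1) → V) : Continuous (cellMap ε) := by
  have hm := continuous_minCoord ε
  have hD : Continuous (cellDenom ε) := by unfold cellDenom; fun_prop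
  refine (PiLp.continuous_toLp 2 _).comp (continuous_pi fun j => ?_)
  have hne : ∀ w, cellDenom ε w ≠ 0 := fun w => (cellDenom_pos ε w).ne'
  refine Continuous.add ?_ ?_
  · split_ifs
    · exact continuous_const.sub (((hm.pow 2).const_mul 2).div hD hne)
    · exact continuous_const
  · exact ((hm.const_mul 2).mul ((continuous_apply _).sub (continuous_apply _))).div hD hne

/-- On the open simplex, with `m` the minimum coordinate, the formula is inverse stereographic
projection from the base point applied to the vector `(w (ε j) - w (ε 0)) / m`, `j ≠ 0`. Where `m =
0` the value is the base point, so total mass one is needed only for `m ≠ 0`. -/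
theorem norm_cellMap (ε : Fin (d + 1) → V) {w : V → ℝ}
    (h : minCoord ε w ≠ 0 → ∑ j, w (ε j) = 1) : ‖cellMap ε w‖ = 1 := by
  rw [EuclideanSpace.norm_eq, Real.sqrt_eq_one, Fin.sum_univ_succ, cellMap_zero]
  have hD := (cellDenom_pos ε w).ne'
  have h1 : ∀ j : Fin d, ‖cellMap ε w j.succ‖ ^ 2 =
      4 * minCoord ε w ^ 2 / cellDenom ε w ^ 2 * (w (ε j.succ) - w (ε 0)) ^ 2 := fun j => by
    rw [cellMap_of_ne ε w (Fin.succ_ne_zero j), Real.norm_eq_abs, sq_abs]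
    field_simp
    ring
  simp only [h1]
  rw [← Finset.mul_sum, Real.norm_eq_abs, sq_abs]
  have h2 : ∑ j : Fin d, (w (ε j.succ) - w (ε 0)) ^ 2 =
      cellDenom ε w - minCoord ε w ^ 2 - (1 - ∑ j, w (ε j)) ^ 2 := by
    rw [cellDenom, Fin.sum_univ_succ]
    ring
  rw [h2]
  by_cases hm : minCoord ε w = 0
  · simp [hm]
  · rw [h hm]
    field_simp
    ring

theorem cellMap_eq_base (ε : Fin (d + 1) → V) {w : V → ℝ} (h : minCoord ε w = 0) :
    cellMap ε w = sphereBase (d + 1) := by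
  simp [cellMap, sphereBase, h]

theorem minCoord_eq_zero_of_cellMap (ε : Fin (d + 1) → V) {w : V → ℝ} (h : cellMap ε w 0 = 1) :
    minCoord ε w = 0 := by
  rw [cellMap_zero] at h
  have hD := (cellDenom_pos ε w).ne'
  have h1 : 2 * minCoord ε w ^ 2 / cellDenom ε w = 0 := by linarith
  rw [div_eq_zero_iff, or_iff_left hD] at h1
  simpa using h1

/-- Interior points of a simplex are determined by their image on the sphere. -/
theorem eq_of_cellMap_eq (ε : Fin (d + 1) → V) {w w' : V → ℝ} (h : cellMap ε w = cellMap ε w')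
    (hm : 0 < minCoord ε w) (hm' : 0 < minCoord ε w') (h1 : ∑ j, w (ε j) = 1)
    (h1' : ∑ j, w' (ε j) = 1) (j : Fin (d + 1)) : w (ε j) = w' (ε j) := by
  set m := minCoord ε w
  set m' := minCoord ε w'
  have hD := (cellDenom_pos ε w).ne'
  have hD' := (cellDenom_pos ε w').ne'
  have e0 : 2 * m ^ 2 / cellDenom ε w = 2 * m' ^ 2 / cellDenom ε w' := by
    have := congrArg (fun x => x 0) h
    simp only [cellMap_zero] at this
    linarith
  have e1 : ∀ j, (w (ε j) - w (ε 0)) / m = (w' (ε j) - w' (ε 0)) / m' := by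
    intro j
    by_cases hj : j = 0
    · simp [hj]
    · have := congrArg (fun x => x j) h
      simp only [cellMap_of_ne _ _ hj] at this
      have h2 : 2 * m * (w (ε j) - w (ε 0)) / cellDenom ε w =
          2 * m ^ 2 / cellDenom ε w * ((w (ε j) - w (ε 0)) / m) := by field_simp
      have h2' : 2 * m' * (w' (ε j) - w' (ε 0)) / cellDenom ε w' =
          2 * m' ^ 2 / cellDenom ε w' * ((w' (ε j) - w' (ε 0)) / m') := by field_simp
      rw [h2, h2', e0] at this
      exact mul_left_cancel₀ (by positivity) this
  -- Equal stereographic coordinates mean that the rescaled points differ by a constant. Both have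
  -- minimum one, so the constant is zero, and total mass one then gives `m = m'`.
  have hδ : ∀ j, w (ε j) / m = w' (ε j) / m' + (w (ε 0) / m - w' (ε 0) / m') := fun j => by
    have := e1 j
    rw [sub_div, sub_div] at this
    linarith
  have hle : ∀ j, 1 ≤ w (ε j) / m := fun j => (one_le_div hm).2 (minCoord_le ε w j)
  have hle' : ∀ j, 1 ≤ w' (ε j) / m' := fun j => (one_le_div hm').2 (minCoord_le ε w' j)
  obtain ⟨j₀, hj₀⟩ : ∃ j, w (ε j) / m = 1 := by
    obtain ⟨j, hj⟩ := exists_minCoord_eq ε w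
    exact ⟨j, by rw [← hj]; exact div_self hm.ne'⟩
  obtain ⟨j₁, hj₁⟩ : ∃ j, w' (ε j) / m' = 1 := by
    obtain ⟨j, hj⟩ := exists_minCoord_eq ε w'
    exact ⟨j, by rw [← hj]; exact div_self hm'.ne'⟩
  have e2 : ∀ j, w (ε j) / m = w' (ε j) / m' := fun j => by
    have a1 := hδ j₀
    have a2 := hδ j₁
    have a3 := hδ j
    have a4 := hle' j₀
    have a5 := hle j₁
    linarith
  have e3 : m = m' := by
    have := Finset.sum_congr (rfl : (Finset.univ : Finset (Fin (d + 1))) = Finset.univ)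
      fun j _ => e2 j
    rw [← Finset.sum_div, ← Finset.sum_div, h1, h1'] at this
    field_simp at this
    exact this.symm
  have := e2 j
  rw [e3] at this
  exact (div_left_inj' hm'.ne').1 this

theorem exists_cellMap_eq {ε : Fin (d + 1) → V} (hε : Function.Injective ε)
    {x : EuclideanSpace ℝ (Fin (d + 1))} (hx : ‖x‖ = 1) (hx' : x ≠ sphereBase (d + 1)) :
    ∃ w : V → ℝ, (∀ v, 0 ≤ w v) ∧ ∑ j, w (ε j) = 1 ∧ (∀ v, (∀ j, ε j ≠ v) → w v = 0) ∧
      cellMap ε w = x := by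
  have hsq : x 0 ^ 2 + ∑ j : Fin d, x j.succ ^ 2 = 1 := by
    rw [EuclideanSpace.norm_eq, Real.sqrt_eq_one, Fin.sum_univ_succ] at hx
    simpa [Real.norm_eq_abs, sq_abs] using hx
  have hnn : 0 ≤ ∑ j : Fin d, x j.succ ^ 2 := Finset.sum_nonneg fun _ _ => sq_nonneg _
  have hx0 : x 0 < 1 := by
    have h1 : x 0 ≤ 1 := by nlinarith
    refine lt_of_le_of_ne h1 fun h => hx' ?_
    have h2 : ∑ j : Fin d, x j.succ ^ 2 = 0 := by rw [h] at hsq; linarith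
    rw [Finset.sum_eq_zero_iff_of_nonneg fun _ _ => sq_nonneg _] at h2
    ext j
    refine Fin.cases ?_ (fun i => ?_) j
    · simp [h, sphereBase]
    · have := pow_eq_zero_iff (two_ne_zero) |>.1 (h2 i (Finset.mem_univ i))
      simp [this, sphereBase]
  have hy : 0 < 1 - x 0 := by linarith
  -- The stereographic projection of `x`. The shift `μ` makes the minimum equal to one, and the
  -- factor `m` then normalizes the total mass.
  let z : Fin (d + 1) → ℝ := fun j => if j = 0 then 0 else x j / (1 - x 0)
  let μ : ℝ := 1 - Finset.univ.inf' Finset.univ_nonempty z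
  have hz : ∀ j, 1 ≤ μ + z j := fun j => by
    have := Finset.inf'_le z (Finset.mem_univ j)
    simp only [μ]
    linarith
  have hz' : ∃ j, μ + z j = 1 := by
    obtain ⟨j, -, hj⟩ := Finset.exists_mem_eq_inf' Finset.univ_nonempty z
    exact ⟨j, by simp only [μ, hj]; ring⟩
  have hT : 0 < ∑ j, (μ + z j) :=
    Finset.sum_pos (fun j _ => zero_lt_one.trans_le (hz j)) Finset.univ_nonempty
  let m : ℝ := (∑ j, (μ + z j))⁻¹
  have hm : 0 < m := inv_pos.2 hT
  let w : V → ℝ := Function.extend ε (fun j => m * (μ + z j)) 0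
  have hw : ∀ j, w (ε j) = m * (μ + z j) := fun j => hε.extend_apply _ _ j
  have hw' : ∀ v, (∀ j, ε j ≠ v) → w v = 0 := fun v hv => by
    simp only [w]
    rw [Function.extend_apply' _ _ _ fun ⟨j, hj⟩ => hv j hj]
    rfl
  have hsum : ∑ j, w (ε j) = 1 := by
    simp only [hw]
    rw [← Finset.mul_sum]
    exact inv_mul_cancel₀ hT.ne'
  have hmin : minCoord ε w = m := by
    refine le_antisymm ?_ ((Finset.le_inf'_iff _ _).2 fun j _ => ?_)
    · obtain ⟨j, hj⟩ := hz'
      have := minCoord_le ε w j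
      rwa [hw, hj, mul_one] at this
    · rw [hw]
      nlinarith [hz j]
  have hdiff : ∀ j, w (ε j) - w (ε 0) = m * z j := fun j => by
    rw [hw, hw, show z 0 = 0 from if_pos rfl]
    ring
  have hD : cellDenom ε w = 2 * m ^ 2 / (1 - x 0) := by
    rw [cellDenom, hsum, hmin]
    simp only [hdiff]
    rw [Fin.sum_univ_succ]
    have : ∀ j : Fin d, (m * z j.succ) ^ 2 = m ^ 2 / (1 - x 0) ^ 2 * x j.succ ^ 2 := fun j => by
      simp only [z, Fin.succ_ne_zero, if_false]
      field_simp
    simp only [this]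
    rw [← Finset.mul_sum, eq_sub_of_add_eq' hsq]
    simp only [z, if_true]
    field_simp
    ring
  refine ⟨w, fun v => ?_, hsum, hw', ?_⟩
  · by_cases h : ∃ j, ε j = v
    · obtain ⟨j, rfl⟩ := h
      rw [hw]
      exact mul_nonneg hm.le (zero_le_one.trans (hz j))
    · rw [hw' v fun j hj => h ⟨j, hj⟩]
  · ext j
    by_cases hj : j = 0
    · subst hj
      rw [cellMap_zero, hmin, hD]
      field_simp
      ring
    · rw [cellMap_of_ne ε w hj, hmin, hD, hdiff]
      simp only [z, hj, if_false]
      field_simp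

end Cell

/-! ### Attaching cells to a contractible complex -/

section Attach

variable {V : Type*} [DecidableEq V] {d r : ℕ}

/-- The simplices listed by `ε` are attached along their boundaries to the complex `A`. -/
structure IsCellAttachment (A : Finset (Finset V)) (ε : Fin r → Fin (d + 1) → V) : Prop where
  injective : ∀ i, Function.Injective (ε i)
  subset_mem : ∀ s ∈ A, ∀ s' ⊆ s, s' ∈ A
  notMem : ∀ i, Finset.univ.image (ε i) ∉ A
  boundary : ∀ i j, (Finset.univ.image (ε i)).erase (ε i j) ∈ A
  ne : ∀ i j, i ≠ j → Finset.univ.image (ε i) ≠ Finset.univ.image (ε j)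

/-- The faces of `A` together with the simplices listed by `ε`. -/
def attachedFaces (A : Finset (Finset V)) (ε : Fin r → Fin (d + 1) → V) : Finset (Finset V) :=
  A ∪ Finset.univ.image fun i => Finset.univ.image (ε i)

theorem card_image_cell {ε : Fin (d + 1) → V} (hε : Function.Injective ε) :
    (Finset.univ.image ε).card = d + 1 := by
  rw [Finset.card_image_of_injective _ hε, Finset.card_univ, Fintype.card_fin]

namespace IsCellAttachment

variable {A : Finset (Finset V)} {ε : Fin r → Fin (d + 1) → V}

theorem image_mem (i : Fin r) : Finset.univ.image (ε i) ∈ attachedFaces A ε :=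
  Finset.mem_union_right _ (Finset.mem_image_of_mem _ (Finset.mem_univ i))

/-! #### Stretching a collar -/

/-- The stretching factor, minus one, of a simplex whose smallest coordinate is `m`. -/
def stretchFactor (d : ℕ) (t m : ℝ) : ℝ := 1 / max (1 - (d + 1) * m) (1 / (1 + t)) - 1

/-- Stretch the attached simplices from their barycentres. -/
def stretch (ε : Fin r → Fin (d + 1) → V) (t : ℝ) (w : V → ℝ) : V → ℝ := fun v =>
  w v + ∑ i, stretchFactor d t (minCoord (ε i) w) *
    (w v - if v ∈ Finset.univ.image (ε i) then 1 / ((d : ℝ) + 1) else 0)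

/-- Here `1 - (d + 1) * m` measures the distance from the barycentre, with value one on the
boundary. The total scaling `1 / max (1 - (d + 1) * m) (1 / (1 + t))` is the factor `1 + t`, capped
so that a point stops on reaching the boundary. -/
theorem stretchFactor_zero_right {t : ℝ} (ht : 0 ≤ t) : stretchFactor d t 0 = 0 := by
  have : 1 / (1 + t) ≤ 1 := by rw [div_le_one (by linarith)]; linarith
  simp [stretchFactor, max_eq_left (one_div (1 + t) ▸ this)]

theorem stretchFactor_zero_left {m : ℝ} (hm : 0 ≤ m) : stretchFactor d 0 m = 0 := by
  have : 1 - ((d : ℝ) + 1) * m ≤ 1 := by nlinarith [mul_nonneg (by positivity : 0 ≤ (d : ℝ) + 1) hm]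
  simp [stretchFactor, max_eq_right this]

theorem stretch_of_forall (ε : Fin r → Fin (d + 1) → V) {t : ℝ} (ht : 0 ≤ t) {w : V → ℝ}
    (h : ∀ i, minCoord (ε i) w = 0) : stretch ε t w = w := by
  funext v
  simp [stretch, h, stretchFactor_zero_right ht]

theorem stretch_zero (ε : Fin r → Fin (d + 1) → V) {w : V → ℝ} (hw : ∀ v, 0 ≤ w v) :
    stretch ε 0 w = w := by
  funext v
  simp [stretch, stretchFactor_zero_left (minCoord_nonneg _ hw)]

theorem continuous_stretch (ε : Fin r → Fin (d + 1) → V) :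
    Continuous fun p : unitInterval × (V → ℝ) => stretch ε p.1 p.2 := by
  refine continuous_pi fun v => ?_
  have h1 : ∀ i, Continuous fun p : unitInterval × (V → ℝ) =>
      stretchFactor d p.1 (minCoord (ε i) p.2) := by
    intro i
    have hm : Continuous fun p : unitInterval × (V → ℝ) => minCoord (ε i) p.2 :=
      (continuous_minCoord (ε i)).comp continuous_snd
    have ht : Continuous fun p : unitInterval × (V → ℝ) => (p.1 : ℝ) :=
      continuous_subtype_val.comp continuous_fst
    have hpos : ∀ p : unitInterval × (V → ℝ), 0 < 1 + (p.1 : ℝ) := fun p => by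
      linarith [p.1.2.1]
    refine Continuous.sub (continuous_const.div (Continuous.max ?_ ?_) fun p => ?_)
      continuous_const
    · exact continuous_const.sub (hm.const_mul _)
    · exact continuous_const.div (continuous_const.add ht) fun p => (hpos p).ne'
    · exact (lt_max_of_lt_right (one_div_pos.2 (hpos p))).ne'
  have h2 : Continuous fun p : unitInterval × (V → ℝ) => p.2 v :=
    (continuous_apply v).comp continuous_snd
  exact h2.add (continuous_finsetSum _ fun i _ => (h1 i).mul (h2.sub continuous_const))

/-! #### The map to the wedge -/

variable [Fintype V]

theorem sum_cell {ε : Fin (d + 1) → V} (hε : Function.Injective ε) (w : V → ℝ)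
    (h : ∀ v ∉ Finset.univ.image ε, w v = 0) : ∑ j, w (ε j) = ∑ v, w v := by
  rw [← Finset.sum_image (f := w) (s := Finset.univ) (g := ε) fun a _ b _ hab => hε hab]
  exact Finset.sum_subset (Finset.subset_univ _) fun v _ hv => h v hv

/-- A face supporting such a point contains the whole cell. It cannot belong to `A`, and all cells
have the same size, so it is that cell. -/
theorem eq_zero_of_minCoord_ne_zero (hA : IsCellAttachment A ε) {w : V → ℝ}
    (hw : w ∈ faceRealization (attachedFaces A ε)) {i : Fin r} (hi : minCoord (ε i) w ≠ 0) :
    ∀ v ∉ Finset.univ.image (ε i), w v = 0 := by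
  obtain ⟨h0, -, s, hs, hsupp⟩ := hw
  have hsub : Finset.univ.image (ε i) ⊆ s := by
    intro v hv
    obtain ⟨j, -, rfl⟩ := Finset.mem_image.1 hv
    by_contra hn
    exact hi (minCoord_eq_zero _ h0 (hsupp _ hn))
  rcases Finset.mem_union.1 hs with hs | hs
  · exact absurd (hA.subset_mem s hs _ hsub) (hA.notMem i)
  · obtain ⟨j, -, rfl⟩ := Finset.mem_image.1 hs
    rwa [Finset.eq_of_subset_of_card_le hsub
      (by rw [card_image_cell (hA.injective i), card_image_cell (hA.injective j)])]

theorem sum_eq_one (hA : IsCellAttachment A ε) {w : V → ℝ}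
    (hw : w ∈ faceRealization (attachedFaces A ε)) {i : Fin r} (hi : minCoord (ε i) w ≠ 0) :
    ∑ j, w (ε i j) = 1 := by
  rw [sum_cell (hA.injective i) w (hA.eq_zero_of_minCoord_ne_zero hw hi), hw.2.1]

theorem minCoord_eq_zero_of_ne (hA : IsCellAttachment A ε) {w : V → ℝ}
    (hw : w ∈ faceRealization (attachedFaces A ε)) {i j : Fin r} (hi : minCoord (ε i) w ≠ 0)
    (hij : j ≠ i) : minCoord (ε j) w = 0 := by
  have hsub : ¬ Finset.univ.image (ε j) ⊆ Finset.univ.image (ε i) := fun hsub =>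
    hA.ne j i hij (Finset.eq_of_subset_of_card_le hsub
      (by rw [card_image_cell (hA.injective i), card_image_cell (hA.injective j)]))
  obtain ⟨v, hv, hvi⟩ := Finset.not_subset.1 hsub
  obtain ⟨k, -, rfl⟩ := Finset.mem_image.1 hv
  exact minCoord_eq_zero _ hw.1 (hA.eq_zero_of_minCoord_ne_zero hw hi _ hvi)

theorem minCoord_eq_zero_of_mem (hA : IsCellAttachment A ε) {w : V → ℝ}
    (hw : w ∈ faceRealization A) (i : Fin r) : minCoord (ε i) w = 0 := by
  obtain ⟨h0, -, s, hs, hsupp⟩ := hw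
  obtain ⟨v, hv, hvi⟩ := Finset.not_subset.1 fun h => hA.notMem i (hA.subset_mem s hs _ h)
  obtain ⟨k, -, rfl⟩ := Finset.mem_image.1 hv
  exact minCoord_eq_zero _ h0 (hsupp _ hvi)

theorem mem_of_eq_zero (hA : IsCellAttachment A ε) {w : V → ℝ} (h0 : ∀ v, 0 ≤ w v)
    (h1 : ∑ v, w v = 1) {i : Fin r} (hi : ∀ v ∉ Finset.univ.image (ε i), w v = 0)
    {j : Fin (d + 1)} (hj : w (ε i j) = 0) : w ∈ faceRealization A := by
  refine ⟨h0, h1, _, hA.boundary i j, fun v hv => ?_⟩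
  by_cases h : v = ε i j
  · rw [h, hj]
  · exact hi v fun hv' => hv (Finset.mem_erase.2 ⟨h, hv'⟩)

theorem mem_of_minCoord_eq_zero (hA : IsCellAttachment A ε) {w : V → ℝ}
    (hw : w ∈ faceRealization (attachedFaces A ε)) (h : ∀ i, minCoord (ε i) w = 0) :
    w ∈ faceRealization A := by
  obtain ⟨h0, h1, s, hs, hsupp⟩ := hw
  rcases Finset.mem_union.1 hs with hs | hs
  · exact ⟨h0, h1, s, hs, hsupp⟩
  · obtain ⟨i, -, rfl⟩ := Finset.mem_image.1 hs
    obtain ⟨j, hj⟩ := exists_minCoord_eq (ε i) w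
    exact hA.mem_of_eq_zero h0 h1 hsupp (hj ▸ h i)

/-! #### The collapse onto the wedge of spheres -/

theorem cellMap_mem (hA : IsCellAttachment A ε) {w : V → ℝ}
    (hw : w ∈ faceRealization (attachedFaces A ε)) (i : Fin r) :
    cellMap (ε i) w ∈ Metric.sphere (0 : EuclideanSpace ℝ (Fin (d + 1))) 1 := by
  rw [mem_sphere_zero_iff_norm]
  exact norm_cellMap _ fun hi => hA.sum_eq_one hw hi

/-- Collapse `A` to the base point of the wedge of the spheres obtained from the attached
simplices. -/
def toWedge (hA : IsCellAttachment A ε) (i₀ : Fin r) (w : faceRealization (attachedFaces A ε)) :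
    SphereWedge r (d + 1) :=
  open Classical in
  if h : ∃ i, minCoord (ε i) w.1 ≠ 0 then
    Quotient.mk _ (h.choose, ⟨_, hA.cellMap_mem w.2 h.choose⟩)
  else Quotient.mk _ (i₀, ⟨_, sphereBase_mem d⟩)

/-- This removes the choices from `toWedge`: at most one cell has a nonzero minimum, and all other
cells contribute the base point. -/
theorem wedgeCoord_toWedge (hA : IsCellAttachment A ε) (i₀ : Fin r)
    (w : faceRealization (attachedFaces A ε)) (i : Fin r) :
    wedgeCoord r d i (hA.toWedge i₀ w) = ⟨_, hA.cellMap_mem w.2 i⟩ := by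
  have hbase : ∀ j, minCoord (ε j) w.1 = 0 →
      (⟨_, sphereBase_mem d⟩ : Metric.sphere (0 : EuclideanSpace ℝ (Fin (d + 1))) 1) =
        ⟨_, hA.cellMap_mem w.2 j⟩ := fun j hj => Subtype.ext (cellMap_eq_base _ hj).symm
  by_cases h : ∃ i, minCoord (ε i) w.1 ≠ 0
  · rw [toWedge, dif_pos h, wedgeCoord_mk]
    split_ifs with he
    · simp only [he]
    · exact hbase i (hA.minCoord_eq_zero_of_ne w.2 h.choose_spec (Ne.symm he))
  · rw [toWedge, dif_neg h, wedgeCoord_mk]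
    push Not at h
    split_ifs with he
    · exact hbase i (h i)
    · exact hbase i (h i)

theorem continuous_toWedge (hA : IsCellAttachment A ε) (i₀ : Fin r) :
    Continuous (hA.toWedge i₀) := by
  refine continuous_of_wedgeCoord fun i => ?_
  simp only [wedgeCoord_toWedge]
  exact ((continuous_cellMap (ε i)).comp continuous_subtype_val).subtype_mk _

theorem toWedge_eq_of_mem (hA : IsCellAttachment A ε) (i₀ : Fin r)
    {w w' : faceRealization (attachedFaces A ε)} (hw : w.1 ∈ faceRealization A)
    (hw' : w'.1 ∈ faceRealization A) : hA.toWedge i₀ w = hA.toWedge i₀ w' := by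
  refine wedgeCoord_injective fun i => ?_
  rw [wedgeCoord_toWedge, wedgeCoord_toWedge]
  refine Subtype.ext ?_
  change cellMap _ _ = cellMap _ _
  rw [cellMap_eq_base _ (hA.minCoord_eq_zero_of_mem hw i),
    cellMap_eq_base _ (hA.minCoord_eq_zero_of_mem hw' i)]

theorem eq_or_mem_of_toWedge_eq (hA : IsCellAttachment A ε) (i₀ : Fin r)
    {w w' : faceRealization (attachedFaces A ε)} (h : hA.toWedge i₀ w = hA.toWedge i₀ w') :
    w = w' ∨ (w.1 ∈ faceRealization A ∧ w'.1 ∈ faceRealization A) := by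
  have hc : ∀ i, cellMap (ε i) w.1 = cellMap (ε i) w'.1 := fun i => by
    have := congrArg (wedgeCoord r d i) h
    rw [wedgeCoord_toWedge, wedgeCoord_toWedge] at this
    exact congrArg Subtype.val this
  have hbase : ∀ i, sphereBase (d + 1) i = if i.val = 0 then 1 else 0 := fun i => rfl
  have key : ∀ {w w' : V → ℝ} (i : Fin r), cellMap (ε i) w = cellMap (ε i) w' →
      minCoord (ε i) w = 0 → minCoord (ε i) w' = 0 := by
    intro w w' i hc h0
    apply minCoord_eq_zero_of_cellMap
    rw [← hc, cellMap_eq_base _ h0, hbase]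
    simp
  by_cases hall : ∀ i, minCoord (ε i) w.1 = 0
  · refine Or.inr ⟨hA.mem_of_minCoord_eq_zero w.2 hall, hA.mem_of_minCoord_eq_zero w'.2 ?_⟩
    exact fun i => key i (hc i) (hall i)
  · push Not at hall
    obtain ⟨i, hi⟩ := hall
    have hi' : minCoord (ε i) w'.1 ≠ 0 := fun h0 => hi (key i (hc i).symm h0)
    refine Or.inl (Subtype.ext (funext fun v => ?_))
    by_cases hv : v ∈ Finset.univ.image (ε i)
    · obtain ⟨j, -, rfl⟩ := Finset.mem_image.1 hv
      exact eq_of_cellMap_eq (ε i) (hc i) ((minCoord_nonneg _ w.2.1).lt_of_ne' hi)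
        ((minCoord_nonneg _ w'.2.1).lt_of_ne' hi') (hA.sum_eq_one w.2 hi)
        (hA.sum_eq_one w'.2 hi') j
    · rw [hA.eq_zero_of_minCoord_ne_zero w.2 hi v hv, hA.eq_zero_of_minCoord_ne_zero w'.2 hi' v hv]

theorem toWedge_surjective (hA : IsCellAttachment A ε) (i₀ : Fin r)
    (hne : (faceRealization A).Nonempty) : Function.Surjective (hA.toWedge i₀) := by
  intro x
  induction x using Quotient.inductionOn with
  | _ x =>
  obtain ⟨i, x, hx⟩ := x
  by_cases hxb : x = sphereBase (d + 1)
  · obtain ⟨w, hw⟩ := hne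
    refine ⟨⟨w, faceRealization_mono Finset.subset_union_left hw⟩, wedgeCoord_injective fun j => ?_⟩
    rw [wedgeCoord_toWedge, wedgeCoord_mk]
    refine Subtype.ext ?_
    change cellMap _ _ = _
    rw [cellMap_eq_base _ (hA.minCoord_eq_zero_of_mem hw j)]
    split_ifs
    · exact hxb.symm
    · rfl
  · obtain ⟨w, h0, h1, hsupp, rfl⟩ := exists_cellMap_eq (hA.injective i)
      (mem_sphere_zero_iff_norm.1 hx) hxb
    have hsupp' : ∀ v ∉ Finset.univ.image (ε i), w v = 0 := fun v hv =>
      hsupp v fun j hj => hv (Finset.mem_image.2 ⟨j, Finset.mem_univ j, hj⟩)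
    have hw : w ∈ faceRealization (attachedFaces A ε) :=
      ⟨h0, by rw [← sum_cell (hA.injective i) w hsupp', h1], _, image_mem i, hsupp'⟩
    have hi : minCoord (ε i) w ≠ 0 := fun h => hxb (cellMap_eq_base _ h)
    refine ⟨⟨w, hw⟩, wedgeCoord_injective fun j => ?_⟩
    rw [wedgeCoord_toWedge, wedgeCoord_mk]
    refine Subtype.ext ?_
    change cellMap _ _ = _
    split_ifs with hij
    · subst hij
      rfl
    · exact cellMap_eq_base _ (hA.minCoord_eq_zero_of_ne hw hi (Ne.symm hij))

theorem stretch_of_minCoord_ne_zero (hA : IsCellAttachment A ε) {w : V → ℝ}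
    (hw : w ∈ faceRealization (attachedFaces A ε)) {i : Fin r} (hi : minCoord (ε i) w ≠ 0)
    {t : ℝ} (ht : 0 ≤ t) (v : V) :
    stretch ε t w v = w v + stretchFactor d t (minCoord (ε i) w) *
      (w v - if v ∈ Finset.univ.image (ε i) then 1 / ((d : ℝ) + 1) else 0) := by
  rw [stretch, Finset.sum_eq_single i]
  · intro j _ hj
    rw [hA.minCoord_eq_zero_of_ne hw hi hj, stretchFactor_zero_right ht, zero_mul]
  · simp

/-- The stretch stays inside the closed cell thanks to the cap. The last clause describes the
collar: once the cap is attained, the minimal coordinate is sent to zero. -/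
theorem stretch_spec (hA : IsCellAttachment A ε) {w : V → ℝ}
    (hw : w ∈ faceRealization (attachedFaces A ε)) {i : Fin r} (hi : minCoord (ε i) w ≠ 0)
    {t : ℝ} (ht : 0 ≤ t) :
    (∀ v, 0 ≤ stretch ε t w v) ∧ ∑ v, stretch ε t w v = 1 ∧
      (∀ v ∉ Finset.univ.image (ε i), stretch ε t w v = 0) ∧
      (1 ≤ (1 + t) * (1 - (d + 1) * minCoord (ε i) w) → ∃ j, stretch ε t w (ε i j) = 0) := by
  have hs := hA.eq_zero_of_minCoord_ne_zero hw hi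
  have hst := fun v => hA.stretch_of_minCoord_ne_zero hw hi ht v
  set m := minCoord (ε i) w with hmdef
  have ht1 : 0 < 1 + t := by linarith
  have hm0 : 0 ≤ m := minCoord_nonneg _ hw.1
  have hd : 0 < (d : ℝ) + 1 := by positivity
  set X := max (1 - ((d : ℝ) + 1) * m) (1 / (1 + t)) with hX
  have hX0 : 0 < X := lt_max_of_lt_right (one_div_pos.2 ht1)
  have hg : stretchFactor d t m = 1 / X - 1 := rfl
  have hmX : 1 - X ≤ (d + 1) * m := by
    have := le_max_left (1 - ((d : ℝ) + 1) * m) (1 / (1 + t))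
    linarith
  refine ⟨fun v => ?_, ?_, fun v hv => ?_, fun hρ => ?_⟩
  · by_cases hv : v ∈ Finset.univ.image (ε i)
    · rw [hst, if_pos hv, hg]
      obtain ⟨j, -, rfl⟩ := Finset.mem_image.1 hv
      have h1 : m ≤ w (ε i j) := minCoord_le _ _ j
      have h2 : w (ε i j) + (1 / X - 1) * (w (ε i j) - 1 / ((d : ℝ) + 1)) =
          ((d + 1) * w (ε i j) - (1 - X)) / (X * (d + 1)) := by
        field_simp
        ring
      rw [h2]
      refine div_nonneg ?_ (by positivity)
      have := mul_le_mul_of_nonneg_left h1 hd.le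
      linarith
    · rw [hst, if_neg hv, hs v hv]
      simp
  · simp only [hst]
    rw [Finset.sum_add_distrib, ← Finset.mul_sum, Finset.sum_sub_distrib, hw.2.1,
      Finset.sum_ite_mem, Finset.univ_inter, Finset.sum_const, card_image_cell (hA.injective i)]
    simp only [nsmul_eq_mul, Nat.cast_add, Nat.cast_one]
    rw [mul_one_div_cancel hd.ne']
    ring
  · rw [hst, if_neg hv, hs v hv]
    simp
  · obtain ⟨j, hj⟩ := exists_minCoord_eq (ε i) w
    refine ⟨j, ?_⟩
    have hX' : X = 1 - (d + 1) * m := max_eq_left ((div_le_iff₀' ht1).2 hρ)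
    rw [hst, if_pos (Finset.mem_image_of_mem _ (Finset.mem_univ j)), hg, ← hj, ← hmdef]
    have h3 : ((d : ℝ) + 1) * m = 1 - X := by rw [hX']; ring
    have h4 : m = (1 - X) / (d + 1) := by rw [← h3]; field_simp
    rw [h4]
    field_simp
    ring

/-- Attaching simplices along their boundaries to a contractible complex gives a wedge of
spheres. -/
theorem nonempty_homotopyEquiv (hA : IsCellAttachment A ε) (hr : 0 < r)
    [ContractibleSpace (faceRealization A)] :
    Nonempty (faceRealization (attachedFaces A ε) ≃ₕ SphereWedge r (d + 1)) := by
  let K := faceRealization (attachedFaces A ε)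
  let S : Set K := {w | w.1 ∈ faceRealization A}
  have hAK : faceRealization A ⊆ K := faceRealization_mono Finset.subset_union_left
  have : CompactSpace K := isCompact_iff_compactSpace.1 (isCompact_faceRealization _)
  let eS : S ≃ₜ faceRealization A :=
    { toFun := fun w => ⟨w.1.1, w.2⟩
      invFun := fun w => ⟨⟨w.1, hAK w.2⟩, w.2⟩
      left_inv := fun _ => rfl
      right_inv := fun _ => rfl
      continuous_toFun := (continuous_subtype_val.comp continuous_subtype_val).subtype_mk _
      continuous_invFun := (continuous_subtype_val.subtype_mk _).subtype_mk _ }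
  have : ContractibleSpace S := eS.contractibleSpace
  have hcases : ∀ w : K, w.1 ∈ faceRealization A ∨ ∃ i, minCoord (ε i) w.1 ≠ 0 := by
    intro w
    by_cases h : ∃ i, minCoord (ε i) w.1 ≠ 0
    · exact Or.inr h
    · push Not at h
      exact Or.inl (hA.mem_of_minCoord_eq_zero w.2 h)
  have hfix : ∀ (t : unitInterval) (w : K), w.1 ∈ faceRealization A → stretch ε t w.1 = w.1 :=
    fun t w hw => stretch_of_forall ε t.2.1 fun i => hA.minCoord_eq_zero_of_mem hw i
  have hmem : ∀ p : unitInterval × K, stretch ε p.1 p.2.1 ∈ K := by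
    rintro ⟨t, w⟩
    rcases hcases w with hw | ⟨i, hi⟩
    · rw [hfix t w hw]
      exact w.2
    · obtain ⟨h1, h2, h3, -⟩ := hA.stretch_spec w.2 hi t.2.1
      exact ⟨h1, h2, _, image_mem i, h3⟩
  let e : C(unitInterval × K, K) := ⟨fun p => ⟨stretch ε p.1 p.2.1, hmem p⟩,
    ((continuous_stretch ε).comp (continuous_fst.prodMk
      (continuous_subtype_val.comp continuous_snd))).subtype_mk _⟩
  -- At most one term of the sum is nonzero. The value is nonnegative once the stretch has reached
  -- the boundary, and it equals `t` on `A`.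
  let s : C(unitInterval × K, ℝ) :=
    ⟨fun p => (1 + p.1.1) * (1 - (d + 1) * ∑ i, minCoord (ε i) p.2.1) - 1, by
      have : ∀ i, Continuous fun p : unitInterval × K => minCoord (ε i) p.2.1 := fun i =>
        (continuous_minCoord (ε i)).comp (continuous_subtype_val.comp continuous_snd)
      fun_prop⟩
  obtain ⟨H, H0, HS, H1⟩ := exists_homotopy_of_expansion S e s (by
      rintro ⟨t, w⟩ hp
      rcases hcases w with hw | ⟨i, hi⟩
      · change stretch ε t w.1 ∈ faceRealization A
        rwa [hfix t w hw]
      · obtain ⟨h1, h2, h3, h4⟩ := hA.stretch_spec w.2 hi t.2.1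
        have hsum : ∑ j, minCoord (ε j) w.1 = minCoord (ε i) w.1 := by
          rw [Finset.sum_eq_single i]
          · exact fun j _ hj => hA.minCoord_eq_zero_of_ne w.2 hi hj
          · simp
        have hp : 0 ≤ (1 + t.1) * (1 - (d + 1) * ∑ i, minCoord (ε i) w.1) - 1 := hp
        rw [hsum] at hp
        obtain ⟨j, hj⟩ := h4 (by linarith)
        exact hA.mem_of_eq_zero h1 h2 h3 hj)
    (fun w => Subtype.ext (stretch_zero ε w.2.1))
    (fun w => by
      have : 0 ≤ ((d : ℝ) + 1) * ∑ i, minCoord (ε i) w.1 :=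
        mul_nonneg (by positivity) (Finset.sum_nonneg fun i _ => minCoord_nonneg _ w.2.1)
      simp [s, this])
    (fun t w hw => Subtype.ext (hfix t w hw))
    (fun t w hw => by
      simp [s, hA.minCoord_eq_zero_of_mem hw])
  obtain ⟨w₀⟩ : Nonempty (faceRealization A) := inferInstance
  exact nonempty_homotopyEquiv_of_collapse ⟨hA.toWedge ⟨0, hr⟩, hA.continuous_toWedge ⟨0, hr⟩⟩
    (hA.toWedge_surjective ⟨0, hr⟩ ⟨w₀.1, w₀.2⟩) S
    (fun w w' h => hA.eq_or_mem_of_toWedge_eq ⟨0, hr⟩ h)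
    (fun w hw w' hw' => hA.toWedge_eq_of_mem ⟨0, hr⟩ hw hw') H H0 HS H1

end IsCellAttachment

/-- A pure shellable complex is a wedge of spheres; their number is the reduced Euler
characteristic up to sign. -/
theorem IsReverseShelling.nonempty_homotopyEquiv [Fintype V] {S : List (Finset V)} (hS : IsReverseShelling S)
    (hne : S ≠ []) (hcard : ∀ F ∈ S, F.card = d + 1) {K : Finset (Finset V)}
    (hK : ∀ G, G ∈ K ↔ ∃ F ∈ S, G ⊆ F) {b : ℕ} (hb : 0 < b)
    (hχ : ∑ G ∈ K, (-1 : ℤ) ^ G.card = (-1) ^ (d + 1) * b) :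
    Nonempty (faceRealization K ≃ₕ SphereWedge b (d + 1)) := by
  obtain ⟨A, B, hAB, hmem, hsub, hB, hcontr, hsum⟩ :=
    hS.exists_contractible (Nat.succ_pos d) hne hcard
  have hKAB : K = A ∪ B := by
    ext G
    rw [hK, hmem]
  -- The family `A` contributes zero to the alternating sum and each member of `B` contributes `(-1)
  -- ^ (d + 1)`.
  have hBb : B.card = b := by
    rw [hKAB, Finset.sum_union hAB, hsum, zero_add,
      Finset.sum_congr rfl fun F hF => by rw [(hB F hF).1], Finset.sum_const, nsmul_eq_mul,
      mul_comm] at hχ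
    exact_mod_cast mul_left_cancel₀ (pow_ne_zero _ (by norm_num)) hχ
  let eB : Fin b ≃ B := (B.equivFinOfCardEq hBb).symm
  let ε : Fin b → Fin (d + 1) → V := fun i j =>
    (((eB i).1.equivFinOfCardEq (hB _ (eB i).2).1).symm j).1
  have himg : ∀ i, Finset.univ.image (ε i) = (eB i).1 := by
    intro i
    ext v
    simp only [Finset.mem_image, Finset.mem_univ, true_and, ε]
    constructor
    · rintro ⟨j, rfl⟩
      exact Subtype.prop _
    · intro hv
      exact ⟨(eB i).1.equivFinOfCardEq (hB _ (eB i).2).1 ⟨v, hv⟩, by simp⟩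
  have hA : IsCellAttachment A ε :=
    { injective := fun i j j' h => by
        simpa [ε] using h
      subset_mem := hsub
      notMem := fun i => by
        rw [himg]
        exact Finset.disjoint_right.1 hAB (eB i).2
      boundary := fun i j => by
        have hv : ε i j ∈ (eB i).1 := Subtype.prop _
        rw [himg]
        exact (hB _ (eB i).2).2 _ hv
      ne := fun i j hij h => hij (by
        rw [himg, himg] at h
        exact eB.injective (Subtype.ext h)) }
  have hatt : attachedFaces A ε = K := by
    rw [attachedFaces, hKAB]
    congr 1
    ext F
    simp only [Finset.mem_image, Finset.mem_univ, true_and, himg]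
    constructor
    · rintro ⟨i, rfl⟩
      exact (eB i).2
    · intro hF
      exact ⟨eB.symm ⟨F, hF⟩, by simp⟩
  rw [← hatt]
  exact hA.nonempty_homotopyEquiv hb

end Attach

/-! ### Homology of a shellable order complex -/

section Homology

variable {P : Type*} [PartialOrder P] {k : Type*} [CommRing k] {m : ℕ}

/-- The set of elements of a chain. -/
def chainSupport (c : Fin m ↪o P) : Finset P := Finset.univ.map c.toEmbedding

theorem mem_chainSupport {c : Fin m ↪o P} {x : P} : x ∈ chainSupport c ↔ ∃ i, c i = x := by
  simp [chainSupport]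

theorem card_chainSupport (c : Fin m ↪o P) : (chainSupport c).card = m := by
  simp [chainSupport]

theorem isChain_chainSupport (c : Fin m ↪o P) :
    IsChain (· ≤ ·) (chainSupport c : Set P) := by
  intro x hx y hy _
  obtain ⟨i, rfl⟩ := mem_chainSupport.1 hx
  obtain ⟨j, rfl⟩ := mem_chainSupport.1 hy
  simpa using le_total i j

theorem chainSupport_injective :
    Function.Injective (chainSupport : (Fin m ↪o P) → Finset P) := by
  intro c c' h
  refine DFunLike.coe_injective ((StrictMono.range_inj c.strictMono c'.strictMono).1 ?_)
  ext x
  simp only [Set.mem_range]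
  rw [← mem_chainSupport, h, mem_chainSupport]

theorem exists_chainSupport_eq {G : Finset P} (hG : IsChain (· ≤ ·) (G : Set P))
    (hm : G.card = m) : ∃ c : Fin m ↪o P, chainSupport c = G := by
  classical
  let _ : LinearOrder (G : Set P) := hG.linearOrder
  have hc : Fintype.card (G : Set P) = m := by simpa using hm
  let e := monoEquivOfFin (G : Set P) hc
  refine ⟨e.toOrderEmbedding.trans (OrderEmbedding.subtype _), ?_⟩
  ext x
  rw [mem_chainSupport]
  constructor
  · rintro ⟨i, rfl⟩
    exact (e i).2
  · intro hx
    exact ⟨e.symm ⟨x, hx⟩, by simp⟩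

variable (k) in
/-- The coefficient of the chain `g` in the boundary of the chain `c`. -/
def incidence (c : Fin (m + 1) ↪o P) (g : Fin m ↪o P) : k :=
  orderBoundary k P m (Finsupp.single c 1) g

theorem orderBoundary_single (c : Fin (m + 1) ↪o P) :
    orderBoundary k P m (Finsupp.single c 1) =
      ∑ i : Fin (m + 1), Finsupp.single ((Fin.succAboveOrderEmb i).trans c) ((-1 : k) ^ i.val) := by
  simp [orderBoundary]

theorem orderBoundary_apply [Fintype P] (z : OrderChain k P (m + 1)) (g : Fin m ↪o P) :
    orderBoundary k P m z g = ∑ c, z c * incidence k c g := by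
  classical
  conv_lhs => rw [← Finsupp.univ_sum_single z]
  rw [map_sum, Finsupp.finsetSum_apply]
  refine Finset.sum_congr rfl fun c _ => ?_
  rw [incidence, ← smul_eq_mul, ← Finsupp.smul_apply, ← map_smul, Finsupp.smul_single,
    smul_eq_mul, mul_one]

theorem chainSupport_face [DecidableEq P] (c : Fin (m + 1) ↪o P) (i : Fin (m + 1)) :
    chainSupport ((Fin.succAboveOrderEmb i).trans c) = (chainSupport c).erase (c i) := by
  ext x
  rw [Finset.mem_erase, mem_chainSupport, mem_chainSupport]
  constructor
  · rintro ⟨j, rfl⟩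
    exact ⟨fun h => Fin.succAbove_ne i j (c.injective h), _, rfl⟩
  · rintro ⟨h, j, rfl⟩
    obtain ⟨j', rfl⟩ := Fin.exists_succAbove_eq (x := j) (y := i) fun e => h (by rw [e])
    exact ⟨j', rfl⟩

theorem incidence_eq_zero {c : Fin (m + 1) ↪o P} {g : Fin m ↪o P}
    (h : ¬ chainSupport g ⊆ chainSupport c) : incidence k c g = 0 := by
  classical
  rw [incidence, orderBoundary_single, Finsupp.finsetSum_apply]
  refine Finset.sum_eq_zero fun i _ => Finsupp.single_eq_of_ne fun e => h ?_
  rw [e, chainSupport_face]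
  exact Finset.erase_subset _ _

/-- Exactly one deletion turns `c` into `g`, with sign `±1`. Incidences can therefore be cancelled
over any commutative ring. -/
theorem incidence_mul_self {c : Fin (m + 1) ↪o P} {g : Fin m ↪o P}
    (h : chainSupport g ⊆ chainSupport c) : incidence k c g * incidence k c g = 1 := by
  classical
  obtain ⟨x, hx⟩ : ∃ x ∈ chainSupport c, x ∉ chainSupport g := by
    refine Finset.exists_mem_notMem_of_card_lt_card ?_
    rw [card_chainSupport, card_chainSupport]
    exact Nat.lt_succ_self m
  obtain ⟨i, rfl⟩ := mem_chainSupport.1 hx.1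
  have key : ∀ j, (Fin.succAboveOrderEmb j).trans c = g ↔ j = i := by
    intro j
    rw [← chainSupport_injective.eq_iff, chainSupport_face]
    constructor
    · intro e
      by_contra hj
      refine hx.2 (e ▸ Finset.mem_erase.2 ⟨fun e' => hj (c.injective e').symm, hx.1⟩)
    · rintro rfl
      symm
      refine Finset.eq_of_subset_of_card_le (fun y hy => Finset.mem_erase.2
        ⟨fun e => hx.2 (e ▸ hy), h hy⟩) ?_
      rw [Finset.card_erase_of_mem hx.1, card_chainSupport, card_chainSupport]
      simp
  rw [incidence, orderBoundary_single, Finsupp.finsetSum_apply, Finset.sum_eq_single i]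
  · rw [(key i).2 rfl, Finsupp.single_eq_same, ← pow_add]
    exact Even.neg_one_pow ⟨_, rfl⟩
  · intro j _ hj
    exact Finsupp.single_eq_of_ne fun e => hj ((key j).1 e.symm)
  · simp

/-- Deleting the same two elements in the opposite order gives the same chain with the opposite
sign. -/
theorem orderBoundary_orderBoundary (z : OrderChain k P (m + 2)) :
    orderBoundary k P m (orderBoundary k P (m + 1) z) = 0 := by
  suffices h : orderBoundary k P m ∘ₗ orderBoundary k P (m + 1) = 0 from
    LinearMap.congr_fun h z
  ext1 c
  refine LinearMap.ext_ring ?_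
  simp only [LinearMap.comp_apply, Finsupp.lsingle_apply, LinearMap.zero_apply]
  rw [orderBoundary_single, map_sum]
  have h : ∀ i : Fin (m + 2), orderBoundary k P m
      (Finsupp.single ((Fin.succAboveOrderEmb i).trans c) ((-1 : k) ^ i.val)) =
      ∑ j : Fin (m + 1), Finsupp.single
        ((Fin.succAboveOrderEmb j).trans ((Fin.succAboveOrderEmb i).trans c))
          ((-1 : k) ^ (i.val + j.val)) := by
    intro i
    rw [← mul_one ((-1 : k) ^ i.val), ← smul_eq_mul, ← Finsupp.smul_single, map_smul,
      orderBoundary_single, Finset.smul_sum]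
    refine Finset.sum_congr rfl fun j _ => ?_
    rw [Finsupp.smul_single, smul_eq_mul, pow_add]
  rw [Finset.sum_congr rfl fun i _ => h i, ← Fintype.sum_prod_type' (f := fun i j =>
      Finsupp.single ((Fin.succAboveOrderEmb j).trans ((Fin.succAboveOrderEmb i).trans c))
        ((-1 : k) ^ (i.val + j.val)))]
  refine Finset.sum_involution (fun x _ => (x.1.succAbove x.2, x.2.predAbove x.1)) ?_ ?_ ?_ ?_
  · rintro ⟨i, j⟩ -
    have : (Fin.succAboveOrderEmb (j.predAbove i)).trans
        ((Fin.succAboveOrderEmb (i.succAbove j)).trans c) =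
        (Fin.succAboveOrderEmb j).trans ((Fin.succAboveOrderEmb i).trans c) := by
      ext1 l
      simp [Fin.succAbove_succAbove_succAbove_predAbove]
    dsimp only
    rw [this, ← Finsupp.single_add, Fin.neg_one_pow_succAbove_add_predAbove, add_neg_cancel,
      Finsupp.single_zero]
  · rintro ⟨i, j⟩ - - h
    exact Fin.succAbove_ne i j (congrArg Prod.fst h)
  · simp
  · rintro ⟨i, j⟩ -
    simp [Fin.succAbove_succAbove_predAbove, Fin.predAbove_predAbove_succAbove]

theorem orderBoundary_mem_orderCycles (z : OrderChain k P (m + 1)) :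
    orderBoundary k P m z ∈ orderCycles k P m := by
  cases m with
  | zero => trivial
  | succ m => exact orderBoundary_orderBoundary z

end Homology

/-! ### Vanishing of homology below the top degree, and Betti numbers. -/

section Homology

variable {P : Type*} [PartialOrder P] [Finite P] {k : Type*} [CommRing k] {m : ℕ}

/-- Modulo boundaries, a cycle can be pushed off the last facet of a shelling, except for its top
dimensional part. -/
theorem exists_sub_orderBoundary {F : Finset P} {S : List (Finset P)}
    (hF : IsChain (· ≤ ·) (F : Set P)) {R : Finset P}
    (hR : ∀ G ⊆ F, (∃ E ∈ S, G ⊆ E) ↔ ¬ R ⊆ G) {u : P} (huF : u ∈ F) (huR : u ∉ R)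
    {z : OrderChain k P m} (hz : z ∈ orderCycles k P m)
    (hsupp : ∀ g, z g ≠ 0 → ∃ E ∈ F :: S, chainSupport g ⊆ E) :
    ∃ y, ∀ g, (z - orderBoundary k P m y) g ≠ 0 → ∃ E ∈ S, chainSupport g ⊆ E := by
  classical
  have := Fintype.ofFinite P
  let new : (Fin m ↪o P) → Prop := fun g => R ⊆ chainSupport g ∧ chainSupport g ⊆ F
  have hdel : ∀ c : Fin (m + 1) ↪o P, ∃ g : Fin m ↪o P,
      u ∈ chainSupport c → chainSupport g = (chainSupport c).erase u := by
    intro c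
    by_cases hu : u ∈ chainSupport c
    · obtain ⟨i, rfl⟩ := mem_chainSupport.1 hu
      exact ⟨_, fun _ => chainSupport_face c i⟩
    · exact ⟨(Fin.succAboveOrderEmb 0).trans c, fun h => absurd h hu⟩
  choose del hdel using hdel
  let T : Finset (Fin (m + 1) ↪o P) :=
    Finset.univ.filter fun c => u ∈ chainSupport c ∧ chainSupport c ⊆ F
  have hT : ∀ c, c ∈ T ↔ u ∈ chainSupport c ∧ chainSupport c ⊆ F := fun c => by simp [T]
  -- Cone from `u`: the coefficient of each chain through `u` is chosen so that its boundary cancels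
  -- `z` on the chain with `u` deleted.
  let y : OrderChain k P (m + 1) :=
    ∑ c ∈ T, Finsupp.single c (incidence k c (del c) * z (del c))
  have hy : ∀ g, orderBoundary k P m y g =
      ∑ c ∈ T, incidence k c (del c) * z (del c) * incidence k c g := by
    intro g
    rw [map_sum, Finsupp.finsetSum_apply]
    refine Finset.sum_congr rfl fun c _ => ?_
    rw [← mul_one (incidence k c (del c) * z (del c)), ← smul_eq_mul, ← Finsupp.smul_single,
      map_smul, Finsupp.smul_apply, smul_eq_mul, smul_eq_mul, mul_one]
    rfl
  have hnew : ∀ g, chainSupport g ⊆ F → ¬ (∃ E ∈ S, chainSupport g ⊆ E) → new g :=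
    fun g hg h => ⟨not_not.1 fun h' => h ((hR _ hg).2 h'), hg⟩
  let z' := z - orderBoundary k P m y
  have hz' : z' ∈ orderCycles k P m := Submodule.sub_mem _ hz (orderBoundary_mem_orderCycles y)
  have hsupp' : ∀ g, z' g ≠ 0 → (∃ E ∈ S, chainSupport g ⊆ E) ∨ new g := by
    intro g hg
    by_cases hgF : chainSupport g ⊆ F
    · exact or_iff_not_imp_left.2 (hnew g hgF)
    · left
      have h0 : orderBoundary k P m y g = 0 := by
        rw [hy]
        refine Finset.sum_eq_zero fun c hc => ?_
        rw [incidence_eq_zero (g := g), mul_zero]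
        exact fun h => hgF (h.trans ((hT c).1 hc).2)
      obtain ⟨E, hE, hgE⟩ := hsupp g (by simpa [z', h0] using hg)
      rcases List.mem_cons.1 hE with rfl | hE
      · exact absurd hgE hgF
      · exact ⟨E, hE, hgE⟩
  have hzero : ∀ g, new g → u ∉ chainSupport g → z' g = 0 := by
    intro g hg hu
    obtain ⟨c, hc⟩ : ∃ c : Fin (m + 1) ↪o P, chainSupport c = insert u (chainSupport g) :=
      exists_chainSupport_eq (hF.mono (by
        rw [Finset.coe_subset]
        exact Finset.insert_subset huF hg.2)) (by
        rw [Finset.card_insert_of_notMem hu, card_chainSupport])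
    have hcT : c ∈ T := by
      rw [hT, hc]
      exact ⟨Finset.mem_insert_self _ _, Finset.insert_subset huF hg.2⟩
    have hcg : del c = g := by
      refine chainSupport_injective ?_
      rw [hdel c ((hT c).1 hcT).1, hc, Finset.erase_insert hu]
    have : orderBoundary k P m y g = z g := by
      rw [hy, Finset.sum_eq_single_of_mem c hcT]
      · rw [hcg, mul_right_comm, incidence_mul_self, one_mul]
        rw [hc]
        exact Finset.subset_insert _ _
      · intro c' hc' hne
        rw [incidence_eq_zero (g := g), mul_zero]
        intro h
        refine hne (chainSupport_injective (Finset.eq_of_subset_of_card_le ?_ ?_)).symm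
        · rw [hc]
          exact Finset.insert_subset ((hT c').1 hc').1 h
        · rw [card_chainSupport, card_chainSupport]
    simp [z', this]
  refine ⟨y, fun g hg => (hsupp' g hg).resolve_right fun hgn => hg ?_⟩
  by_cases hu : u ∉ chainSupport g
  · exact hzero g hgn hu
  rw [not_not] at hu
  cases m with
  | zero => simp [chainSupport] at hu
  | succ m =>
    obtain ⟨g', hg'⟩ : ∃ g' : Fin m ↪o P, chainSupport g' = (chainSupport g).erase u :=
      exists_chainSupport_eq ((isChain_chainSupport g).mono (by
        rw [Finset.coe_subset]
        exact Finset.erase_subset _ _)) (by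
        rw [Finset.card_erase_of_mem hu, card_chainSupport, Nat.add_sub_cancel])
    -- For a new chain `g` through `u`, evaluate the cycle condition at `g` without `u`. A chain
    -- with nonzero coefficient containing that face must be new and pass through `u`, hence is `g`,
    -- so its coefficient vanishes.
    have hcyc : orderBoundary k P m z' g' = 0 := by
      rw [show orderBoundary k P m z' = 0 from hz', Finsupp.zero_apply]
    have hsub : chainSupport g' ⊆ chainSupport g := hg' ▸ Finset.erase_subset _ _
    have hRg' : R ⊆ chainSupport g' := by
      rw [hg']
      exact Finset.subset_erase.2 ⟨hgn.1, huR⟩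
    rw [orderBoundary_apply, Finset.sum_eq_single g] at hcyc
    · show z' g = 0
      rw [← mul_one (z' g), ← incidence_mul_self hsub, ← mul_assoc, hcyc, zero_mul]
    · intro c _ hc
      by_cases hcg : chainSupport g' ⊆ chainSupport c
      · by_contra hne
        have hzc : z' c ≠ 0 := left_ne_zero_of_mul hne
        have hcn : new c := by
          refine (hsupp' c hzc).resolve_left ?_
          rintro ⟨E, hE, hcE⟩
          exact (hR _ (hsub.trans hgn.2)).1 ⟨E, hE, hcg.trans hcE⟩ hRg'
        have huc : u ∈ chainSupport c := by
          by_contra huc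
          exact hzc (hzero c hcn huc)
        refine hc (chainSupport_injective (Finset.eq_of_subset_of_card_le ?_ ?_)).symm
        · intro x hx
          by_cases hxu : x = u
          · exact hxu ▸ huc
          · exact hcg (hg' ▸ Finset.mem_erase.2 ⟨hxu, hx⟩)
        · rw [card_chainSupport, card_chainSupport]
      · rw [incidence_eq_zero hcg, mul_zero]
    · simp

/-- The reduced homology of a shellable order complex vanishes below the top dimension. -/
theorem IsReverseShelling.mem_range_orderBoundary {S : List (Finset P)} (hS : IsReverseShelling S)
    {d : ℕ} (hcard : ∀ F ∈ S, F.card = d) (hchain : ∀ F ∈ S, IsChain (· ≤ ·) (F : Set P))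
    (hm : m < d) (z : OrderChain k P m) (hz : z ∈ orderCycles k P m)
    (hsupp : ∀ g, z g ≠ 0 → ∃ E ∈ S, chainSupport g ⊆ E) :
    z ∈ LinearMap.range (orderBoundary k P m) := by
  induction hS generalizing z with
  | nil =>
    have : z = 0 := by
      ext g
      by_contra hg
      simpa using hsupp g hg
    rw [this]
    exact Submodule.zero_mem _
  | cons F S hS h ih =>
    specialize ih (fun E hE => hcard E (List.mem_cons_of_mem _ hE))
      fun E hE => hchain E (List.mem_cons_of_mem _ hE)
    classical
    obtain ⟨R, hRF, hR⟩ := exists_restriction h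
    -- Here the only new face is `F`, which has more than `m` elements, so the cycle is already
    -- supported on `S`.
    by_cases hFR : F ⊆ R
    · refine ih z hz fun g hg => ?_
      obtain ⟨E, hE, hgE⟩ := hsupp g hg
      rcases List.mem_cons.1 hE with rfl | hE
      · refine (hR _ hgE).2 fun hRg => hm.ne ?_
        rw [← card_chainSupport g, ← hcard E (by simp)]
        exact le_antisymm (Finset.card_le_card hgE) (Finset.card_le_card (hFR.trans hRg))
      · exact ⟨E, hE, hgE⟩
    · obtain ⟨u, huF, huR⟩ := Finset.not_subset.1 hFR
      obtain ⟨y, hy⟩ := exists_sub_orderBoundary (hchain F (by simp)) hR huF huR hz hsupp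
      have := ih _ (Submodule.sub_mem _ hz (orderBoundary_mem_orderCycles y)) hy
      simpa using Submodule.add_mem _ this (LinearMap.mem_range_self _ y)

theorem finite_orderEmbedding (m : ℕ) : Finite (Fin m ↪o P) := DFunLike.finite _

theorem finrank_orderChain [Nontrivial k] :
    Module.finrank k (OrderChain k P m) = Nat.card (Fin m ↪o P) := by
  have := finite_orderEmbedding (P := P) m
  have := Fintype.ofFinite (Fin m ↪o P)
  rw [Module.finrank_finsupp_self, Nat.card_eq_fintype_card]

theorem finrank_orderCycles_succ [IsDomain k] (m : ℕ) :
    Module.finrank k (LinearMap.range (orderBoundary k P m)) +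
      Module.finrank k (orderCycles k P (m + 1)) = Nat.card (Fin (m + 1) ↪o P) := by
  have := finite_orderEmbedding (P := P) (m + 1)
  rw [← finrank_orderChain (k := k), ← (orderBoundary k P m).quotKerEquivRange.finrank_eq]
  exact Submodule.finrank_quotient_add_finrank _

theorem card_orderEmbedding {K : Finset (Finset P)}
    (hK : ∀ G : Finset P, G ∈ K ↔ IsChain (· ≤ ·) (G : Set P)) :
    Nat.card (Fin m ↪o P) = (K.filter fun G => G.card = m).card := by
  have := finite_orderEmbedding (P := P) m
  have := Fintype.ofFinite (Fin m ↪o P)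
  rw [Nat.card_eq_fintype_card, ← Finset.card_univ]
  refine Finset.card_bij (fun c _ => chainSupport c) ?_ (fun c _ c' _ h =>
    chainSupport_injective h) ?_
  · intro c _
    rw [Finset.mem_filter, hK]
    exact ⟨isChain_chainSupport c, card_chainSupport c⟩
  · intro G hG
    rw [Finset.mem_filter, hK] at hG
    obtain ⟨c, hc⟩ := exists_chainSupport_eq hG.1 hG.2
    exact ⟨c, Finset.mem_univ _, hc⟩

/-- The reduced Betti numbers of a poset whose order complex is pure and shellable. -/
theorem IsReverseShelling.reducedBetti_eq [IsDomain k]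
    {S : List (Finset P)} (hS : IsReverseShelling S)
    {d : ℕ} (hcard : ∀ F ∈ S, F.card = d) {K : Finset (Finset P)}
    (hK : ∀ G : Finset P, G ∈ K ↔ IsChain (· ≤ ·) (G : Set P))
    (hKS : ∀ G, G ∈ K ↔ ∃ F ∈ S, G ⊆ F) {b : ℕ}
    (hχ : ∑ G ∈ K, (-1 : ℤ) ^ G.card = (-1) ^ d * b)
    (i : ℤ) : reducedBetti k P i = if i = (d : ℤ) - 1 then b else 0 := by
  have hchain : ∀ G : Finset P, IsChain (· ≤ ·) (G : Set P) ↔ ∃ F ∈ S, G ⊆ F := fun G => by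
    rw [← hK, hKS]
  have hsupp : ∀ {m : ℕ} (g : Fin m ↪o P), ∃ F ∈ S, chainSupport g ⊆ F := fun g =>
    (hchain _).1 (isChain_chainSupport g)
  have hlow : ∀ m < d, orderCycles k P m ≤ LinearMap.range (orderBoundary k P m) :=
    fun m hm z hz => hS.mem_range_orderBoundary hcard (fun F hF => (hchain F).2 ⟨F, hF, subset_rfl⟩)
      hm z hz fun g _ => hsupp g
  have hhigh : ∀ m, d < m → IsEmpty (Fin m ↪o P) := fun m hm => ⟨fun g => by
    obtain ⟨F, hF, hgF⟩ := hsupp g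
    have := Finset.card_le_card hgF
    rw [card_chainSupport, hcard F hF] at this
    omega⟩
  -- Below degree `d` cycles are boundaries, so rank-nullity determines the ranks of the cycles
  -- recursively as alternating sums of numbers of chains.
  have hrank : ∀ m ≤ d, (Module.finrank k (orderCycles k P m) : ℤ) =
      (-1) ^ m * ∑ j ∈ Finset.range (m + 1), (-1 : ℤ) ^ j * Nat.card (Fin j ↪o P) := by
    intro m
    induction m with
    | zero =>
      intro _
      have : Module.finrank k (orderCycles k P 0) = Nat.card (Fin 0 ↪o P) := by
        rw [← finrank_orderChain (k := k)]
        exact finrank_top _ _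
      simp [this]
    | succ m ih =>
      intro hm
      have h1 := finrank_orderCycles_succ (P := P) (k := k) m
      have h2 : LinearMap.range (orderBoundary k P m) = orderCycles k P m := by
        refine le_antisymm ?_ (hlow m hm)
        rintro _ ⟨y, rfl⟩
        exact orderBoundary_mem_orderCycles y
      rw [h2] at h1
      rw [Finset.sum_range_succ, ← h1, mul_add, ← mul_assoc, ← pow_add,
        Even.neg_one_pow ⟨_, rfl⟩, one_mul, pow_succ, mul_neg_one, neg_mul, ← ih (by omega)]
      push_cast
      ring
  have hfib : ∑ G ∈ K, (-1 : ℤ) ^ G.card =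
      ∑ j ∈ Finset.range (d + 1), (-1 : ℤ) ^ j * Nat.card (Fin j ↪o P) := by
    rw [← Finset.sum_fiberwise_of_maps_to (t := Finset.range (d + 1)) (g := Finset.card)]
    · refine Finset.sum_congr rfl fun j _ => ?_
      rw [card_orderEmbedding hK, Finset.sum_congr rfl fun G hG => by
        rw [(Finset.mem_filter.1 hG).2], Finset.sum_const, nsmul_eq_mul, mul_comm]
    · intro G hG
      obtain ⟨F, hF, hGF⟩ := (hKS G).1 hG
      rw [Finset.mem_range, Nat.lt_succ_iff, ← hcard F hF]
      exact Finset.card_le_card hGF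
  have htop : Module.finrank k (orderCycles k P d) = b := by
    have := hrank d le_rfl
    rw [← hfib, hχ, ← mul_assoc, ← pow_add, Even.neg_one_pow ⟨_, rfl⟩, one_mul] at this
    exact_mod_cast this
  rw [reducedBetti]
  split_ifs with h1 h2 h2
  · omega
  · rfl
  · subst h2
    have hd : ((d : ℤ) - 1 + 1).toNat = d := by simp
    rw [hd, subquotientRank]
    have := hhigh (d + 1) (Nat.lt_succ_self d)
    have hbot : LinearMap.range (orderBoundary k P d) = ⊥ := by
      rw [Submodule.eq_bot_iff]
      rintro _ ⟨y, rfl⟩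
      rw [Subsingleton.elim y 0, map_zero]
    rw [hbot, ← htop]
    have hb' : (⊥ : Submodule k (OrderChain k P d)).submoduleOf (orderCycles k P d) = ⊥ := by
      simp [Submodule.submoduleOf]
    exact (Submodule.quotEquivOfEqBot _ hb').finrank_eq
  · obtain ⟨m, rfl⟩ : ∃ m : ℕ, i = (m : ℤ) - 1 := ⟨(i + 1).toNat, by omega⟩
    have hm : ((m : ℤ) - 1 + 1).toNat = m := by simp
    rw [hm, subquotientRank]
    have hmd : m ≠ d := fun e => h2 (by rw [e])
    rcases lt_or_gt_of_ne hmd with hlt | hgt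
    · have : Subsingleton (Subquotient (orderCycles k P m)
          (LinearMap.range (orderBoundary k P m))) :=
        Submodule.Quotient.subsingleton_iff.2
          (Submodule.comap_subtype_eq_top.2 (hlow m hlt))
      exact Module.finrank_zero_of_subsingleton
    · have := hhigh m hgt
      exact Module.finrank_zero_of_subsingleton

end Homology

/-! ### The Euler characteristic of the proper part -/

section ChainSum

variable {Q : Type*} [PartialOrder Q] [Fintype Q]

open Classical in
/-- The chains all of whose elements lie strictly below a given element. -/
def chainsBelow (ρ : Q) : Finset (Finset Q) :=
  Finset.univ.filter fun G => IsChain (· ≤ ·) (G : Set Q) ∧ ∀ x ∈ G, x < ρ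

theorem mem_chainsBelow {ρ : Q} {G : Finset Q} :
    G ∈ chainsBelow ρ ↔ IsChain (· ≤ ·) (G : Set Q) ∧ ∀ x ∈ G, x < ρ := by
  simp [chainsBelow]

/-- Sort the nonempty chains by their largest element `π`; removing it leaves a chain below `π` and
changes the sign. -/
theorem sum_chainsBelow_eq [DecidableLT Q] (ρ : Q) :
    ∑ G ∈ chainsBelow ρ, (-1 : ℤ) ^ G.card =
      1 - ∑ π with π < ρ, ∑ G ∈ chainsBelow π, (-1 : ℤ) ^ G.card := by
  classical
  have hempty : ∅ ∈ chainsBelow ρ := by simp [mem_chainsBelow]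
  rw [← Finset.add_sum_erase _ _ hempty, Finset.card_empty, pow_zero, sub_eq_add_neg,
    add_right_inj, Finset.sum_sigma', ← Finset.sum_neg_distrib]
  symm
  have hnot : ∀ (π : Q), ∀ G ∈ chainsBelow π, π ∉ G := fun π G hG h =>
    lt_irrefl _ ((mem_chainsBelow.1 hG).2 π h)
  refine Finset.sum_bij (fun x _ => insert x.1 x.2) ?_ ?_ ?_ ?_
  · rintro ⟨π, G⟩ h
    simp only [Finset.mem_sigma, Finset.mem_filter, Finset.mem_univ, true_and,
      mem_chainsBelow] at h
    refine Finset.mem_erase.2 ⟨Finset.insert_ne_empty _ _, mem_chainsBelow.2 ⟨?_, ?_⟩⟩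
    · rw [Finset.coe_insert]
      exact h.2.1.insert fun b hb _ => Or.inr (h.2.2 b hb).le
    · intro x hx
      rcases Finset.mem_insert.1 hx with rfl | hx
      · exact h.1
      · exact (h.2.2 x hx).trans h.1
  · rintro ⟨π, G⟩ h ⟨π', G'⟩ h' he
    simp only [Finset.mem_sigma, Finset.mem_filter, Finset.mem_univ, true_and] at h h' he
    have hπ : π = π' := by
      have h1 : π ∈ insert π' G' := he ▸ Finset.mem_insert_self _ _
      have h2 : π' ∈ insert π G := he ▸ Finset.mem_insert_self _ _
      rcases Finset.mem_insert.1 h1 with e | h1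
      · exact e
      rcases Finset.mem_insert.1 h2 with e | h2
      · exact e.symm
      exact absurd (((mem_chainsBelow.1 h'.2).2 _ h1).trans ((mem_chainsBelow.1 h.2).2 _ h2))
        (lt_irrefl _)
    subst hπ
    rw [← Finset.erase_insert (hnot _ _ h.2), he, Finset.erase_insert (hnot _ _ h'.2)]
  · intro G hG
    rw [Finset.mem_erase, mem_chainsBelow, ← Finset.nonempty_iff_ne_empty] at hG
    obtain ⟨hne, hch, hlt⟩ := hG
    obtain ⟨π, hπ, hmax⟩ := G.exists_maximal hne
    have hle : ∀ x ∈ G, x ≤ π := fun x hx => (hch.total hx hπ).elim id fun h => hmax hx h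
    refine ⟨⟨π, G.erase π⟩, ?_, Finset.insert_erase hπ⟩
    simp only [Finset.mem_sigma, Finset.mem_filter, Finset.mem_univ, true_and, mem_chainsBelow]
    refine ⟨hlt π hπ, hch.mono (Finset.coe_subset.2 (Finset.erase_subset _ _)), fun x hx => ?_⟩
    rw [Finset.mem_erase] at hx
    exact lt_of_le_of_ne (hle x hx.2) hx.1
  · rintro ⟨π, G⟩ h
    rw [Finset.card_insert_of_notMem (hnot _ _ (Finset.mem_sigma.1 h).2), pow_succ]
    simp

/-- Möbius inversion: the alternating number of chains below an element is determined by its sums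
over lower intervals. -/
theorem sum_chainsBelow_eq_of_sum_le [DecidableLE Q] {w : Q → ℤ}
    (hw : ∀ ρ, ∑ π with π ≤ ρ, w π = 1) (ρ : Q) :
    ∑ G ∈ chainsBelow ρ, (-1 : ℤ) ^ G.card = w ρ := by
  classical
  induction ρ using WellFoundedLT.induction with
  | ind ρ ih =>
    have hsplit : (Finset.univ.filter fun π => π ≤ ρ) =
        insert ρ (Finset.univ.filter fun π => π < ρ) := by
      ext π
      simp [le_iff_eq_or_lt]
    have h := hw ρ
    rw [hsplit, Finset.sum_insert (by simp)] at h
    rw [sum_chainsBelow_eq, Finset.sum_congr rfl fun π hπ => ih π (Finset.mem_filter.1 hπ).2,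
      sub_eq_iff_eq_add, h]

theorem sum_chains_proper [OrderTop Q] {K : Finset (Finset {q : Q // q ≠ ⊤})}
    (hK : ∀ G, G ∈ K ↔ IsChain (· ≤ ·) (G : Set {q : Q // q ≠ ⊤})) :
    ∑ G ∈ K, (-1 : ℤ) ^ G.card = ∑ G ∈ chainsBelow (⊤ : Q), (-1 : ℤ) ^ G.card := by
  classical
  refine Finset.sum_bij (fun G _ => G.map (Function.Embedding.subtype _)) ?_
    (fun G _ G' _ h => Finset.map_injective _ h) ?_ (fun G _ => by rw [Finset.card_map])
  · intro G hG
    rw [mem_chainsBelow, Finset.coe_map]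
    refine ⟨?_, fun x hx => ?_⟩
    · rintro _ ⟨x, hx, rfl⟩ _ ⟨y, hy, rfl⟩ _
      exact ((hK G).1 hG).total hx hy
    · obtain ⟨y, -, rfl⟩ := Finset.mem_map.1 hx
      exact lt_top_iff_ne_top.2 y.2
  · intro G hG
    rw [mem_chainsBelow] at hG
    have hne : ∀ x ∈ G, x ≠ ⊤ := fun x hx => (hG.2 x hx).ne
    refine ⟨G.subtype fun q => q ≠ ⊤, (hK _).2 ?_, Finset.subtype_map_of_mem hne⟩
    intro x hx y hy _
    exact hG.1.total (Finset.mem_subtype.1 hx) (Finset.mem_subtype.1 hy)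

end ChainSum

/-! ### Weighted sums over partitions into even blocks. -/

section EvenFamily

variable {α β : Type*}

/-- `A` is a partition of `S` into blocks of even size on which `f` is constant. -/
structure IsEvenFamily (f : α → β) (S : Finset α) (A : Finset (Finset α)) : Prop where
  nonempty : ∀ B ∈ A, B.Nonempty
  subset : ∀ B ∈ A, B ⊆ S
  even : ∀ B ∈ A, Even B.card
  const : ∀ B ∈ A, ∀ y ∈ B, ∀ z ∈ B, f y = f z
  exists_mem : ∀ a ∈ S, ∃ B ∈ A, a ∈ B
  unique : ∀ B ∈ A, ∀ B' ∈ A, ∀ a, a ∈ B → a ∈ B' → B = B'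

variable [DecidableEq α] {f : α → β} {S T : Finset α} {A : Finset (Finset α)}

theorem IsEvenFamily.insert (hA : IsEvenFamily f (S \ T) A) (hne : T.Nonempty) (hTS : T ⊆ S)
    (hT : Even T.card) (hf : ∀ y ∈ T, ∀ z ∈ T, f y = f z) :
    IsEvenFamily f S (Insert.insert T A) where
  nonempty := by
    rw [Finset.forall_mem_insert]
    exact ⟨hne, hA.nonempty⟩
  subset := by
    rw [Finset.forall_mem_insert]
    exact ⟨hTS, fun B hB => (hA.subset B hB).trans Finset.sdiff_subset⟩
  even := by
    rw [Finset.forall_mem_insert]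
    exact ⟨hT, hA.even⟩
  const := by
    rw [Finset.forall_mem_insert]
    exact ⟨hf, hA.const⟩
  exists_mem a ha := by
    by_cases haT : a ∈ T
    · exact ⟨T, Finset.mem_insert_self _ _, haT⟩
    · obtain ⟨B, hB, haB⟩ := hA.exists_mem a (Finset.mem_sdiff.2 ⟨ha, haT⟩)
      exact ⟨B, Finset.mem_insert_of_mem hB, haB⟩
  unique := by
    have key : ∀ B ∈ A, ∀ a ∈ B, a ∉ T := fun B hB a ha =>
      (Finset.mem_sdiff.1 (hA.subset B hB ha)).2
    rw [Finset.forall_mem_insert]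
    refine ⟨?_, fun B hB => ?_⟩
    · rw [Finset.forall_mem_insert]
      exact ⟨fun _ _ _ => rfl, fun B hB a ha ha' => absurd ha (key B hB a ha')⟩
    · rw [Finset.forall_mem_insert]
      exact ⟨fun a ha ha' => absurd ha' (key B hB a ha), hA.unique B hB⟩

theorem IsEvenFamily.erase (hA : IsEvenFamily f S A) (hT : T ∈ A) :
    IsEvenFamily f (S \ T) (A.erase T) where
  nonempty B hB := hA.nonempty B (Finset.mem_of_mem_erase hB)
  subset B hB a ha := Finset.mem_sdiff.2 ⟨hA.subset B (Finset.mem_of_mem_erase hB) ha,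
    fun haT => Finset.ne_of_mem_erase hB
      (hA.unique _ (Finset.mem_of_mem_erase hB) _ hT a ha haT)⟩
  even B hB := hA.even B (Finset.mem_of_mem_erase hB)
  const B hB := hA.const B (Finset.mem_of_mem_erase hB)
  exists_mem a ha := by
    rw [Finset.mem_sdiff] at ha
    obtain ⟨B, hB, haB⟩ := hA.exists_mem a ha.1
    exact ⟨B, Finset.mem_erase.2 ⟨fun e => ha.2 (e ▸ haB), hB⟩, haB⟩
  unique B hB B' hB' :=
    hA.unique B (Finset.mem_of_mem_erase hB) B' (Finset.mem_of_mem_erase hB')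

-- Fix `x` and choose its block `T`, an even subset of the fibre of `f` through `x`. By induction
-- the remaining blocks sum to one, and the hypothesis `hc` sums the weights of `T` to one.
open Classical in
theorem sum_isEvenFamily_eq_one [Fintype α] {c : ℕ → ℤ}
    (hc : ∀ (D : Finset α) (x : α), x ∈ D → Even D.card →
      ∑ T ∈ D.powerset with x ∈ T ∧ Even T.card, c T.card = 1)
    (S : Finset α) (hS : ∀ b, Even (S.filter fun a => f a = b).card) :
    ∑ A with IsEvenFamily f S A, ∏ B ∈ A, c B.card = 1 := by
  induction S using Finset.strongInduction with
  | H S ih =>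
    rcases S.eq_empty_or_nonempty with rfl | ⟨x, hx⟩
    · have : (Finset.univ.filter fun A => IsEvenFamily f ∅ A) = {∅} := by
        ext A
        simp only [Finset.mem_filter, Finset.mem_univ, true_and, Finset.mem_singleton]
        constructor
        · intro hA
          refine Finset.eq_empty_of_forall_notMem fun B hB => ?_
          exact (hA.nonempty B hB).ne_empty (Finset.subset_empty.1 (hA.subset B hB))
        · rintro rfl
          constructor <;> simp
      rw [this, Finset.sum_singleton, Finset.prod_empty]
    · let D := S.filter fun a => f a = f x
      have hxD : x ∈ D := Finset.mem_filter.2 ⟨hx, rfl⟩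
      rw [← hc D x hxD (hS (f x))]
      have hT : ∀ T ∈ D.powerset.filter (fun T => x ∈ T ∧ Even T.card), c T.card =
          ∑ A with IsEvenFamily f (S \ T) A, c T.card * ∏ B ∈ A, c B.card := by
        intro T hT
        rw [Finset.mem_filter, Finset.mem_powerset] at hT
        obtain ⟨hTD, hxT, hTe⟩ := hT
        have hTS : T ⊆ S := hTD.trans (Finset.filter_subset _ _)
        rw [← Finset.mul_sum, ih (S \ T), mul_one]
        · exact Finset.sdiff_ssubset hTS ⟨x, hxT⟩
        · intro b
          have h1 : ((S \ T).filter fun a => f a = b) =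
              (S.filter fun a => f a = b) \ T.filter fun a => f a = b := by
            ext a
            simp only [Finset.mem_filter, Finset.mem_sdiff]
            tauto
          have h2 : (T.filter fun a => f a = b) ⊆ S.filter fun a => f a = b :=
            Finset.filter_subset_filter _ hTS
          rw [h1, Finset.card_sdiff_of_subset h2, Nat.even_sub (Finset.card_le_card h2)]
          refine iff_of_true (hS b) ?_
          by_cases hb : b = f x
          · rwa [Finset.filter_true_of_mem fun a ha => (Finset.mem_filter.1 (hTD ha)).2.trans hb.symm]
          · rw [Finset.filter_false_of_mem fun a ha e => hb
              (e.symm.trans (Finset.mem_filter.1 (hTD ha)).2)]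
            simp
      rw [Finset.sum_congr rfl hT, Finset.sum_sigma']
      symm
      have hnot : ∀ T A, x ∈ T → IsEvenFamily f (S \ T) A → T ∉ A := fun T A hxT hA hTA =>
        (Finset.mem_sdiff.1 (hA.subset T hTA hxT)).2 hxT
      refine Finset.sum_bij (fun y _ => Insert.insert y.1 y.2) ?_ ?_ ?_ ?_
      · rintro ⟨T, A⟩ h
        simp only [Finset.mem_sigma, Finset.mem_filter, Finset.mem_univ, true_and,
          Finset.mem_powerset] at h ⊢
        obtain ⟨⟨hTD, hxT, hTe⟩, hA⟩ := h
        exact hA.insert ⟨x, hxT⟩ (hTD.trans (Finset.filter_subset _ _)) hTe fun y hy z hz =>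
          (Finset.mem_filter.1 (hTD hy)).2.trans (Finset.mem_filter.1 (hTD hz)).2.symm
      · rintro ⟨T, A⟩ h ⟨T', A'⟩ h' he
        simp only [Finset.mem_sigma, Finset.mem_filter, Finset.mem_univ, true_and,
          Finset.mem_powerset] at h h' he
        obtain ⟨⟨hTD, hxT, hTe⟩, hA⟩ := h
        obtain ⟨⟨hTD', hxT', hTe'⟩, hA'⟩ := h'
        have hTT : T = T' := by
          have h1 : T ∈ Insert.insert T' A' := he ▸ Finset.mem_insert_self _ _
          refine (Finset.mem_insert.1 h1).resolve_right fun h2 => ?_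
          exact (Finset.mem_sdiff.1 (hA'.subset T h2 hxT)).2 hxT'
        subst hTT
        rw [← Finset.erase_insert (hnot T A hxT hA), he, Finset.erase_insert (hnot T A' hxT hA')]
      · intro A hA
        simp only [Finset.mem_filter, Finset.mem_univ, true_and] at hA
        obtain ⟨T, hTA, hxT⟩ := hA.exists_mem x hx
        refine ⟨⟨T, A.erase T⟩, ?_, Finset.insert_erase hTA⟩
        simp only [Finset.mem_sigma, Finset.mem_filter, Finset.mem_univ, true_and,
          Finset.mem_powerset]
        refine ⟨⟨fun a ha => Finset.mem_filter.2 ⟨hA.subset T hTA ha, hA.const T hTA a ha x hxT⟩,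
          hxT, hA.even T hTA⟩, hA.erase hTA⟩
      · rintro ⟨T, A⟩ h
        simp only [Finset.mem_sigma, Finset.mem_filter, Finset.mem_univ, true_and,
          Finset.mem_powerset] at h
        rw [Finset.prod_insert (hnot T A h.1.2.1 h.2)]

end EvenFamily

/-- The signed Euler number which is the weight of a block of a given size. -/
def blockWeight (m : ℕ) : ℤ := (-1) ^ (m / 2 - 1) * eulerNumber (m - 1)

/-- Removing `x` turns the blocks into the odd subsets of a set of odd size `2n + 1`. Grouping them
by size gives the recurrence for the Euler numbers. -/
theorem sum_blockWeight {α : Type*} [DecidableEq α] (D : Finset α) (x : α) (hx : x ∈ D)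
    (hD : Even D.card) :
    ∑ T ∈ D.powerset with x ∈ T ∧ Even T.card, blockWeight T.card = 1 := by
  let F : ℕ → ℤ := fun m => if Even m then 0 else blockWeight (m + 1)
  have h1 : ∑ T ∈ D.powerset with x ∈ T ∧ Even T.card, blockWeight T.card =
      ∑ U ∈ (D.erase x).powerset, F U.card := by
    have hF : ∑ U ∈ (D.erase x).powerset, F U.card =
        ∑ U ∈ (D.erase x).powerset with ¬ Even U.card, blockWeight (U.card + 1) := by
      rw [Finset.sum_filter]
      refine Finset.sum_congr rfl fun U _ => ?_
      simp only [F]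
      split_ifs <;> simp_all
    rw [hF]
    symm
    refine Finset.sum_bij' (fun U _ => insert x U) (fun T _ => T.erase x) ?_ ?_ ?_ ?_ ?_
    · intro U hU
      simp only [Finset.mem_filter, Finset.mem_powerset] at hU ⊢
      have hxU : x ∉ U := fun h => Finset.notMem_erase x D (hU.1 h)
      refine ⟨Finset.insert_subset hx (hU.1.trans (Finset.erase_subset _ _)),
        Finset.mem_insert_self _ _, ?_⟩
      rw [Finset.card_insert_of_notMem hxU, Nat.even_add_one]
      exact hU.2
    · intro T hT
      simp only [Finset.mem_filter, Finset.mem_powerset] at hT ⊢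
      refine ⟨Finset.erase_subset_erase _ hT.1, ?_⟩
      rw [← Nat.even_add_one, Finset.card_erase_add_one hT.2.1]
      exact hT.2.2
    · intro U hU
      simp only [Finset.mem_filter, Finset.mem_powerset] at hU
      exact Finset.erase_insert fun h => Finset.notMem_erase x D (hU.1 h)
    · intro T hT
      simp only [Finset.mem_filter] at hT
      exact Finset.insert_erase hT.2.1
    · intro U hU
      simp only [Finset.mem_filter, Finset.mem_powerset] at hU
      rw [Finset.card_insert_of_notMem fun h => Finset.notMem_erase x D (hU.1 h)]
  obtain ⟨k, hk⟩ := hD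
  have hpos : 0 < D.card := Finset.card_pos.2 ⟨x, hx⟩
  obtain ⟨n, rfl⟩ : ∃ n, k = n + 1 := ⟨k - 1, by omega⟩
  have hcard : (D.erase x).card = 2 * n + 1 := by
    rw [Finset.card_erase_of_mem hx]
    omega
  have h2 : ∀ (f : ℕ → ℤ) (N : ℕ), ∑ m ∈ Finset.range (2 * N), f m =
      ∑ j ∈ Finset.range N, (f (2 * j) + f (2 * j + 1)) := by
    intro f N
    induction N with
    | zero => simp
    | succ N ih => rw [mul_add, Finset.sum_range_succ, Finset.sum_range_succ, ih,
        Finset.sum_range_succ, add_assoc]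
  rw [h1, Finset.sum_powerset_apply_card, hcard, show 2 * n + 1 + 1 = 2 * (n + 1) by ring, h2,
    ← sum_choose_mul_eulerNumber n]
  refine Finset.sum_congr rfl fun j _ => ?_
  have hj : (2 * j + 1 + 1) / 2 - 1 = j := by omega
  simp only [F, even_two_mul, if_true, smul_zero, zero_add, Nat.not_even_bit1, if_false,
    blockWeight, hj, Nat.add_sub_cancel, nsmul_eq_mul]
  push_cast
  ring

namespace EvenPartition

variable {n : ℕ}

-- The refinements of `ρ` are the partitions into even blocks on which `ρ.1.part` is constant, so
-- the general summation applies with this function as `f`.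
open Classical in
theorem sum_prod_blockWeight (ρ : EvenPartition n) :
    ∑ π : EvenPartition n with π ≤ ρ, ∏ B ∈ π.1.parts, blockWeight B.card = 1 := by
  rw [← sum_isEvenFamily_eq_one (f := ρ.1.part) (fun D x hx hD => sum_blockWeight D x hx hD)
    Finset.univ fun b => ?_]
  · refine Finset.sum_bij (fun π _ => π.1.parts) ?_ ?_ ?_ fun _ _ => rfl
    · intro π hπ
      simp only [Finset.mem_filter, Finset.mem_univ, true_and] at hπ ⊢
      refine ⟨fun B hB => π.1.nonempty_of_mem_parts hB, fun B _ => Finset.subset_univ B, π.2,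
        fun B hB y hy z hz => ?_, fun a _ => ⟨π.1.part a, π.1.part_mem.2 (Finset.mem_univ a),
          π.1.mem_part_univ a⟩, fun B hB B' hB' a ha ha' => ?_⟩
      · refine part_eq_of_mem (le_iff_mem_part.1 hπ y z ?_)
        rwa [π.1.part_eq_of_mem hB hz]
      · rw [← π.1.part_eq_of_mem hB ha, π.1.part_eq_of_mem hB' ha']
    · intro π _ π' _ h
      exact Subtype.ext (Finpartition.ext h)
    · intro A hA
      simp only [Finset.mem_filter, Finset.mem_univ, true_and] at hA
      let π : Finpartition (Finset.univ : Finset (Fin (2 * n))) :=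
        Finpartition.ofExistsUnique A hA.subset (fun a ha => by
          obtain ⟨B, hB, haB⟩ := hA.exists_mem a ha
          exact ⟨B, ⟨hB, haB⟩, fun B' h => hA.unique B' h.1 B hB a h.2 haB⟩)
          fun h => (hA.nonempty ∅ h).ne_empty rfl
      refine ⟨⟨π, hA.even⟩, ?_, rfl⟩
      simp only [Finset.mem_filter, Finset.mem_univ, true_and]
      refine le_iff_mem_part.2 fun a b hab => ?_
      have := hA.const (π.part b) (π.part_mem.2 (Finset.mem_univ b)) a hab b (π.mem_part_univ b)
      rw [← this]
      exact ρ.1.mem_part_univ a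
  · suffices h : Even (Finset.univ.filter fun a => ρ.1.part a = b).card by convert h
    rcases (Finset.univ.filter fun a => ρ.1.part a = b).eq_empty_or_nonempty with h | ⟨a, ha⟩
    · rw [h]
      simp
    · rw [Finset.mem_filter] at ha
      have : (Finset.univ.filter fun a => ρ.1.part a = b) = ρ.1.part a := by
        ext a'
        rw [Finset.mem_filter, ρ.1.mem_part_iff_part_eq_part (by simp) (by simp), ha.2]
        simp
      rw [this]
      exact ρ.even_card_part a

/-- By Möbius inversion the sum is the weight of the top element, whose single block has size `2n`.
-/
theorem sum_chains (hn : 1 ≤ n) {K : Finset (Finset (EvenPartitionProper n))}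
    (hK : ∀ G, G ∈ K ↔ IsChain (· ≤ ·) (G : Set (EvenPartitionProper n))) :
    ∑ G ∈ K, (-1 : ℤ) ^ G.card = (-1) ^ (n - 1) * eulerNumber (2 * n - 1) := by
  classical
  rw [sum_chains_proper hK,
    sum_chainsBelow_eq_of_sum_le (w := fun π => ∏ B ∈ π.1.parts, blockWeight B.card)
      fun ρ => by convert sum_prod_blockWeight ρ]
  have hsub : (⊤ : EvenPartition n).1.parts ⊆ {Finset.univ} :=
    Finpartition.parts_top_subset (Finset.univ : Finset (Fin (2 * n)))
  have : (⊤ : EvenPartition n).1.parts = {Finset.univ} :=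
    Finset.eq_of_subset_of_card_le hsub (by rw [card_parts_top hn, Finset.card_singleton])
  rw [this, Finset.prod_singleton, Finset.card_univ, Fintype.card_fin, blockWeight,
    Nat.mul_div_cancel_left n two_pos]

end EvenPartition

/-! ### The main theorem -/

namespace EvenPartition

variable {n : ℕ}

theorem exists_isRecursiveAtomOrdering (n : ℕ) :
    ∃ l : List (EvenPartition n), l.Pairwise (fun π ρ => π.word < ρ.word) ∧
      IsRecursiveAtomOrdering (⊥ : WithBot (EvenPartition n)) (l.map (↑)) := by
  obtain ⟨l, hl, hmem⟩ := exists_list_isMin n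
  exact ⟨l, hl, isRecursiveAtomOrdering hl hmem⟩

theorem isPureOfDim (hn : 1 ≤ n) :
    (orderComplex (EvenPartitionProper n)).IsPureOfDim ((n : ℤ) - 2) := by
  intro F hF
  rcases hn.eq_or_lt with rfl | hn
  · have := isEmpty_proper
    obtain ⟨x, -⟩ := hF.prop.1
    exact isEmptyElim x
  · have := card_of_isFacet hn hF
    omega

/-- A shelling of the order complex of the proper part, in reverse order, where for `n = 1` the
empty face is the only facet. -/
theorem exists_isReverseShelling (hn : 1 ≤ n) :
    ∃ S : List (Finset (EvenPartitionProper n)), S ≠ [] ∧ IsReverseShelling S ∧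
      (∀ F ∈ S, F.card = n - 1) ∧
      ∀ G : Finset (EvenPartitionProper n),
        IsChain (· ≤ ·) (G : Set (EvenPartitionProper n)) ↔ ∃ F ∈ S, G ⊆ F := by
  rcases hn.eq_or_lt with rfl | hn
  · have := isEmpty_proper
    refine ⟨[∅], by simp, .cons _ _ .nil (by simp), by simp, fun G => ?_⟩
    rw [Finset.eq_empty_of_isEmpty G]
    simp
  · have := nonempty_proper hn
    obtain ⟨l₀, -, hl₀⟩ := exists_isRecursiveAtomOrdering n
    obtain ⟨l, ⟨-, hl, -⟩, hS⟩ := exists_isShelling_of_isRecursiveAtomOrdering hl₀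
    have hmem : ∀ F, F ∈ l.reverse ↔ (orderComplex (EvenPartitionProper n)).IsFacet F := fun F => by
      rw [List.mem_reverse, hl]
    have hext : ∀ G : Finset (EvenPartitionProper n),
        G ∈ orderComplex (EvenPartitionProper n) → ∃ F ∈ l.reverse, G ⊆ F := by
      intro G hG
      obtain ⟨F, hGF, hF⟩ :=
        (Set.toFinite {F | F ∈ orderComplex (EvenPartitionProper n)}).exists_le_maximal hG
      exact ⟨F, (hmem F).2 hF, hGF⟩
    have hex : ∀ G : Finset (EvenPartitionProper n),
        IsChain (· ≤ ·) (G : Set (EvenPartitionProper n)) → ∃ F ∈ l.reverse, G ⊆ F := by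
      intro G hG
      rcases G.eq_empty_or_nonempty with rfl | hne
      · obtain ⟨x⟩ := ‹Nonempty (EvenPartitionProper n)›
        obtain ⟨F, hF, -⟩ := hext {x} ((orderComplex _).singleton_mem x)
        exact ⟨F, hF, Finset.empty_subset _⟩
      · exact hext G ⟨hne, hG⟩
    refine ⟨l.reverse, ?_, hS, fun F hF => ?_, fun G => ⟨hex G, ?_⟩⟩
    · obtain ⟨F, hF, -⟩ := hex ∅ (by simp)
      exact List.ne_nil_of_mem hF
    · have := card_of_isFacet hn ((hmem F).1 hF)
      omega
    · rintro ⟨F, hF, hGF⟩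
      exact ((hmem F).1 hF).prop.2.mono (Finset.coe_subset.2 hGF)

theorem shellable (hn : 1 ≤ n) : (orderComplex (EvenPartitionProper n)).Shellable := by
  rcases hn.eq_or_lt with rfl | hn
  · have := isEmpty_proper
    -- For `n = 1` the complex has no nonempty faces, hence no facets, and the empty list is a
    -- shelling.
    refine ⟨[], by simp, fun F => ?_, fun k => k.elim0⟩
    simp only [List.not_mem_nil, false_iff]
    intro hF
    obtain ⟨x, -⟩ := hF.prop.1
    exact isEmptyElim x
  · have := nonempty_proper hn
    obtain ⟨l₀, -, hl₀⟩ := exists_isRecursiveAtomOrdering n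
    obtain ⟨l, hl, -⟩ := exists_isShelling_of_isRecursiveAtomOrdering hl₀
    exact ⟨l, hl⟩

theorem eulerNumber_two_mul_sub_one_pos (hn : 1 ≤ n) : 0 < eulerNumber (2 * n - 1) := by
  obtain ⟨k, rfl⟩ : ∃ k, n = k + 1 := ⟨n - 1, by omega⟩
  exact eulerNumber_pos k

theorem nonempty_homotopyEquiv (hn : 1 ≤ n) :
    Nonempty ((orderComplex (EvenPartitionProper n)).realization ≃ₕ
      SphereWedge (eulerNumber (2 * n - 1)) (n - 1)) := by
  classical
  rcases hn.eq_or_lt with rfl | hn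
  · have := isEmpty_proper
    have h1 : IsEmpty (orderComplex (EvenPartitionProper 1)).realization :=
      ⟨fun w => by
        obtain ⟨-, s, hs, -⟩ := w.2
        obtain ⟨x, -⟩ := hs.1
        exact isEmptyElim x⟩
    have h2 : IsEmpty (SphereWedge (eulerNumber (2 * 1 - 1)) (1 - 1)) :=
      ⟨fun q => by
        obtain ⟨⟨i, x⟩, -⟩ := Quotient.exists_rep q
        have hx : ‖x.1‖ = 1 := mem_sphere_zero_iff_norm.1 x.2
        have hx0 : x.1 = 0 := by
          ext j
          exact j.elim0
        rw [hx0, norm_zero] at hx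
        exact zero_ne_one hx⟩
    exact ⟨(Homeomorph.empty).toHomotopyEquiv⟩
  · obtain ⟨S, hne, hS, hcard, hchain⟩ := exists_isReverseShelling (n := n) (by omega)
    let K : Finset (Finset (EvenPartitionProper n)) :=
      Finset.univ.filter fun G => IsChain (· ≤ ·) (G : Set (EvenPartitionProper n))
    have hK : ∀ G, G ∈ K ↔ IsChain (· ≤ ·) (G : Set (EvenPartitionProper n)) := fun G => by
      simp [K]
    obtain ⟨d, rfl⟩ : ∃ d, n = d + 2 := ⟨n - 2, by omega⟩
    rw [AbstractSimplicialComplex.realization_eq _ K fun s hs => by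
      rw [hK, mem_orderComplex]
      exact (and_iff_right hs).symm]
    exact hS.nonempty_homotopyEquiv (d := d) hne hcard (fun G => (hK G).trans (hchain G))
      (eulerNumber_two_mul_sub_one_pos (by omega)) (sum_chains (by omega) hK)

theorem reducedBetti_eq (k : Type*) [CommRing k] [IsDomain k] (hn : 1 ≤ n) (i : ℤ) :
    reducedBetti k (EvenPartitionProper n) i =
      if i = (n : ℤ) - 2 then eulerNumber (2 * n - 1) else 0 := by
  classical
  obtain ⟨S, -, hS, hcard, hchain⟩ := exists_isReverseShelling hn
  let K : Finset (Finset (EvenPartitionProper n)) :=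
    Finset.univ.filter fun G => IsChain (· ≤ ·) (G : Set (EvenPartitionProper n))
  have hK : ∀ G, G ∈ K ↔ IsChain (· ≤ ·) (G : Set (EvenPartitionProper n)) := fun G => by
    simp [K]
  rw [hS.reducedBetti_eq hcard hK (fun G => (hK G).trans (hchain G)) (sum_chains hn hK)]
  congr 1
  rw [eq_iff_iff]
  push_cast [hn]
  constructor <;> intro h <;> linarith

theorem evenBetti_eq (k : Type*) [CommRing k] [IsDomain k] (hn : 1 ≤ n) :
    evenBetti k n = eulerNumber (2 * n - 1) := by
  rw [evenBetti, reducedBetti_eq k hn, if_pos rfl]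

end EvenPartition

end

theorem mainTheorem2 (k : Type*) [CommRing k] [IsDomain k] :
    (∀ n : ℕ, 1 ≤ n →
      -- the lexicographic order on words is a recursive atom ordering of the poset with a bottom
      (∃ l : List (EvenPartition n),
        l.Pairwise (fun π ρ => π.word < ρ.word) ∧
        IsRecursiveAtomOrdering (⊥ : WithBot (EvenPartition n)) (l.map (↑))) ∧
      -- the proper part is pure and shellable
      (orderComplex (EvenPartitionProper n)).IsPureOfDim ((n : ℤ) - 2) ∧
      (orderComplex (EvenPartitionProper n)).Shellable ∧
      -- homotopy type
      Nonempty ((orderComplex (EvenPartitionProper n)).realization ≃ₕ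
        SphereWedge (eulerNumber (2 * n - 1)) (n - 1)) ∧
      -- reduced Betti numbers
      (∀ i : ℤ, reducedBetti k (EvenPartitionProper n) i =
        if i = (n : ℤ) - 2 then eulerNumber (2 * n - 1) else 0)) ∧
    -- exponential generating functions of the Betti numbers: `-ln cos u`, with derivative `tan u`
    (PowerSeries.mk fun m => if Even m ∧ m ≠ 0 then (evenBetti k (m / 2) : ℚ) / (m ! : ℚ) else 0) =
      -PowerSeries.logOf (PowerSeries.cos ℚ) ∧
    (PowerSeries.mk fun m => if Odd m then (evenBetti k ((m + 1) / 2) : ℚ) / (m ! : ℚ) else 0) *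
      PowerSeries.cos ℚ = PowerSeries.sin ℚ := by
  refine ⟨fun n hn => ⟨EvenPartition.exists_isRecursiveAtomOrdering n,
    EvenPartition.isPureOfDim hn, EvenPartition.shellable hn,
    EvenPartition.nonempty_homotopyEquiv hn, EvenPartition.reducedBetti_eq k hn⟩, ?_, ?_⟩
  · rw [← mk_eulerNumber_pred]
    congr 1
    funext m
    refine if_ctx_congr Iff.rfl (fun h => ?_) fun _ => rfl
    obtain ⟨⟨r, rfl⟩, hm⟩ := h
    have h1 : (r + r) / 2 = r := by omega
    rw [h1, EvenPartition.evenBetti_eq k (by omega), two_mul]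
  · rw [← mk_eulerNumber_mul_cos]
    congr 2
    funext m
    refine if_ctx_congr Iff.rfl (fun h => ?_) fun _ => rfl
    obtain ⟨r, rfl⟩ := h
    have h1 : (2 * r + 1 + 1) / 2 = r + 1 := by omega
    have h2 : 2 * (r + 1) - 1 = 2 * r + 1 := by omega
    rw [h1, EvenPartition.evenBetti_eq k (by omega), h2]
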